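/- **Setting.** A rooted planar map with holes is a finite connected planar map with a root oriented edge, some of whose faces are distinguished as holes; holes have simple, pairwise vertex-disjoint boundaries, and the root face (the face to the right of the root edge) is not a hole. It is a quadrangulation with holes if every face other than the root face and the holes has degree 4. Maps are considered up to isomorphism. For a quadrangulation with holes $\mathfrak p$ and quadrangulations with holes $(u_h)_h$, indexed by the holes of $\mathfrak p$, such that the root face of $u_h$ has degree $\deg h$, let $\mathfrak p\odot(u_h)_h$ be the map obtained by gluing $u_h$ into $h$ along its boundary, the root edge of $u_h$ being identified with a marked edge of $h$. Write $\mathfrak p\subset\mathfrak q$ if $\mathfrak q=\mathfrak p\odot(u_h)_h$ for some $(u_h)_h$. Let $q>0$ and let $\mathfrak Q$ be a $q$-Boltzmann quadrangulation of half-perimeter $1$ on a probability space $(\Omega,\mathcal A,\mathbb P)$: $\mathbb P(\mathfrak Q=\mathfrak m)=q^{|F(\mathfrak m)|}/W_q^1$ for every quadrangulation $\mathfrak m$ without holes whose root face has degree $2$, where the normalising constant $W_q^1$ is finite. Its natural filtration is $\mathcal F_{\mathfrak q}=$ the $\mathbb P$-completion of $\sigma(\{\mathfrak p\subset\mathfrak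 Q\}:\mathfrak p\subset\mathfrak q)$, for $\mathfrak q$ a quadrangulation with holes. **The submap $\mathsf Q$.** The right process on $\mathfrak Q$ starts in the root face $x_0$ and moves from face to face across edges. It first crosses the root edge; having entered a face, it leaves it across the right-most edge (the first one in counterclockwise order around the face, starting from the edge by which it entered) that has not been crossed before in either direction. It stops at the time $\tau_E\ge1$ of its first return to the root face. Let $x_0,x_1,\dots,x_{\tau_E}$ be the visited faces, let $\tau_I$ be the smallest $i\in\{1,\dots,\tau_E\}$ such that $x_i=x_j$ for some $j\in\{1,\dots,\tau_E\}$, $j\ne i$, and let $\tau$ be the last time at which $x_{\tau}=x_{\tau_I}$. The map $\mathsf Q$ consists of the faces visited by the paths $x_0,\dots,x_{\tau_I}$ and $x_{\tau},\dots,x_{\tau_E}$, glued along the edges that these two paths cross and along no other edges (if there is no such $i$, the whole path $x_0,\dots,x_{\tau_E}$ is used). **Claim 1.** The family $(\mathcal F_{\mathfrak q})$ is a complete filtration (monotone for $\subset$), and $\mathfrak Q$ is an $\mathcal F$-Boltzmann map: $\{\mathfrak p\subset\mathfrak Q\}\in\mathcal F_{\mathfrak p}$, and conditionally on $\mathcal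 F_{\mathfrak p}$ and on $\{\mathfrak p\subset\mathfrak Q\}$, the maps that fill the holes of $\mathfrak p$ in $\mathfrak Q$ are independent $q$-Boltzmann maps whose perimeters are the degrees of the holes. Moreover $\mathsf Q$ is an $\mathcal F$-stopping map: almost surely $\mathsf Q\subset\mathfrak Q$, and $\{\mathsf Q\subset\mathfrak q\}\in\mathcal F_{\mathfrak q}$ for every quadrangulation with holes $\mathfrak q$. Thus $\mathsf Q$ has the Markov property: conditionally on $\mathcal F_{\mathsf Q}=\{A\in\bigvee_{\mathfrak q}\mathcal F_{\mathfrak q}: A\cap\{\mathsf Q\subset\mathfrak q\}\in\mathcal F_{\mathfrak q}\ \forall\mathfrak q\}$, the maps that fill the holes of $\mathsf Q$ in $\mathfrak Q$ are independent $q$-Boltzmann maps whose perimeters are the degrees of these holes. **Claim 2.** $\mathsf Q$ cannot be obtained by a randomised peeling algorithm. Such an algorithm uses a random seed $U$ independent of $\mathfrak Q$, with values in an arbitrary measurable space. It starts from $\mathfrak e_0$, the root face (with a hole of degree $2$); given $\mathfrak e_n\subset\mathfrak Q$, it picks, as a measurable function of $U$ and of the map $\mathfrak e_n$, an edge of the boundary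 of a hole of $\mathfrak e_n$, or stops. In the first case $\mathfrak e_{n+1}\subset\mathfrak Q$ is obtained from $\mathfrak e_n$ by revealing what lies behind this edge: either a new face, which is glued to $\mathfrak e_n$ along this edge, or another edge of the boundary of the same hole, with which the picked edge is then identified. In the second case the explored map no longer changes. For every such algorithm, it is false that almost surely $\mathfrak e_n=\mathsf Q$ for some $n\ge0$. -/

import Mathlib

open MeasureTheory ProbabilityTheory
open scoped NNReal ENNReal

noncomputable section

/-! ## Rooted maps with holes -/

/-- A finite family of polygons, glued along some of their sides.

`D` is the set of oriented edges (darts) of the polygons. Every dart lies on the boundary of exactly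
one polygon (a non-hole face of the map), which is on its right, and `face d` is the dart that
follows `d` around this polygon. The involution `opp` describes the gluing: if `opp d ≠ d`, then `d`
and `opp d` are the two orientations of one edge; if `opp d = d`, then the side `d` is not glued to
anything, i.e. a hole lies on its left, and its edge belongs to the active boundary.
The root face is the polygon on the right of `root`. -/
structure HoledMap : Type 1 where
  D : Type
  fin : Finite D
  face : Equiv.Perm D
  opp : Equiv.Perm D
  opp_opp : ∀ d, opp (opp d) = d
  root : D

namespace HoledMap

/-- The darts of the active boundary. -/
def Active (m : HoledMap) (d : m.D) : Prop := m.opp d = d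

/-- The faces that are not holes (the root face is one of them). -/
def Face (m : HoledMap) : Type := Quotient (Equiv.Perm.SameCycle.setoid m.face)

def faceOf (m : HoledMap) (d : m.D) : m.Face :=
  Quotient.mk (Equiv.Perm.SameCycle.setoid m.face) d

/-- The darts that lie on the root face. -/
def OnRootFace (m : HoledMap) (d : m.D) : Prop := m.faceOf d = m.faceOf m.root

/-- The permutation `d ↦ face (opp d)`. A cycle of it without active darts consists of the darts that
start at a given inner vertex. A cycle with active darts runs around a hole (through all the darts
that start at a vertex of the boundary of the hole); it meets the active darts of this hole in the
order of the boundary of the hole. -/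
def around (m : HoledMap) : Equiv.Perm m.D := m.face * m.opp

/-- The cycles of `around`: inner vertices and holes. -/
def Cyc (m : HoledMap) : Type := Quotient (Equiv.Perm.SameCycle.setoid m.around)

def cycOf (m : HoledMap) (d : m.D) : m.Cyc :=
  Quotient.mk (Equiv.Perm.SameCycle.setoid m.around) d

/-- The holes: the boundary components of the glued surface. In the map that is obtained by filling
each of them with a face, the holes have simple boundaries without common vertices. -/
def Hole (m : HoledMap) : Type := {c : m.Cyc // ∃ d, m.Active d ∧ m.cycOf d = c}

/-- The degree of a hole. -/
def holeDeg (m : HoledMap) (h : m.Hole) : ℕ := Nat.card {d : m.D // m.Active d ∧ m.cycOf d = h.1}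

/-- The perimeter: the degree of the root face. -/
def perimeter (m : HoledMap) : ℕ := Nat.card {d : m.D // m.OnRootFace d}

/-- The number of faces that are not holes. -/
def numFaces (m : HoledMap) : ℕ := Nat.card m.Face

/-- There are no holes. -/
def IsClosed (m : HoledMap) : Prop := ∀ d, ¬ m.Active d

/-- The map is a planar quadrangulation with a boundary, with holes: it is connected, it is embedded
in the sphere, and every face other than the root face and the holes has degree `4`.

After filling the `h` holes with faces, let `i` be the number of inner vertices, `a` the number of
active darts and `e` the number of glued edges. There are `i + a` vertices, `e + a` edges and
`numFaces + h` faces, so Euler's formula is `(i + h) + numFaces = e + 2`, where `i + h` is the number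
of cycles of `around` and `2 * e` is the number of darts that are not active. -/
structure IsQuad (m : HoledMap) : Prop where
  connected : ∀ d, ∃ g ∈ Subgroup.closure {m.face, m.opp}, g m.root = d
  planar : 2 * Nat.card m.Cyc + 2 * m.numFaces = Nat.card {d : m.D // ¬ m.Active d} + 4
  quad : ∀ d, ¬ m.OnRootFace d → Nat.card {d' : m.D // m.faceOf d' = m.faceOf d} = 4

/-- Isomorphisms of rooted maps with holes. -/
structure Iso (m m' : HoledMap) where
  toEquiv : m.D ≃ m'.D
  map_face : ∀ d, toEquiv (m.face d) = m'.face (toEquiv d)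
  map_opp : ∀ d, toEquiv (m.opp d) = m'.opp (toEquiv d)
  map_root : toEquiv m.root = m'.root

def Iso.refl (m : HoledMap) : Iso m m := ⟨Equiv.refl _, fun _ => rfl, fun _ => rfl, rfl⟩

def Iso.symm {m m' : HoledMap} (f : Iso m m') : Iso m' m where
  toEquiv := f.toEquiv.symm
  map_face d := by rw [Equiv.symm_apply_eq, f.map_face, Equiv.apply_symm_apply]
  map_opp d := by rw [Equiv.symm_apply_eq, f.map_opp, Equiv.apply_symm_apply]
  map_root := by rw [Equiv.symm_apply_eq, f.map_root]

def Iso.trans {m m' m'' : HoledMap} (f : Iso m m') (g : Iso m' m'') : Iso m m'' where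
  toEquiv := f.toEquiv.trans g.toEquiv
  map_face d := by simp [f.map_face, g.map_face]
  map_opp d := by simp [f.map_opp, g.map_opp]
  map_root := by simp [f.map_root, g.map_root]

instance isoSetoid : Setoid HoledMap where
  r m m' := Nonempty (Iso m m')
  iseqv := ⟨fun m => ⟨Iso.refl m⟩, fun ⟨f⟩ => ⟨f.symm⟩, fun ⟨f⟩ ⟨g⟩ => ⟨f.trans g⟩⟩

/-! ## Gluing and submaps -/

/-- The first of the points `f a`, `f (f a)`, … that satisfies `P`. -/
def firstIter {α : Type} (f : α → α) (P : α → Prop) (a : α) : α :=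
  f^[sInf {k : ℕ | 0 < k ∧ P (f^[k] a)}] a

/-- The active dart that follows the active dart `d` around its hole; it starts where `d` ends. -/
def nextActive (m : HoledMap) (d : m.D) : m.D := firstIter m.around m.Active d

/-- A choice of a marked oriented edge on each hole. -/
def IsMarking (p : HoledMap) (mark : p.Hole → p.D) : Prop :=
  ∀ h, p.Active (mark h) ∧ p.cycOf (mark h) = h.1

/-- `m` is the result of gluing the maps `u h` into the holes `h` of `p`, where the root of `u h` is
identified with the marked edge of `h`, and the other edges of the root face of `u h` with the other
edges of `h` following the orientation. The root faces of the `u h` disappear, so the darts of `m`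
are those of `p` and those of the `u h` that are not on a root face; a dart of `u h` on the root face
becomes the dart of `p` with which it is identified. -/
structure Gluing (p : HoledMap) (mark : p.Hole → p.D) (u : p.Hole → HoledMap) (m : HoledMap) where
  per : ∀ h, (u h).perimeter = p.holeDeg h
  i : p.D → m.D
  j : ∀ h, (u h).D → m.D
  bij : Function.Bijective
    (Sum.elim i (fun x : Σ h, {d : (u h).D // ¬ (u h).OnRootFace d} => j x.1 x.2.1))
  i_root : i p.root = m.root
  i_face : ∀ d, i (p.face d) = m.face (i d)
  i_opp : ∀ d, ¬ p.Active d → i (p.opp d) = m.opp (i d)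
  j_root : ∀ h (k : ℕ), j h ((u h).face^[k] (u h).root) = i (p.nextActive^[k] (mark h))
  j_face : ∀ h d, ¬ (u h).OnRootFace d → j h ((u h).face d) = m.face (j h d)
  j_opp : ∀ h d, j h ((u h).opp d) = m.opp (j h d)

/-- `p ⊂ m`: the map `m` is obtained by gluing quadrangulations with holes into the holes of `p`.
(The marked edges of the holes do not matter, since the roots of the maps that are glued are free.) -/
def Submap (p m : HoledMap) : Prop :=
  p.IsQuad ∧ ∃ (mark : p.Hole → p.D) (u : p.Hole → HoledMap),
    p.IsMarking mark ∧ (∀ h, (u h).IsQuad) ∧ Nonempty (Gluing p mark u m)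

/-! ## Discovering a part of a map -/

/-- The edge of `d` (equivalently, the dual edge that crosses it) is the edge of a dart in `X`. -/
def Crossed (m : HoledMap) (X : Set m.D) (d : m.D) : Prop := d ∈ X ∨ m.opp d ∈ X

/-- The dart lies on the root face or on a face with an edge that is crossed. -/
def Discovered (m : HoledMap) (X : Set m.D) (d : m.D) : Prop :=
  m.OnRootFace d ∨ ∃ x, m.Crossed X x ∧ m.faceOf x = m.faceOf d

lemma crossed_opp (m : HoledMap) (X : Set m.D) (d : m.D) :
    m.Crossed X (m.opp d) ↔ m.Crossed X d := by
  unfold Crossed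
  rw [m.opp_opp, or_comm]

lemma faceOf_face (m : HoledMap) (d : m.D) : m.faceOf (m.face d) = m.faceOf d :=
  Quotient.sound (s := Equiv.Perm.SameCycle.setoid m.face)
    ((Equiv.Perm.sameCycle_apply_left).2 (Equiv.Perm.SameCycle.refl _ _))

lemma discovered_face (m : HoledMap) (X : Set m.D) (d : m.D) :
    m.Discovered X (m.face d) ↔ m.Discovered X d := by
  unfold Discovered OnRootFace
  rw [faceOf_face]

open Classical in
/-- The gluing of `m`, along the crossed edges only. -/
def crossedOpp (m : HoledMap) (X : Set m.D) (d : {d : m.D // m.Discovered X d}) :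
    {d : m.D // m.Discovered X d} :=
  if h : m.Crossed X d.1 then
    ⟨m.opp d.1, show m.Discovered X (m.opp d.1) from
      Or.inr ⟨m.opp d.1, (m.crossed_opp X d.1).2 h, rfl⟩⟩
  else d

lemma crossedOpp_involutive (m : HoledMap) (X : Set m.D) :
    Function.Involutive (m.crossedOpp X) := by
  intro d
  by_cases h : m.Crossed X d.1
  · have h' : m.Crossed X (m.opp d.1) := (m.crossed_opp X d.1).2 h
    apply Subtype.ext
    simp [crossedOpp, h, h', m.opp_opp]
  · simp [crossedOpp, h]

/-- The map discovered by crossing the edges of the darts in `X`, starting from the root face: its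
faces are the root face and the faces next to these edges, and they are glued along these edges only.
All the other edges of these faces are on the boundaries of the holes. -/
def explore (m : HoledMap) (X : Set m.D) : HoledMap where
  D := {d : m.D // m.Discovered X d}
  fin := by
    have := m.fin
    infer_instance
  face := m.face.subtypePerm (fun d => m.discovered_face X d)
  opp := Function.Involutive.toPerm (m.crossedOpp X) (m.crossedOpp_involutive X)
  opp_opp := m.crossedOpp_involutive X
  root := ⟨m.root, Or.inl rfl⟩

/-! ## The right process and the submap that it defines -/

/-- The right process on the dual map. The first component of `rightStep n` is the dart that is
crossed in the step from the `n`-th to the `(n + 1)`-st visited face, a dart of the face that is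
left; the second component is the set of all darts whose edge has been crossed so far.

The process first crosses the root edge. Having crossed `d`, it is in the face of `opp d`; it looks
at the edges of this face in counterclockwise order from there (first the one that is furthest to
the right), and crosses the first of them that has not been crossed before, in either direction. -/
def rightStep (m : HoledMap) : ℕ → m.D × Set m.D
  | 0 => (m.root, {m.root, m.opp m.root})
  | n + 1 =>
    let s := rightStep m n
    let d := firstIter m.face.symm (fun d => d ∉ s.2) (m.opp s.1)
    (d, s.2 ∪ {d, m.opp d})

/-- The face `x_n` that the right process visits at time `n`. -/
def rightFace (m : HoledMap) : ℕ → m.Face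
  | 0 => m.faceOf m.root
  | n + 1 => m.faceOf (m.opp (m.rightStep n).1)

/-- The first time the right process comes back to the root face. -/
def returnTime (m : HoledMap) : ℕ := sInf {n | 1 ≤ n ∧ m.rightFace n = m.rightFace 0}

/-- The times `1 ≤ n ≤ returnTime` at which the right process is in a face that it visits at
another such time too. -/
def multipleTimes (m : HoledMap) : Set ℕ :=
  {n | 1 ≤ n ∧ n ≤ m.returnTime ∧
    ∃ k, 1 ≤ k ∧ k ≤ m.returnTime ∧ k ≠ n ∧ m.rightFace n = m.rightFace k}

/-- The time of the first visit of the first self-intersection point. -/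
def firstVisit (m : HoledMap) : ℕ := sInf m.multipleTimes

/-- The time of the last visit of the first self-intersection point. -/
def lastVisit (m : HoledMap) : ℕ :=
  sSup {n | n ≤ m.returnTime ∧ m.rightFace n = m.rightFace m.firstVisit}

/-- The darts crossed by the right process before its return to the root face, without those crossed
between the first and the last visit of the first self-intersection point, if there is such a
point. -/
def cutTrail (m : HoledMap) : Set m.D :=
  {d | ∃ n < m.returnTime, d = (m.rightStep n).1 ∧
    ¬ (m.multipleTimes.Nonempty ∧ m.firstVisit ≤ n ∧ n < m.lastVisit)}

end HoledMap

open HoledMap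

/-! ## Isomorphism classes and the Boltzmann law -/

/-- Rooted maps with holes, up to isomorphism. -/
abbrev MapClass : Type 1 := Quotient HoledMap.isoSetoid

instance : MeasurableSpace MapClass := ⊤

namespace MapClass

/-- The isomorphism class of `m`. -/
def of (m : HoledMap) : MapClass := Quotient.mk HoledMap.isoSetoid m

/-- The submap relation `x ⊂ y` on isomorphism classes. -/
def Sub (x y : MapClass) : Prop := ∃ p m : HoledMap, of p = x ∧ of m = y ∧ p.Submap m

/-- The number of faces that are not holes, on a representative. -/
def numFaces (x : MapClass) : ℕ := (Quotient.out x).numFaces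

/-- The submap `𝖰` of a map, computed on a representative: the part that is discovered by the right
process, cut at its first self-intersection. -/
def cutSubmap (x : MapClass) : MapClass :=
  of ((Quotient.out x).explore (Quotient.out x).cutTrail)

/-- `y` is the result of gluing the maps `u h` into the holes of `p`. -/
def IsGluing (p : HoledMap) (mark : p.Hole → p.D) (u : p.Hole → HoledMap) (y : MapClass) : Prop :=
  ∃ m, of m = y ∧ Nonempty (Gluing p mark u m)

end MapClass

/-- Quadrangulations with holes. -/
def QuadHoles : Type 1 := {x : MapClass // ∃ m, MapClass.of m = x ∧ m.IsQuad}

/-- Quadrangulations (without holes) with a boundary of perimeter `n`. -/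
def Quads (n : ℕ) : Set MapClass :=
  {x | ∃ m, MapClass.of m = x ∧ m.IsQuad ∧ m.IsClosed ∧ m.perimeter = n}

/-- The partition function of quadrangulations with a boundary of perimeter `n`. -/
def partitionFunction (q : ℝ≥0) (n : ℕ) : ℝ≥0∞ := ∑' x : Quads n, (q : ℝ≥0∞) ^ x.1.numFaces

/-- The probability of `u` under the `q`-Boltzmann law with the same perimeter. -/
def boltzmannProb (q : ℝ≥0) (u : HoledMap) : ℝ≥0∞ :=
  (q : ℝ≥0∞) ^ u.numFaces / partitionFunction q u.perimeter

section Random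

variable {Ω : Type*} [MeasurableSpace Ω]

/-- `Q` is a `q`-Boltzmann map with half-perimeter `ℓ`. -/
structure IsBoltzmann (μ : Measure Ω) (q : ℝ≥0) (ℓ : ℕ) (Q : Ω → MapClass) : Prop where
  measurable : Measurable Q
  support : ∀ᵐ ω ∂μ, Q ω ∈ Quads (2 * ℓ)
  law : ∀ x ∈ Quads (2 * ℓ),
    μ {ω | Q ω = x} = (q : ℝ≥0∞) ^ x.numFaces / partitionFunction q (2 * ℓ)

/-- Filtrations indexed by quadrangulations with holes, complete with respect to `μ`. -/
structure IsQuadFiltration (μ : Measure Ω) (F : QuadHoles → MeasurableSpace Ω) : Prop where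
  mono : ∀ p q : QuadHoles, MapClass.Sub p.1 q.1 → F p ≤ F q
  complete : ∀ (q : QuadHoles) (N : Set Ω), μ N = 0 → MeasurableSet[F q] N

/-- The natural filtration of `Q`: it is generated by the events `{p ⊂ Q}`, `p ⊂ q`, and the negligible
sets. -/
@[reducible]
def naturalFiltration (μ : Measure Ω) (Q : Ω → MapClass) (q : QuadHoles) : MeasurableSpace Ω :=
  MeasurableSpace.generateFrom
    ({A | ∃ p : QuadHoles, MapClass.Sub p.1 q.1 ∧ A = {ω | MapClass.Sub p.1 (Q ω)}} ∪
      {N | μ N = 0})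

/-- `u` is a family of quadrangulations without holes that fit into the holes of `p`. -/
def IsFilling (p : HoledMap) (u : p.Hole → HoledMap) : Prop :=
  ∀ h, (u h).IsQuad ∧ (u h).IsClosed ∧ (u h).perimeter = p.holeDeg h

/-- The Boltzmann map `Q` is an `F`-Boltzmann map: `{p ⊂ Q}` is in `F p`, and conditionally on `F p`
and on `{p ⊂ Q}`, the maps to be glued into the holes of `p` to obtain `Q` are independent
`q`-Boltzmann maps with the perimeters of these holes. -/
structure IsFBoltzmann (μ : Measure Ω) (q : ℝ≥0) (F : QuadHoles → MeasurableSpace Ω)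
    (Q : Ω → MapClass) : Prop where
  adapted : ∀ p : QuadHoles, MeasurableSet[F p] {ω | MapClass.Sub p.1 (Q ω)}
  indep : ∀ (p : HoledMap) (hp : p.IsQuad) (mark : p.Hole → p.D) (u : p.Hole → HoledMap) (A : Set Ω),
    p.IsMarking mark → IsFilling p u → MeasurableSet[F ⟨MapClass.of p, p, rfl, hp⟩] A →
    μ (A ∩ {ω | MapClass.IsGluing p mark u (Q ω)}) =
      μ (A ∩ {ω | MapClass.Sub (MapClass.of p) (Q ω)}) * ∏ᶠ h, boltzmannProb q (u h)

/-- `S` is an `F`-stopping map for the map `Q`. -/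
structure IsStoppingMap (μ : Measure Ω) (F : QuadHoles → MeasurableSpace Ω)
    (Q S : Ω → MapClass) : Prop where
  sub : ∀ᵐ ω ∂μ, MapClass.Sub (S ω) (Q ω)
  stopping : ∀ q : QuadHoles, MeasurableSet[F q] {ω | MapClass.Sub (S ω) q.1}

/-- The events of the `σ`-algebra `F_S` of a stopping map `S`. -/
def IsStoppedEvent (F : QuadHoles → MeasurableSpace Ω) (S : Ω → MapClass) (A : Set Ω) : Prop :=
  MeasurableSet[⨆ q, F q] A ∧ ∀ q : QuadHoles, MeasurableSet[F q] (A ∩ {ω | MapClass.Sub (S ω) q.1})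

/-- The (strong) Markov property of `S`: almost surely `Q` is obtained by gluing maps into the holes of
`S`, and conditionally on `F_S` these are independent `q`-Boltzmann maps with the perimeters of the
holes. -/
def HasMarkovProperty (μ : Measure Ω) (q : ℝ≥0) (F : QuadHoles → MeasurableSpace Ω)
    (Q S : Ω → MapClass) : Prop :=
  (∀ᵐ ω ∂μ, MapClass.Sub (S ω) (Q ω)) ∧
  ∀ (p : HoledMap) (mark : p.Hole → p.D) (u : p.Hole → HoledMap) (A : Set Ω),
    p.IsQuad → p.IsMarking mark → IsFilling p u → IsStoppedEvent F S A →
    μ (A ∩ {ω | S ω = MapClass.of p} ∩ {ω | MapClass.IsGluing p mark u (Q ω)}) =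
      μ (A ∩ {ω | S ω = MapClass.of p}) * ∏ᶠ h, boltzmannProb q (u h)

end Random

/-! ## Randomised peeling -/

/-- A peeling algorithm with a random seed in `S`. Given the seed and the map with holes that is
explored so far, it either picks an edge of the active boundary or stops. The choice depends on the
explored map only up to isomorphism, and on the seed in a measurable way. -/
structure PeelingAlgorithm (S : Type*) [MeasurableSpace S] where
  pick : S → (e : HoledMap) → Option e.D
  active : ∀ s e d, pick s e = some d → e.Active d
  equivariant : ∀ s e e' (f : Iso e e'), pick s e' = (pick s e).map f.toEquiv
  measurable : ∀ e o, MeasurableSet {s | pick s e = o}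

/-- The darts that are peeled in the first `n` steps of the exploration of `m`. In each step, the edge
that is picked is crossed: either a new face is discovered behind it (and is glued along this edge
only), or this edge is found to be glued to another edge of the same hole. -/
def HoledMap.peeled (m : HoledMap) (pick : (e : HoledMap) → Option e.D) : ℕ → Set m.D
  | 0 => ∅
  | n + 1 =>
    let X := HoledMap.peeled m pick n
    X ∪ {d | ∃ h : m.Discovered X d, pick (m.explore X) = some (⟨d, h⟩ : {d : m.D // m.Discovered X d})}

/-- The map with holes that the algorithm with seed `s` has explored after `n` steps when it is run on
`x` (on a representative). It starts from the root face. -/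
def PeelingAlgorithm.run {S : Type*} [MeasurableSpace S] (A : PeelingAlgorithm S) (s : S)
    (x : MapClass) (n : ℕ) : MapClass :=
  MapClass.of ((Quotient.out x).explore ((Quotient.out x).peeled (A.pick s) n))

end

/-! ## Planarity as exactness of a cochain complex with coefficients in `ZMod 2` -/

/-! The argument rests on replacing `p ⊂ m` by the existence of an embedding: an injection of the
polygons of `p` into those of `m` that respects the root and the gluings of `p`
(`MapClass.sub_of_iff`). Such an embedding is unique, and the rest of `m` splits according to the
holes of `p` into planar quadrangulations. The topological input is Euler's formula in the form of a
vanishing cohomology group over `ZMod 2` (`exact₂_iff`). This form passes to submaps, fillings and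
gluings: cochains are extended by zero, and potentials are restricted or put together.

Boltzmann property. Gluing is a bijection from families of fillings to the maps that contain `p`,
and the weight of a map is multiplicative, so given `{p ⊂ Q}` the fillings are independent Boltzmann
maps (`measure_isGluing`). Conditioning on the natural filtration at `p` adds nothing: if `x ⊂ p`,
then `{p ⊂ Q}` is contained in `{x ⊂ Q}`, so every event of that σ-algebra is trivial on `{p ⊂ Q}`
(`naturalFiltration_trivial`).

Stopping property. All face degrees are even, so the map is bipartite and has no loops. The right
process therefore never runs into a crossed edge: it rotates once around the end point of the root
(`IsQuadTwo.rightStep`). A self-intersection is a square with two opposite sides that both end at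
this vertex; leaving out the part between its first and last visit creates a hole bounded by two
consecutive sides of the square. If another map contains this cut submap, the rotations agree
forwards from the root up to the first visit and backwards from the root down to the last one; in
between, the rotation stays in the hole and meets no face of the cut submap. Hence the other map has
the same cut submap (`IsQuadTwo.nonempty_iso_explore_cutTrail`). For each value `y` of the cut
submap, `{𝖰 = y}` is thus `{y ⊂ 𝔔}`, which gives the stopping and Markov properties by countable
unions.

Peeling. Every map has positive probability and there are countably many, so an algorithm that
succeeds almost surely has one seed that succeeds on all maps (`exists_seed`). Three maps made of
the root digon and two squares defeat any fixed seed (`threeMaps_not_run`). The squares are attached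
to the digon in the same way, and each cut submap has one more glued edge, between the squares, but
no dart belongs to this extra edge in all three maps. While only edges of the root digon are
crossed, the explored parts coincide, so the next pick is the same in the three maps and is wrong in
one of them; not picking fails as well. -/

section Exactness

variable {D : Type*}

/-- The functions that are constant on the cycles of `σ`. -/
def invariants (σ : Equiv.Perm D) : Submodule (ZMod 2) (D → ZMod 2) where
  carrier := {f | ∀ d, f (σ d) = f d}
  add_mem' hf hg d := by simp [hf d, hg d]
  zero_mem' _ := rfl
  smul_mem' c f hf d := by simp [hf d]

lemma SameCycle.apply_eq {E : Type*} {σ : Equiv.Perm D} {f : D → E} (hf : ∀ d, f (σ d) = f d)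
    {a b : D} (h : σ.SameCycle a b) : f a = f b := by
  obtain ⟨i, rfl⟩ := h
  induction i with
  | zero => rfl
  | succ n ih => rw [add_comm, zpow_add, Equiv.Perm.mul_apply, zpow_one, hf]; exact ih
  | pred n ih =>
    rw [ih, ← hf ((σ ^ (-(n : ℤ) - 1)) a), ← Equiv.Perm.mul_apply, ← zpow_one_add]
    congr 3; ring

/-- Invariant functions are the functions on the set of cycles. -/
noncomputable def invariantsEquiv (σ : Equiv.Perm D) :
    invariants σ ≃ₗ[ZMod 2] (Quotient (Equiv.Perm.SameCycle.setoid σ) → ZMod 2) where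
  toFun f := Quotient.lift f.1 (fun _ _ h => SameCycle.apply_eq f.2 h)
  map_add' f g := by ext x; induction x using Quotient.ind; rfl
  map_smul' c f := by ext x; induction x using Quotient.ind; rfl
  invFun F := ⟨fun d => F (Quotient.mk _ d), fun d => congrArg F (Quotient.sound
    (s := Equiv.Perm.SameCycle.setoid σ)
    ((Equiv.Perm.sameCycle_apply_left).2 (Equiv.Perm.SameCycle.refl _ _)))⟩
  left_inv f := rfl
  right_inv F := by ext x; induction x using Quotient.ind; rfl

lemma finrank_invariants [Finite D] (σ : Equiv.Perm D) :
    Module.finrank (ZMod 2) (invariants σ)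
      = Nat.card (Quotient (Equiv.Perm.SameCycle.setoid σ)) := by
  classical
  have : Fintype (Quotient (Equiv.Perm.SameCycle.setoid σ)) := Fintype.ofFinite _
  rw [LinearEquiv.finrank_eq (invariantsEquiv σ), Module.finrank_fintype_fun_eq_card,
    Nat.card_eq_fintype_card]

/-- The functions on the edges, for the edges that are the orbits of size two of the involution. -/
def edgeFunctions (α : Equiv.Perm D) : Submodule (ZMod 2) (D → ZMod 2) where
  carrier := {f | (∀ d, f (α d) = f d) ∧ ∀ d, α d = d → f d = 0}
  add_mem' hf hg := ⟨fun d => by simp [hf.1 d, hg.1 d], fun d h => by simp [hf.2 d h, hg.2 d h]⟩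
  zero_mem' := ⟨fun _ => rfl, fun _ _ => rfl⟩
  smul_mem' c f hf := ⟨fun d => by simp [hf.1 d], fun d h => by simp [hf.2 d h]⟩

/-- Number the darts: in each orbit of size two one dart has the smaller number, and a function on
edges is a free choice of values at these representatives. Fixed points carry no freedom, so the
dimension is half the number of the other darts. -/
lemma two_mul_finrank_edgeFunctions [Finite D] (α : Equiv.Perm D) (hα : ∀ d, α (α d) = d) :
    2 * Module.finrank (ZMod 2) (edgeFunctions α) = Nat.card {d // α d ≠ d} := by
  classical
  obtain ⟨n, ⟨e⟩⟩ := Finite.exists_equiv_fin D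
  have : Fintype D := Fintype.ofFinite D
  let R := {d : D // e d < e (α d)}
  have hlt : ∀ d, α d ≠ d → ¬ e d < e (α d) → e (α d) < e d := fun d h h' =>
    lt_of_le_of_ne (not_lt.1 h') (fun h'' => h (e.injective h''))
  let L : edgeFunctions α ≃ₗ[ZMod 2] (R → ZMod 2) :=
    { toFun := fun f r => f.1 r.1
      map_add' := fun f g => rfl
      map_smul' := fun c f => rfl
      -- The value at `d` is read at whichever of `d`, `α d` has the smaller number; at a fixed
      -- point both tests fail and the default `0` is the required value.
      invFun := fun F => ⟨fun d => if h : e d < e (α d) then F ⟨d, h⟩ else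
          if h' : e (α d) < e (α (α d)) then F ⟨α d, h'⟩ else 0, by
        constructor
        · intro d
          beta_reduce
          by_cases h : e d < e (α d)
          · have : ¬ e (α d) < e (α (α d)) := by rw [hα]; exact not_lt.2 h.le
            have h2 : e (α (α d)) < e (α (α (α d))) := by rw [hα]; exact h
            rw [dif_neg this, dif_pos h2, dif_pos h]
            simp only [hα]
          · by_cases h' : e (α d) < e (α (α d))
            · rw [dif_pos h', dif_neg h, dif_pos h']
            · have h2 : ¬ e (α (α d)) < e (α (α (α d))) := by rw [hα]; exact h
              rw [dif_neg h', dif_neg h2, dif_neg h, dif_neg h']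
        · intro d hd
          have : ¬ e d < e (α d) := by rw [hd]; exact lt_irrefl _
          have h2 : ¬ e (α d) < e (α (α d)) := by rw [hd, hd]; exact lt_irrefl _
          beta_reduce
          rw [dif_neg this, dif_neg h2]⟩
      left_inv := fun f => by
        ext d
        by_cases h : e d < e (α d)
        · simp [h]
        · by_cases hd : α d = d
          · simp [hd, f.2.2 d hd]
          · have h' : e (α d) < e (α (α d)) := by rw [hα]; exact hlt d hd h
            simp only [h, h', dif_neg, dif_pos, not_false_eq_true, f.2.1]
      right_inv := fun F => by
        ext r
        simp [r.2] }
  have hcard : Nat.card {d // α d ≠ d} = Nat.card (R ⊕ R) := by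
    symm
    refine Nat.card_congr (Equiv.ofBijective
      (Sum.elim (fun r => ⟨r.1, fun h => by have := r.2; rw [h] at this; exact lt_irrefl _ this⟩)
        (fun r => ⟨α r.1, fun h => by
          have := r.2; rw [hα] at h; rw [← h] at this; exact lt_irrefl _ this⟩)) ⟨?_, ?_⟩)
    · rintro (⟨a, ha⟩ | ⟨a, ha⟩) (⟨b, hb⟩ | ⟨b, hb⟩) h <;> simp only [Sum.elim_inl, Sum.elim_inr,
        Subtype.mk.injEq] at h
      · subst h; rfl
      · subst h; rw [hα] at ha; exact absurd ha (not_lt.2 hb.le)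
      · subst h; rw [hα] at hb; exact absurd hb (not_lt.2 ha.le)
      · have := α.injective h; subst this; rfl
    · rintro ⟨d, hd⟩
      by_cases h : e d < e (α d)
      · exact ⟨Sum.inl ⟨d, h⟩, rfl⟩
      · exact ⟨Sum.inr ⟨α d, by rw [hα]; exact hlt d hd h⟩, Subtype.ext (hα d)⟩
  rw [hcard, Nat.card_sum, LinearEquiv.finrank_eq L, Module.finrank_fintype_fun_eq_card,
    Nat.card_eq_fintype_card]
  ring

lemma finrank_constants [Nonempty D] (V : Submodule (ZMod 2) (D → ZMod 2))
    (hV : ∀ f, f ∈ V ↔ ∃ c, ∀ d, f d = c) : Module.finrank (ZMod 2) V = 1 := by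
  obtain ⟨d₀⟩ := ‹Nonempty D›
  let L : V ≃ₗ[ZMod 2] ZMod 2 :=
    { toFun := fun f => f.1 d₀
      map_add' := fun _ _ => rfl
      map_smul' := fun _ _ => rfl
      invFun := fun c => ⟨fun _ => c, (hV _).2 ⟨c, fun _ => rfl⟩⟩
      left_inv := fun f => by
        obtain ⟨c, hc⟩ := (hV _).1 f.2
        ext d
        simp [hc]
      right_inv := fun c => rfl }
  rw [LinearEquiv.finrank_eq L, Module.finrank_self]

variable [Fintype D]

/-- Exactness in the middle of the complex of functions on the cycles of `σ * α`, on the edges and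
on the cycles of `σ`. -/
def Exact₂ (σ α : Equiv.Perm D) : Prop :=
  ∀ φ : D → ZMod 2, (∀ d, φ (α d) = φ d) → (∀ d, α d = d → φ d = 0) →
    (∀ f : D → ZMod 2, (∀ d, f (σ d) = f d) → ∑ d, f d * φ d = 0) →
    ∃ g : D → ZMod 2, (∀ d, g (σ (α d)) = g d) ∧ ∀ d, φ d = g (σ d) + g d

/-- The coboundary operator `g ↦ (d ↦ g (σ d) + g d)`. -/
def coboundary (σ : Equiv.Perm D) : (D → ZMod 2) →ₗ[ZMod 2] (D → ZMod 2) where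
  toFun g d := g (σ d) + g d
  map_add' f g := by ext d; simp; ring
  map_smul' c f := by ext d; simp; ring

/-- The pairing of functions on the cycles of `σ` with functions on edges. -/
noncomputable def edgePairing (σ α : Equiv.Perm D) :
    invariants σ →ₗ[ZMod 2] Module.Dual (ZMod 2) (edgeFunctions α) where
  toFun f :=
    { toFun := fun φ => ∑ d, f.1 d * φ.1 d
      map_add' := fun φ ψ => by simp [mul_add, Finset.sum_add_distrib]
      map_smul' := fun c φ => by
        simp only [Submodule.coe_smul, Pi.smul_apply, smul_eq_mul, Finset.mul_sum, RingHom.id_apply]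
        exact Finset.sum_congr rfl fun d _ => by ring }
  map_add' f g := by
    ext φ; simp [add_mul, Finset.sum_add_distrib]
  map_smul' c f := by
    ext φ; simp [Finset.mul_sum, mul_assoc]

lemma finrank_range_add_one {M N : Type*} [AddCommGroup M] [Module (ZMod 2) M]
    [Module.Finite (ZMod 2) M]
    [AddCommGroup N] [Module (ZMod 2) N] (T : M →ₗ[ZMod 2] N) {k : ℕ}
    (hM : Module.finrank (ZMod 2) M = k) (hk : Module.finrank (ZMod 2) (LinearMap.ker T) = 1) :
    Module.finrank (ZMod 2) (LinearMap.range T) + 1 = k := by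
  rw [← hM, ← hk, LinearMap.finrank_range_add_finrank_ker]

lemma zmod2_eq_of_add {a b : ZMod 2} (h : a + b = 0) : a = b := by
  revert a b; decide

lemma zmod2_add_self (a : ZMod 2) : a + a = 0 := by
  revert a; decide

/-- Euler's formula holds if and only if the cochain complex is exact. -/
theorem exact₂_iff [Nonempty D] (σ α : Equiv.Perm D) (hα : ∀ d, α (α d) = d)
    (conn : ∀ f : D → ZMod 2, (∀ d, f (σ d) = f d) → (∀ d, f (α d) = f d) → ∀ d d', f d = f d') :
    Exact₂ σ α ↔ 2 * Nat.card (Quotient (Equiv.Perm.SameCycle.setoid (σ * α)))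
      + 2 * Nat.card (Quotient (Equiv.Perm.SameCycle.setoid σ))
      = Nat.card {d // ¬ α d = d} + 4 := by
  classical
  obtain ⟨d₀⟩ := id ‹Nonempty D›
  have hE := two_mul_finrank_edgeFunctions α hα
  have hF := finrank_invariants σ
  have hV := finrank_invariants (σ * α)
  have invτ : ∀ {g : D → ZMod 2}, g ∈ invariants (σ * α) ↔ ∀ d, g (σ (α d)) = g d := Iff.rfl
  -- the coboundaries
  let T : invariants (σ * α) →ₗ[ZMod 2] edgeFunctions α :=
    LinearMap.codRestrict _ ((coboundary σ).comp (Submodule.subtype _)) (by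
      rintro ⟨g, hg⟩
      have hg' := invτ.1 hg
      constructor
      · intro d
        have := hg' (α d)
        rw [hα] at this
        simp [coboundary, hg' d, this, add_comm]
      · intro d hd
        have := hg' d
        rw [hd] at this
        simp [coboundary, this, zmod2_add_self])
  have hT : ∀ g : invariants (σ * α), ∀ d, (T g).1 d = g.1 (σ d) + g.1 d := fun g d => rfl
  -- A function invariant under `σ * α` with zero coboundary is invariant under `σ`, hence under
  -- `α`, and connectedness makes it constant.
  have hkerT : Module.finrank (ZMod 2) (LinearMap.ker T) = 1 := by
    rw [← (LinearEquiv.finrank_eq (Submodule.equivSubtypeMap (invariants (σ * α))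
      (LinearMap.ker T))).symm]
    refine finrank_constants _ (fun f => ?_)
    rw [Submodule.mem_map]
    constructor
    · rintro ⟨⟨g, hg⟩, hgT, rfl⟩
      have h1 : ∀ d, g (σ d) = g d := fun d => zmod2_eq_of_add (by
        have := congrArg (fun z => z.1 d) (LinearMap.mem_ker.1 hgT)
        exact this)
      refine ⟨g d₀, fun d => conn g h1 (fun d => ?_) d d₀⟩
      rw [← invτ.1 hg d, h1]
    · rintro ⟨c, hc⟩
      refine ⟨⟨f, fun d => by rw [hc, hc]⟩, ?_, rfl⟩
      rw [LinearMap.mem_ker]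
      ext d
      rw [hT]
      simp [hc, zmod2_add_self]
  have hrT := finrank_range_add_one T hV hkerT
  -- the cocycles
  let P := edgePairing σ α
  have hP : ∀ f φ, P f φ = ∑ d, f.1 d * φ.1 d := fun f φ => rfl
  -- Pairing with the indicator of the edge `{d, α d}` gives `f d + f (α d)`, so the kernel consists
  -- of the functions invariant under both permutations, again the constants.
  have hkerP : Module.finrank (ZMod 2) (LinearMap.ker P) = 1 := by
    rw [← (LinearEquiv.finrank_eq (Submodule.equivSubtypeMap (invariants σ)
      (LinearMap.ker P))).symm]
    refine finrank_constants _ (fun f => ?_)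
    rw [Submodule.mem_map]
    have key : ∀ f : invariants σ, f ∈ LinearMap.ker P ↔ ∀ d, f.1 (α d) = f.1 d := by
      intro f
      rw [LinearMap.mem_ker]
      constructor
      · intro h d
        by_cases hd : α d = d
        · rw [hd]
        · let φ : edgeFunctions α := ⟨fun x => if x = d ∨ x = α d then 1 else 0, by
            constructor
            · intro x
              have : (α x = d ∨ α x = α d) ↔ (x = d ∨ x = α d) := by
                constructor
                · rintro (h | h)
                  · right; rw [← h, hα]
                  · left; exact α.injective h
                · rintro (rfl | rfl)
                  · exact Or.inr rfl
                  · exact Or.inl (hα d)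
              simp only [this]
            · intro x hx
              beta_reduce
              rw [if_neg]
              rintro (rfl | rfl)
              · exact hd hx
              · rw [hα] at hx; exact hd hx.symm⟩
          have h' : P f φ = 0 := by rw [h]; rfl
          rw [hP] at h'
          have : ∑ x, f.1 x * φ.1 x = f.1 d + f.1 (α d) := by
            rw [← Finset.sum_subset (Finset.subset_univ ({d, α d} : Finset D)),
              Finset.sum_pair (Ne.symm hd)]
            · simp [φ]
            · intro x _ hx
              have : ¬ (x = d ∨ x = α d) := by simpa using hx
              simp [φ, this]
          rw [this] at h'
          exact (zmod2_eq_of_add h').symm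
      · intro h
        ext φ
        rw [hP]
        refine Finset.sum_involution (fun d _ => α d) ?_ ?_ (fun _ _ => Finset.mem_univ _)
          (fun d _ => hα d)
        · intro d _
          rw [h, φ.2.1, zmod2_add_self]
        · intro d _ hne hd
          exact hne (by rw [φ.2.2 d hd, mul_zero])
    constructor
    · rintro ⟨g, hgP, rfl⟩
      exact ⟨g.1 d₀, fun d => conn g.1 g.2 ((key g).1 hgP) d d₀⟩
    · rintro ⟨c, hc⟩
      exact ⟨⟨f, fun d => by rw [hc, hc]⟩, (key _).2 (fun d => (hc _).trans (hc _).symm), rfl⟩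
  have hrP := finrank_range_add_one P hF hkerP
  -- Let V, E, F count the cycles of `σ * α`, the edges and the cycles of `σ`. The cocycles are the
  -- annihilator of the range of `P`, of dimension E - (F - 1), and contain the coboundaries, of
  -- dimension V - 1. Exactness is equality of these dimensions, i.e. V + F = E + 2.
  have hZ := Subspace.finrank_add_finrank_dualCoannihilator_eq (LinearMap.range P)
  have hle : LinearMap.range T ≤ (LinearMap.range P).dualCoannihilator := by
    rintro _ ⟨g, rfl⟩
    rw [Submodule.mem_dualCoannihilator]
    rintro _ ⟨f, rfl⟩
    rw [hP]
    simp only [hT, mul_add, Finset.sum_add_distrib]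
    have : ∑ d, f.1 d * g.1 (σ d) = ∑ d, f.1 d * g.1 d := by
      rw [← Equiv.sum_comp σ (fun d => f.1 d * g.1 d)]
      exact Finset.sum_congr rfl fun d _ => by rw [f.2 d]
    rw [this, zmod2_add_self]
  have hiff : Exact₂ σ α ↔ (LinearMap.range P).dualCoannihilator ≤ LinearMap.range T := by
    constructor
    · intro h φ hφ
      rw [Submodule.mem_dualCoannihilator] at hφ
      obtain ⟨g, hg, hgφ⟩ := h φ.1 φ.2.1 φ.2.2 (fun f hf => hφ _ ⟨⟨f, hf⟩, rfl⟩)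
      exact ⟨⟨g, hg⟩, by ext d; rw [hT, hgφ]⟩
    · intro h φ h1 h2 h3
      have : (⟨φ, h1, h2⟩ : edgeFunctions α) ∈ (LinearMap.range P).dualCoannihilator := by
        rw [Submodule.mem_dualCoannihilator]
        rintro _ ⟨f, rfl⟩
        exact h3 f.1 f.2
      obtain ⟨g, hg⟩ := h this
      exact ⟨g.1, g.2, fun d => by rw [← hT, hg]⟩
  rw [hiff]
  have hfin : (LinearMap.range P).dualCoannihilator ≤ LinearMap.range T ↔
      Module.finrank (ZMod 2) (LinearMap.range P).dualCoannihilator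
        = Module.finrank (ZMod 2) (LinearMap.range T) := by
    constructor
    · intro h
      rw [le_antisymm h hle]
    · intro h
      exact (Submodule.eq_of_le_of_finrank_eq hle h.symm).ge
  rw [hfin]
  have hE' : Nat.card {d // ¬ α d = d} = Nat.card {d // α d ≠ d} := rfl
  rw [hE', ← hE]
  omega

end Exactness

/-! ## Preliminaries on permutations of finite sets -/

/-- The points that are reached from `r` by applying `f` and `g`. -/
inductive Reach {D : Type*} (f g : D → D) (r : D) : D → Prop
  | base : Reach f g r r
  | left {d : D} : Reach f g r d → Reach f g r (f d)
  | right {d : D} : Reach f g r d → Reach f g r (g d)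

/-- On a finite set, a subset that a permutation maps into itself is also stable under the inverse,
so words without inverses suffice. -/
lemma reach_of_closure {D : Type*} [Finite D] {σ α : Equiv.Perm D} {r d : D}
    (h : ∃ g ∈ Subgroup.closure {σ, α}, g r = d) : Reach σ α r d := by
  obtain ⟨g, hg, rfl⟩ := h
  have key : ∀ x, Reach σ α r x → Reach σ α r (g x) := by
    induction hg using Subgroup.closure_induction with
    | mem x hx =>
      rcases hx with rfl | hx
      · exact fun _ h => h.left
      · rw [Set.mem_singleton_iff] at hx
        subst hx
        exact fun _ h => h.right
    | one => exact fun _ h => h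
    | mul x y _ _ hx hy => exact fun z h => hx _ (hy _ h)
    | inv x _ hx =>
      exact fun z h => Equiv.Perm.perm_symm_on_of_perm_on_finite
        (p := fun z => Reach σ α r z) (fun z => hx z) h
  exact key r Reach.base

lemma closure_of_reach {D : Type*} {σ α : Equiv.Perm D} {r d : D}
    (h : Reach σ α r d) : ∃ g ∈ Subgroup.closure {σ, α}, g r = d := by
  induction h with
  | base => exact ⟨1, Subgroup.one_mem _, rfl⟩
  | left _ ih =>
    obtain ⟨g, hg, rfl⟩ := ih
    exact ⟨σ * g, Subgroup.mul_mem _ (Subgroup.subset_closure (by simp)) hg, rfl⟩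
  | right _ ih =>
    obtain ⟨g, hg, rfl⟩ := ih
    exact ⟨α * g, Subgroup.mul_mem _ (Subgroup.subset_closure (by simp)) hg, rfl⟩

lemma exists_iterate_of_sameCycle {D : Type*} [Finite D] {σ : Equiv.Perm D} {a b : D}
    (h : σ.SameCycle a b) : ∃ k, σ^[k] a = b := by
  obtain ⟨k, -, hk⟩ := h.exists_pow_eq' (f := σ)
  exact ⟨k, by rw [Equiv.Perm.iterate_eq_pow]; exact hk⟩

lemma sameCycle_iterate {D : Type*} (σ : Equiv.Perm D) (a : D) (k : ℕ) :
    σ.SameCycle a (σ^[k] a) := ⟨k, by rw [Equiv.Perm.iterate_eq_pow]; rfl⟩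

lemma sameCycle_iff_iterate {D : Type*} [Finite D] {σ : Equiv.Perm D} {a b : D} :
    σ.SameCycle a b ↔ ∃ k, σ^[k] a = b :=
  ⟨exists_iterate_of_sameCycle, fun ⟨k, hk⟩ => hk ▸ sameCycle_iterate σ a k⟩

lemma card_sameCycle {D : Type*} [Finite D] (σ : Equiv.Perm D) (a : D) :
    Nat.card {b // σ.SameCycle b a} = Function.minimalPeriod σ a := by
  classical
  have : Fintype (MulAction.orbit (Subgroup.zpowers σ) a) := Fintype.ofFinite _
  have h := MulAction.minimalPeriod_eq_card (a := σ) (b := a)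
  have h' : Function.minimalPeriod σ a = Function.minimalPeriod (fun x => σ • x) a := rfl
  rw [h', h, ← Nat.card_eq_fintype_card]
  refine Nat.card_congr (Equiv.subtypeEquivRight fun b => ?_)
  constructor
  · rintro ⟨i, hi⟩
    exact ⟨⟨σ ^ (-i), Subgroup.zpow_mem_zpowers _ _⟩, by
      rw [← hi]; change (σ ^ (-i)) ((σ ^ i) b) = b; simp⟩
  · rintro ⟨⟨_, i, rfl⟩, hi⟩
    exact Equiv.Perm.SameCycle.symm ⟨i, hi⟩

lemma minimalPeriod_eq_of_semiconj {D E : Type*} {f : D → D} {g : E → E} {i : D → E}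
    (hi : Function.Injective i) {a : D} (h : ∀ k, i (f^[k] a) = g^[k] (i a)) :
    Function.minimalPeriod f a = Function.minimalPeriod g (i a) := by
  refine Function.minimalPeriod_eq_minimalPeriod_iff.2 fun n => ?_
  unfold Function.IsPeriodicPt Function.IsFixedPt
  rw [← h]
  exact hi.eq_iff.symm

lemma minimalPeriod_perm_pos {D : Type*} [Finite D] (σ : Equiv.Perm D) (a : D) :
    0 < Function.minimalPeriod σ a :=
  Function.minimalPeriod_pos_of_mem_periodicPts
    ⟨orderOf σ, orderOf_pos σ, by
      unfold Function.IsPeriodicPt Function.IsFixedPt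
      rw [Equiv.Perm.iterate_eq_pow, pow_orderOf_eq_one]; rfl⟩

namespace HoledMap

lemma firstIter_eq {α : Type} {f : α → α} {P : α → Prop} {a : α} {k : ℕ} (hk : 0 < k)
    (hP : P (f^[k] a)) (hmin : ∀ j, 0 < j → j < k → ¬ P (f^[j] a)) :
    firstIter f P a = f^[k] a := by
  unfold firstIter
  congr 1
  exact IsLeast.csInf_eq ⟨⟨hk, hP⟩, fun j hj => not_lt.1 fun h => hmin j hj.1 h hj.2⟩

lemma firstIter_spec {α : Type} {f : α → α} {P : α → Prop} {a : α} (h : ∃ k, 0 < k ∧ P (f^[k] a)) :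
    ∃ k, 0 < k ∧ firstIter f P a = f^[k] a ∧ P (f^[k] a) ∧ ∀ j, 0 < j → j < k → ¬ P (f^[j] a) := by
  have hm := Nat.sInf_mem h
  exact ⟨_, hm.1, rfl, hm.2, fun j hj hjk hP => Nat.notMem_of_lt_sInf hjk ⟨hj, hP⟩⟩

lemma exists_firstIter_eq {α : Type} (f : α → α) (P : α → Prop) (a : α) :
    ∃ k, firstIter f P a = f^[k] a := ⟨_, rfl⟩

/-! ## Basic facts about maps with holes -/

instance (m : HoledMap) : Finite m.D := m.fin
noncomputable instance (m : HoledMap) : Fintype m.D := Fintype.ofFinite _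
instance (m : HoledMap) : Nonempty m.D := ⟨m.root⟩
instance (m : HoledMap) : Finite m.Face := Quotient.finite _
instance (m : HoledMap) : Finite m.Cyc := Quotient.finite _
instance (m : HoledMap) : Finite m.Hole := Subtype.finite

variable (m : HoledMap)

lemma faceOf_eq_iff {a b : m.D} : m.faceOf a = m.faceOf b ↔ m.face.SameCycle a b :=
  Quotient.eq (r := Equiv.Perm.SameCycle.setoid m.face)

lemma faceOf_eq_iff_iterate {a b : m.D} : m.faceOf a = m.faceOf b ↔ ∃ k, m.face^[k] a = b := by
  rw [faceOf_eq_iff, sameCycle_iff_iterate]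

lemma cycOf_eq_iff {a b : m.D} : m.cycOf a = m.cycOf b ↔ m.around.SameCycle a b :=
  Quotient.eq (r := Equiv.Perm.SameCycle.setoid m.around)

lemma cycOf_eq_iff_iterate {a b : m.D} : m.cycOf a = m.cycOf b ↔ ∃ k, m.around^[k] a = b := by
  rw [cycOf_eq_iff, sameCycle_iff_iterate]

lemma faceOf_surjective : Function.Surjective m.faceOf := Quotient.mk_surjective

lemma around_apply (d : m.D) : m.around d = m.face (m.opp d) := rfl

lemma around_mul_opp : m.around * m.opp = m.face := by
  ext d
  simp [around, m.opp_opp]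

lemma cycOf_around (d : m.D) : m.cycOf (m.around d) = m.cycOf d :=
  ((m.cycOf_eq_iff_iterate).2 ⟨1, rfl⟩).symm

lemma faceOf_iterate (k : ℕ) (d : m.D) : m.faceOf (m.face^[k] d) = m.faceOf d :=
  ((m.faceOf_eq_iff_iterate).2 ⟨k, rfl⟩).symm

lemma faceOf_symm (d : m.D) : m.faceOf (m.face.symm d) = m.faceOf d := by
  rw [← m.faceOf_face (m.face.symm d), Equiv.apply_symm_apply]

lemma cycOf_iterate (k : ℕ) (d : m.D) : m.cycOf (m.around^[k] d) = m.cycOf d :=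
  ((m.cycOf_eq_iff_iterate).2 ⟨k, rfl⟩).symm

lemma onRootFace_iff {d : m.D} : m.OnRootFace d ↔ ∃ k, m.face^[k] m.root = d := by
  unfold OnRootFace
  rw [eq_comm, faceOf_eq_iff_iterate]

lemma onRootFace_face {d : m.D} : m.OnRootFace (m.face d) ↔ m.OnRootFace d := by
  unfold OnRootFace
  rw [faceOf_face]

lemma active_opp {d : m.D} : m.Active (m.opp d) ↔ m.Active d := by
  unfold Active
  rw [m.opp_opp, eq_comm]

lemma card_face (d : m.D) : Nat.card {d' : m.D // m.faceOf d' = m.faceOf d}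
    = Function.minimalPeriod m.face d := by
  rw [← card_sameCycle]
  exact Nat.card_congr (Equiv.subtypeEquivRight fun b => m.faceOf_eq_iff)

lemma perimeter_eq : m.perimeter = Function.minimalPeriod m.face m.root := m.card_face m.root

variable {m}

lemma reach_invariant {E : Type*} {D : Type*} {f g : D → D} {r : D} {F : D → E}
    (hf : ∀ d, F (f d) = F d) (hg : ∀ d, F (g d) = F d) {d : D} (h : Reach f g r d) :
    F d = F r := by
  induction h with
  | base => rfl
  | left _ ih => rw [hf, ih]
  | right _ ih => rw [hg, ih]

lemma exact_iff_planar (hm : ∀ d, Reach m.face m.opp m.root d) :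
    Exact₂ m.face m.opp ↔
      2 * Nat.card m.Cyc + 2 * m.numFaces = Nat.card {d : m.D // ¬ m.Active d} + 4 :=
  exact₂_iff m.face m.opp m.opp_opp fun _ h1 h2 d d' =>
    (reach_invariant h1 h2 (hm d)).trans (reach_invariant h1 h2 (hm d')).symm

/-- Since `around * opp = face`, passing to the dual exchanges the cycles of `face` and of `around`
and does not change Euler's formula. The dual form yields potentials that are constant on faces,
which is what separates the holes. -/
lemma exact_dual_iff_planar (hm : ∀ d, Reach m.face m.opp m.root d) :
    Exact₂ m.around m.opp ↔
      2 * Nat.card m.Cyc + 2 * m.numFaces = Nat.card {d : m.D // ¬ m.Active d} + 4 := by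
  rw [exact₂_iff m.around m.opp m.opp_opp]
  · rw [around_mul_opp, add_comm (2 * _)]
    rfl
  · intro f h1 h2 d d'
    have h3 : ∀ d, f (m.face d) = f d := fun d => by
      have := h1 (m.opp d)
      rw [around_apply, m.opp_opp, h2] at this
      exact this
    exact (reach_invariant h3 h2 (hm d)).trans (reach_invariant h3 h2 (hm d')).symm

lemma isQuad_iff : m.IsQuad ↔ (∀ d, Reach m.face m.opp m.root d) ∧ Exact₂ m.face m.opp ∧
    ∀ d, ¬ m.OnRootFace d → Function.minimalPeriod m.face d = 4 := by
  constructor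
  · intro h
    have hr := fun d => reach_of_closure (h.connected d)
    exact ⟨hr, (exact_iff_planar hr).2 h.planar, fun d hd => by rw [← card_face, h.quad d hd]⟩
  · rintro ⟨h1, h2, h3⟩
    exact ⟨fun d => closure_of_reach (h1 d), (exact_iff_planar h1).1 h2,
      fun d hd => by rw [card_face, h3 d hd]⟩

lemma IsQuad.reach (h : m.IsQuad) (d : m.D) : Reach m.face m.opp m.root d := (isQuad_iff.1 h).1 d

lemma IsQuad.exact (h : m.IsQuad) : Exact₂ m.face m.opp := (isQuad_iff.1 h).2.1

lemma IsQuad.exact_dual (h : m.IsQuad) : Exact₂ m.around m.opp :=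
  (exact_dual_iff_planar h.reach).2 h.planar

lemma IsQuad.minimalPeriod (h : m.IsQuad) {d : m.D} (hd : ¬ m.OnRootFace d) :
    Function.minimalPeriod m.face d = 4 := (isQuad_iff.1 h).2.2 d hd

lemma isQuad_of_dual (h1 : ∀ d, Reach m.face m.opp m.root d) (h2 : Exact₂ m.around m.opp)
    (h3 : ∀ d, ¬ m.OnRootFace d → Function.minimalPeriod m.face d = 4) : m.IsQuad :=
  isQuad_iff.2 ⟨h1, (exact_iff_planar h1).2 ((exact_dual_iff_planar h1).1 h2), h3⟩

/-- A set of darts that contains the root and is closed under `face` and `opp` is everything. -/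
lemma IsQuad.induction (h : m.IsQuad) {P : m.D → Prop} (root : P m.root)
    (face : ∀ d, P d → P (m.face d)) (opp : ∀ d, P d → P (m.opp d)) (d : m.D) : P d := by
  induction h.reach d with
  | base => exact root
  | left _ ih => exact face _ ih
  | right _ ih => exact opp _ ih

/-! ## The boundary of a hole -/

variable (m)

lemma exists_iterate_self {D : Type*} [Finite D] (σ : Equiv.Perm D) (d : D) :
    ∃ k, 0 < k ∧ σ^[k] d = d :=
  ⟨_, minimalPeriod_perm_pos σ d, Function.iterate_minimalPeriod⟩

lemma exists_pos_iterate {D : Type*} [Finite D] {σ : Equiv.Perm D} {a b : D}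
    (h : σ.SameCycle a b) : ∃ k, 0 < k ∧ σ^[k] a = b := by
  obtain ⟨k, hk⟩ := exists_iterate_of_sameCycle h
  obtain ⟨l, hl, hl'⟩ := exists_iterate_self σ a
  exact ⟨k + l, by omega, by rw [Function.iterate_add_apply, hl', hk]⟩

/-- The dart lies on a cycle that runs around a hole. -/
def AroundHole (d : m.D) : Prop := ∃ x, m.Active x ∧ m.cycOf x = m.cycOf d

variable {m}

lemma AroundHole.exists {d : m.D} (h : m.AroundHole d) : ∃ k, 0 < k ∧ m.Active (m.around^[k] d) := by
  obtain ⟨x, hx, hxd⟩ := h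
  obtain ⟨k, hk, hk'⟩ := exists_pos_iterate ((m.cycOf_eq_iff).1 hxd.symm)
  exact ⟨k, hk, hk' ▸ hx⟩

lemma Active.aroundHole {x : m.D} (h : m.Active x) : m.AroundHole x := ⟨x, h, rfl⟩

lemma aroundHole_around {d : m.D} : m.AroundHole (m.around d) ↔ m.AroundHole d := by
  unfold AroundHole
  rw [cycOf_around]

lemma cycOf_nextActive (d : m.D) : m.cycOf (m.nextActive d) = m.cycOf d := by
  obtain ⟨k, hk⟩ := exists_firstIter_eq m.around m.Active d
  rw [nextActive, hk, cycOf_iterate]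

lemma AroundHole.nextActive {d : m.D} (h : m.AroundHole d) : m.Active (m.nextActive d) := by
  obtain ⟨k, _, hk, hk', _⟩ := firstIter_spec h.exists
  rw [HoledMap.nextActive, hk]
  exact hk'

lemma Active.nextActive {x : m.D} (h : m.Active x) : m.Active (m.nextActive x) :=
  h.aroundHole.nextActive

lemma cycOf_nextActive_iterate (k : ℕ) (d : m.D) : m.cycOf (m.nextActive^[k] d) = m.cycOf d := by
  induction k with
  | zero => rfl
  | succ k ih => rw [Function.iterate_succ_apply', cycOf_nextActive, ih]

lemma Active.nextActive_iterate {x : m.D} (h : m.Active x) (k : ℕ) :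
    m.Active (m.nextActive^[k] x) := by
  induction k with
  | zero => exact h
  | succ k ih => rw [Function.iterate_succ_apply']; exact ih.nextActive

lemma nextActive_of_active {d : m.D} (h : m.Active (m.around d)) : m.nextActive d = m.around d :=
  firstIter_eq (k := 1) one_pos h (fun j h1 h2 => by omega)

lemma nextActive_of_not_active {d : m.D} (hd : m.AroundHole d) (h : ¬ m.Active (m.around d)) :
    m.nextActive d = m.nextActive (m.around d) := by
  obtain ⟨k, hk, h1, h2, h3⟩ := firstIter_spec hd.exists
  have hk1 : k ≠ 1 := by
    rintro rfl
    exact h h2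
  obtain ⟨l, rfl⟩ : ∃ l, k = l + 1 := ⟨k - 1, by omega⟩
  rw [Function.iterate_succ_apply] at h2
  rw [nextActive, h1, nextActive, Function.iterate_succ_apply]
  refine (firstIter_eq (by omega) h2 fun j hj hjl => ?_).symm
  rw [← Function.iterate_succ_apply]
  exact h3 _ (by omega) (by omega)

/-- A function that does not change along a cycle, except possibly at active darts, takes the same
value at `around d` and at the next active dart. -/
lemma apply_nextActive {E : Type*} {F : m.D → E} (hF : ∀ d, ¬ m.Active d → F (m.around d) = F d)
    {d : m.D} (hd : m.AroundHole d) : F (m.nextActive d) = F (m.around d) := by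
  obtain ⟨k, hk, h1, h2, h3⟩ := firstIter_spec hd.exists
  rw [nextActive, h1]
  clear h1 h2
  induction k with
  | zero => omega
  | succ k ih =>
    rcases Nat.eq_zero_or_pos k with rfl | hk'
    · rfl
    · rw [Function.iterate_succ_apply', hF _ (h3 k hk' (by omega))]
      exact ih hk' fun j hj hjk => h3 j hj (by omega)

lemma apply_nextActive_of_active {E : Type*} {F : m.D → E}
    (hF : ∀ d, ¬ m.Active d → F (m.around d) = F d) {x : m.D} (hx : m.Active x) :
    F (m.nextActive x) = F (m.face x) := by
  rw [apply_nextActive hF hx.aroundHole, around_apply, hx]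

/-- Step back from the common value: if the two numbers of steps differed, the dart with fewer steps
would be an active dart met from the other one before its first active dart. -/
lemma nextActive_injOn {x y : m.D} (hx : m.Active x) (hy : m.Active y)
    (h : m.nextActive x = m.nextActive y) : x = y := by
  obtain ⟨k, hk, h1, h2, h3⟩ := firstIter_spec hx.aroundHole.exists
  obtain ⟨l, hl, h1', h2', h3'⟩ := firstIter_spec hy.aroundHole.exists
  rw [nextActive, nextActive, h1, h1'] at h
  have key : ∀ {k l : ℕ} {x y : m.D}, m.Active y → k ≤ l → 0 < k → m.around^[k] x = m.around^[l] y →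
      m.Active x → (∀ j, 0 < j → j < l → ¬ m.Active (m.around^[j] y)) → x = y := by
    intro k l x y hy hkl hk h hx hmin
    obtain ⟨j, rfl⟩ : ∃ j, l = k + j := ⟨l - k, by omega⟩
    rw [Function.iterate_add_apply] at h
    have h4 := (m.around.injective.iterate k) h
    rcases Nat.eq_zero_or_pos j with rfl | hj
    · exact h4
    · exact absurd (h4 ▸ hx) (hmin j hj (by omega))
  rcases le_total k l with hkl | hkl
  · exact key hy hkl hk h hx h3'
  · exact (key hx hkl hl h.symm hy h3).symm

/-- Strong induction on the number of steps of `around`: as `y` is active, the first active dart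
after `x` cannot lie beyond `y`. -/
lemma exists_nextActive_iterate {x y : m.D} (hx : m.Active x) (hy : m.Active y)
    (h : m.cycOf x = m.cycOf y) : ∃ k, m.nextActive^[k] x = y := by
  obtain ⟨n, hn⟩ := (m.cycOf_eq_iff_iterate).1 h
  induction n using Nat.strong_induction_on generalizing x with
  | _ n ih =>
    rcases Nat.eq_zero_or_pos n with rfl | hn'
    · exact ⟨0, hn⟩
    · obtain ⟨k, hk, h1, h2, h3⟩ := firstIter_spec hx.aroundHole.exists
      have hkn : k ≤ n := not_lt.1 fun h' => h3 n hn' h' (hn ▸ hy)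
      obtain ⟨l, rfl⟩ : ∃ l, n = l + k := ⟨n - k, by omega⟩
      rw [Function.iterate_add_apply, ← h1] at hn
      obtain ⟨j, hj⟩ := ih l (by omega) (x := m.nextActive x) hx.nextActive
        (by rw [cycOf_nextActive, h]) hn
      exact ⟨j + 1, by rw [Function.iterate_succ_apply, hj]⟩

/-- The hole on the left of an active dart. -/
def holeOf {x : m.D} (hx : m.Active x) : m.Hole := ⟨m.cycOf x, x, hx, rfl⟩

/-- The permutation of the active darts of a cycle that sends each of them to the next one. -/
noncomputable def boundaryPerm (m : HoledMap) (c : m.Cyc) :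
    Equiv.Perm {d : m.D // m.Active d ∧ m.cycOf d = c} :=
  Equiv.ofBijective (fun s => ⟨m.nextActive s.1, s.2.1.nextActive, by rw [cycOf_nextActive, s.2.2]⟩)
    (Finite.injective_iff_bijective.1 fun a b hab =>
      Subtype.ext (nextActive_injOn a.2.1 b.2.1 (congrArg Subtype.val hab)))

lemma boundaryPerm_coe (c : m.Cyc) (s : {d : m.D // m.Active d ∧ m.cycOf d = c}) :
    (m.boundaryPerm c s).1 = m.nextActive s.1 := rfl

lemma boundaryPerm_iterate_coe (c : m.Cyc) (k : ℕ) (s : {d : m.D // m.Active d ∧ m.cycOf d = c}) :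
    ((m.boundaryPerm c)^[k] s).1 = m.nextActive^[k] s.1 := by
  induction k generalizing s with
  | zero => rfl
  | succ k ih => rw [Function.iterate_succ_apply, ih]; rfl

/-- `nextActive` permutes the active darts of a hole in a single cycle. This is what allows the
boundary of a hole to be matched with a root face of the same degree. -/
lemma minimalPeriod_nextActive {h : m.Hole} {x : m.D} (hx : m.Active x) (hxh : m.cycOf x = h.1) :
    Function.minimalPeriod m.nextActive x = m.holeDeg h := by
  have h1 := minimalPeriod_eq_of_semiconj (f := m.boundaryPerm h.1) (g := m.nextActive)
    Subtype.val_injective (a := ⟨x, hx, hxh⟩) (fun k => boundaryPerm_iterate_coe h.1 k _)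
  rw [← h1, ← card_sameCycle, holeDeg]
  refine Nat.card_congr (Equiv.subtypeUnivEquiv fun s => ?_)
  obtain ⟨k, hk⟩ := exists_nextActive_iterate s.2.1 hx (s.2.2.trans hxh.symm)
  exact sameCycle_iff_iterate.2 ⟨k, Subtype.ext ((boundaryPerm_iterate_coe h.1 k s).trans hk)⟩

end HoledMap

namespace HoledMap

/-! ## Embeddings -/

/-- An embedding of the polygons of `p` into those of `m` that respects the root and the gluings
of `p`. -/
structure Emb (p m : HoledMap) where
  toFun : p.D → m.D
  inj : Function.Injective toFun
  map_root : toFun p.root = m.root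
  map_face : ∀ d, toFun (p.face d) = m.face (toFun d)
  map_opp : ∀ d, ¬ p.Active d → toFun (p.opp d) = m.opp (toFun d)

instance (p m : HoledMap) : CoeFun (Emb p m) (fun _ => p.D → m.D) := ⟨Emb.toFun⟩

variable {p q m : HoledMap}

def Iso.toEmb (f : Iso p m) : Emb p m where
  toFun := f.toEquiv
  inj := f.toEquiv.injective
  map_root := f.map_root
  map_face := f.map_face
  map_opp d _ := f.map_opp d

lemma Iso.active_iff (f : Iso p m) (d : p.D) : m.Active (f.toEquiv d) ↔ p.Active d := by
  unfold Active
  rw [← f.map_opp, f.toEquiv.injective.eq_iff]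

lemma Emb.not_active (e : Emb p m) {d : p.D} (hd : ¬ p.Active d) : ¬ m.Active (e d) := by
  unfold Active
  rw [← e.map_opp d hd]
  exact fun h => hd (e.inj h)

def Emb.trans (e : Emb p q) (e' : Emb q m) : Emb p m where
  toFun := e'.toFun ∘ e.toFun
  inj := e'.inj.comp e.inj
  map_root := by rw [Function.comp_apply, e.map_root, e'.map_root]
  map_face d := by simp only [Function.comp_apply, e.map_face, e'.map_face]
  map_opp d hd := by
    simp only [Function.comp_apply, e.map_opp d hd, e'.map_opp _ (e.not_active hd)]

lemma Emb.map_around (e : Emb p m) {d : p.D} (hd : ¬ p.Active d) :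
    e (p.around d) = m.around (e d) := by
  rw [around_apply, e.map_face, e.map_opp d hd, around_apply]

lemma Emb.map_iterate (e : Emb p m) (k : ℕ) (d : p.D) : e (p.face^[k] d) = m.face^[k] (e d) := by
  induction k with
  | zero => rfl
  | succ k ih => rw [Function.iterate_succ_apply', Function.iterate_succ_apply', e.map_face, ih]

lemma Emb.map_symm (e : Emb p m) (d : p.D) : e (p.face.symm d) = m.face.symm (e d) := by
  rw [Equiv.eq_symm_apply, ← e.map_face, Equiv.apply_symm_apply]

lemma Emb.faceOf_eq_iff (e : Emb p m) {a b : p.D} :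
    m.faceOf (e a) = m.faceOf (e b) ↔ p.faceOf a = p.faceOf b := by
  rw [faceOf_eq_iff_iterate, faceOf_eq_iff_iterate]
  exact exists_congr fun k => by rw [← e.map_iterate, e.inj.eq_iff]

lemma Emb.onRootFace_iff (e : Emb p m) {d : p.D} : m.OnRootFace (e d) ↔ p.OnRootFace d := by
  unfold OnRootFace
  rw [← e.map_root, e.faceOf_eq_iff]

lemma Emb.minimalPeriod (e : Emb p m) (d : p.D) :
    Function.minimalPeriod p.face d = Function.minimalPeriod m.face (e d) :=
  minimalPeriod_eq_of_semiconj e.inj fun k => e.map_iterate k d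

lemma Emb.perimeter (e : Emb p m) : p.perimeter = m.perimeter := by
  rw [perimeter_eq, perimeter_eq, e.minimalPeriod, e.map_root]

lemma Emb.mem_range_of_faceOf (e : Emb p m) {d : m.D} {a : p.D} (h : m.faceOf d = m.faceOf (e a)) :
    d ∈ Set.range e := by
  obtain ⟨k, hk⟩ := (m.faceOf_eq_iff_iterate).1 h.symm
  exact ⟨p.face^[k] a, by rw [e.map_iterate, hk]⟩

lemma Emb.face_mem_range (e : Emb p m) {d : m.D} :
    m.face d ∈ Set.range e ↔ d ∈ Set.range e := by
  constructor
  · rintro ⟨a, ha⟩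
    exact e.mem_range_of_faceOf (a := a) (by rw [ha, faceOf_face])
  · rintro ⟨a, rfl⟩
    exact ⟨_, e.map_face a⟩

lemma Emb.mem_range_of_onRootFace (e : Emb p m) {d : m.D} (h : m.OnRootFace d) :
    d ∈ Set.range e := e.mem_range_of_faceOf (a := p.root) (by rw [e.map_root]; exact h)

/-- An embedding of a connected map is unique. -/
lemma Emb.ext_of_reach (e e' : Emb p m) (hp : ∀ d, Reach p.face p.opp p.root d) (d : p.D) :
    e d = e' d := by
  induction hp d with
  | base => rw [e.map_root, e'.map_root]
  | left _ ih => rw [e.map_face, e'.map_face, ih]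
  | @right d _ ih =>
    by_cases hd : p.Active d
    · rw [hd, ih]
    · rw [e.map_opp d hd, e'.map_opp d hd, ih]

lemma sum_extend (e : Emb p m) (f : m.D → ZMod 2) (φ : p.D → ZMod 2) :
    ∑ d, f d * Function.extend e φ 0 d = ∑ d, f (e d) * φ d := by
  symm
  refine Fintype.sum_of_injective e e.inj _ _ (fun d hd => ?_) (fun d => ?_)
  · rw [Function.extend_apply' _ _ _ hd, Pi.zero_apply, mul_zero]
  · rw [e.inj.extend_apply]

/-- A connected map that is embedded in a planar quadrangulation is a planar quadrangulation. -/
lemma Emb.isQuad (e : Emb p m) (hm : m.IsQuad) (hp : ∀ d, Reach p.face p.opp p.root d) :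
    p.IsQuad := by
  refine isQuad_iff.2 ⟨hp, ?_, fun d hd => ?_⟩
  · intro φ h1 h2 h3
    -- Extended by zero, a cochain of `p` is a cochain of `m`: it vanishes at the active darts, the
    -- only ones that `m` may glue differently.
    have c1 : ∀ d, Function.extend e φ 0 (m.opp d) = Function.extend e φ 0 d := by
      intro d
      by_cases hd : d ∈ Set.range e ∧ m.opp d ∈ Set.range e
      · obtain ⟨⟨a, rfl⟩, b, hb⟩ := hd
        rw [← hb, e.inj.extend_apply, e.inj.extend_apply]
        by_cases ha : p.Active a
        · by_cases hb' : p.Active b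
          · rw [h2 a ha, h2 b hb']
          · have h4 := e.map_opp b hb'
            rw [hb, m.opp_opp] at h4
            rw [← e.inj h4, h1]
        · rw [← e.map_opp a ha] at hb
          rw [e.inj hb, h1]
      · have key : ∀ x, x ∈ Set.range e → m.opp x ∉ Set.range e → Function.extend e φ 0 x = 0 := by
          rintro _ ⟨a, rfl⟩ ha
          rw [e.inj.extend_apply]
          refine h2 a (by_contra fun h => ha ⟨_, e.map_opp a h⟩)
        by_cases hd1 : d ∈ Set.range e
        · have hd2 := fun h => hd ⟨hd1, h⟩
          rw [key d hd1 hd2, Function.extend_apply' _ _ _ hd2]; rfl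
        · rw [Function.extend_apply' _ _ _ hd1]
          by_cases hd2 : m.opp d ∈ Set.range e
          · rw [key _ hd2 (by rwa [m.opp_opp])]; rfl
          · rw [Function.extend_apply' _ _ _ hd2]; rfl
    have c2 : ∀ d, m.opp d = d → Function.extend e φ 0 d = 0 := by
      intro d hd
      by_cases hd1 : d ∈ Set.range e
      · obtain ⟨a, rfl⟩ := hd1
        rw [e.inj.extend_apply]
        exact h2 a (by_contra fun h => e.not_active h hd)
      · rw [Function.extend_apply' _ _ _ hd1]; rfl
    have c3 : ∀ f : m.D → ZMod 2, (∀ d, f (m.face d) = f d) →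
        ∑ d, f d * Function.extend e φ 0 d = 0 := by
      intro f hf
      rw [sum_extend]
      exact h3 _ fun d => by rw [e.map_face, hf]
    obtain ⟨g, hg, hgφ⟩ := hm.exact (Function.extend e φ 0) c1 c2 c3
    have hφ : ∀ d, φ d = g (e (p.face d)) + g (e d) := fun d => by
        rw [e.map_face, ← hgφ, e.inj.extend_apply]
    -- At an active dart, invariance under `around` does not come from `m`, which may glue this
    -- dart; it comes from `φ d = 0`.
    refine ⟨fun d => g (e d), fun d => ?_, hφ⟩
    by_cases hd : p.Active d
    · beta_reduce
      rw [hd]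
      exact zmod2_eq_of_add (by rw [← hφ, h2 d hd])
    · beta_reduce
      rw [e.map_face, e.map_opp d hd, hg]
  · rw [e.minimalPeriod]
    exact hm.minimalPeriod (by rwa [e.onRootFace_iff])

lemma Iso.isQuad (f : Iso p m) (hm : m.IsQuad) : p.IsQuad := by
  refine f.toEmb.isQuad hm fun d => ?_
  refine hm.induction (P := fun d => Reach p.face p.opp p.root (f.toEquiv.symm d)) ?_ ?_ ?_
    (f.toEquiv d) |> fun h => by simpa using h
  · rw [← f.map_root, Equiv.symm_apply_apply]; exact Reach.base
  · intro d h
    rw [f.symm.map_face d |> fun h' => (show f.toEquiv.symm (m.face d) = _ from h')]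
    exact h.left
  · intro d h
    rw [f.symm.map_opp d |> fun h' => (show f.toEquiv.symm (m.opp d) = _ from h')]
    exact h.right

lemma Iso.perimeter (f : Iso p m) : p.perimeter = m.perimeter := f.toEmb.perimeter

lemma Iso.isClosed (f : Iso p m) (hm : m.IsClosed) : p.IsClosed :=
  fun d hd => hm _ ((f.active_iff d).2 hd)

lemma Iso.numFaces (f : Iso p m) : p.numFaces = m.numFaces := by
  refine Nat.card_congr (Quotient.congr f.toEquiv fun a b => ?_)
  change p.face.SameCycle a b ↔ m.face.SameCycle _ _
  rw [← faceOf_eq_iff, ← faceOf_eq_iff]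
  exact f.toEmb.faceOf_eq_iff.symm

end HoledMap

namespace HoledMap

variable {p m : HoledMap}

/-! ## Cutting a map along an embedded map -/

/-- The darts of `m` that belong to the part of `m` in the hole of `p` on the left of `x₀`. -/
inductive Filling (e : Emb p m) (x₀ : p.D) : m.D → Prop
  | base : Filling e x₀ (e x₀)
  | next {x : p.D} : p.Active x → Filling e x₀ (e x) → Filling e x₀ (e (p.nextActive x))
  | face {d : m.D} : d ∉ Set.range e → Filling e x₀ d → Filling e x₀ (m.face d)
  | opp {d : m.D} : Filling e x₀ d → Filling e x₀ (m.opp d)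

/-- Glued pairs of `p` stay glued in `m`, so a dart of such a pair cannot appear across the edge of
an active dart. -/
lemma Emb.opp_active (e : Emb p m) {x y : p.D} (hx : p.Active x) (h : m.opp (e x) = e y) :
    p.Active y := by
  by_contra hy
  have h1 := e.map_opp y hy
  rw [← h, m.opp_opp] at h1
  rw [← e.inj h1, Active, p.opp_opp] at hx
  exact hy hx.symm

lemma Emb.opp_active_of_notMem (e : Emb p m) {d : m.D} (hd : d ∉ Set.range e) {y : p.D}
    (h : m.opp d = e y) : p.Active y := by
  by_contra hy
  have h1 := e.map_opp y hy
  rw [← h, m.opp_opp] at h1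
  exact hd ⟨_, h1⟩

lemma Filling.active_or {e : Emb p m} {x₀ : p.D} (h₀ : p.Active x₀) {d : m.D}
    (h : Filling e x₀ d) : (∃ x, p.Active x ∧ e x = d) ∨ d ∉ Set.range e := by
  induction h with
  | base => exact Or.inl ⟨x₀, h₀, rfl⟩
  | next hx _ _ => exact Or.inl ⟨_, hx.nextActive, rfl⟩
  | face hd _ _ => exact Or.inr fun h => hd (e.face_mem_range.1 h)
  | @opp d _ ih =>
    by_cases h : m.opp d ∈ Set.range e
    · obtain ⟨y, hy⟩ := h
      left
      rcases ih with ⟨x, hx, rfl⟩ | hd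
      · exact ⟨y, e.opp_active hx hy.symm, hy⟩
      · exact ⟨y, e.opp_active_of_notMem hd hy.symm, hy⟩
    · exact Or.inr h

lemma Filling.active {e : Emb p m} {x₀ : p.D} (h₀ : p.Active x₀) {x : p.D}
    (h : Filling e x₀ (e x)) : p.Active x := by
  rcases h.active_or h₀ with ⟨y, hy, hyx⟩ | h'
  · rwa [← e.inj hyx]
  · exact absurd ⟨x, rfl⟩ h'

lemma Filling.of_cycOf (e : Emb p m) {x₀ x : p.D} (h₀ : p.Active x₀) (hx : p.Active x)
    (h : p.cycOf x = p.cycOf x₀) : Filling e x₀ (e x) := by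
  obtain ⟨k, rfl⟩ := exists_nextActive_iterate h₀ hx h.symm
  clear h hx
  induction k with
  | zero => exact Filling.base
  | succ k ih =>
    rw [Function.iterate_succ_apply']
    exact Filling.next (h₀.nextActive_iterate k) ih

/-- `f` is a function of the start vertex. The rotation of `p` from `face x` to the next active dart
passes only through glued edges, which `m` respects, so the boundary walk of a hole remains a walk
in `m`. -/
lemma apply_emb_nextActive (e : Emb p m) {E : Type*} {f : m.D → E}
    (hf : ∀ d, f (m.around d) = f d) {x : p.D} (hx : p.Active x) :
    f (e (p.nextActive x)) = f (m.face (e x)) := by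
  rw [← e.map_face]
  refine apply_nextActive_of_active (F := fun d => f (e d)) (fun d hd => ?_) hx
  rw [e.map_around hd, hf]

/-- A function on the faces of `m` that does not jump across the glued edges of `p` cannot vary on
`p`, which is connected through these edges alone. -/
lemma apply_emb_eq_root (e : Emb p m) (hp : p.IsQuad) {E : Type*} {g : m.D → E}
    (h1 : ∀ d, g (m.face d) = g d) (h2 : ∀ d, ¬ p.Active d → g (m.opp (e d)) = g (e d)) (d : p.D) :
    g (e d) = g m.root := by
  refine hp.induction (P := fun d => g (e d) = g m.root) (by rw [e.map_root])
    (fun d h => by rw [e.map_face, h1, h]) (fun d h => ?_) d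
  by_cases hd : p.Active d
  · rwa [hd]
  · rw [e.map_opp d hd, h2 d hd, h]

open Classical in
/-- Planarity: the parts of `m` in different holes of `p` are separated by a function that is
constant on the faces. -/
lemma exists_separation (e : Emb p m) (hp : p.IsQuad) (hm : m.IsQuad) {x₀ : p.D} :
    ∃ (g : m.D → ZMod 2) (g₀ : ZMod 2), ∀ x₁, p.Active x₁ → ∀ d, Filling e x₁ d →
      (∃ x, p.Active x ∧ (p.cycOf x = p.cycOf x₀ ↔ p.cycOf x₁ = p.cycOf x₀) ∧ e x = d) ∨
      (d ∉ Set.range e ∧ g d = g₀ + if p.cycOf x₁ = p.cycOf x₀ then 1 else 0) := by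
  -- A discrete Jordan curve theorem. `b` marks the boundary of the hole of `x₀`; modulo two, `b d +
  -- b (opp d)` is a closed curve, and its potential `g` on the faces distinguishes the inside of
  -- this hole from the other holes.
  let b : m.D → ZMod 2 := fun d =>
    if ∃ x, p.Active x ∧ p.cycOf x = p.cycOf x₀ ∧ e x = d then 1 else 0
  have hb : ∀ x, p.Active x → b (e x) = if p.cycOf x = p.cycOf x₀ then 1 else 0 := by
    intro x hx
    simp only [b]
    congr 1
    refine propext ⟨?_, fun h => ⟨x, hx, h, rfl⟩⟩
    rintro ⟨y, -, hy, hyx⟩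
    rwa [← e.inj hyx]
  have hb0 : ∀ d, (∀ x, p.Active x → e x ≠ d) → b d = 0 := fun d h =>
    if_neg fun ⟨x, hx, _, hxd⟩ => h x hx hxd
  have c1 : ∀ d, b (m.opp d) + b (m.opp (m.opp d)) = b d + b (m.opp d) := by
    intro d
    rw [m.opp_opp, add_comm]
  have c2 : ∀ d, m.opp d = d → b d + b (m.opp d) = 0 := by
    intro d hd
    rw [hd, zmod2_add_self]
  have c3 : ∀ f : m.D → ZMod 2, (∀ d, f (m.around d) = f d) →
      ∑ d, f d * (b d + b (m.opp d)) = 0 := by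
    intro f hf
    simp only [mul_add, Finset.sum_add_distrib]
    have h1 : ∑ d, f d * b (m.opp d) = ∑ d, f (m.face d) * b d := by
      rw [← Equiv.sum_comp m.opp]
      refine Finset.sum_congr rfl fun d _ => ?_
      rw [m.opp_opp, ← hf (m.opp d), around_apply, m.opp_opp]
    have : Fintype {d : p.D // p.Active d ∧ p.cycOf d = p.cycOf x₀} := Fintype.ofFinite _
    have h2 : ∀ F : m.D → ZMod 2, ∑ d, F d * b d =
        ∑ s : {d : p.D // p.Active d ∧ p.cycOf d = p.cycOf x₀}, F (e s.1) := by
      intro F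
      symm
      refine Fintype.sum_of_injective (fun s => e s.1)
        (fun s t h => Subtype.ext (e.inj h)) _ _ (fun d hd => ?_) (fun s => ?_)
      · have : b d = 0 := if_neg fun ⟨x, h, h', h''⟩ => hd ⟨⟨x, h, h'⟩, h''⟩
        rw [this, mul_zero]
      · rw [hb _ s.2.1, if_pos s.2.2, mul_one]
    -- The curve is closed: after a shift by `boundaryPerm`, the sum over the starts of its darts
    -- equals the sum over their ends.
    rw [h1, h2, h2, ← Equiv.sum_comp (p.boundaryPerm (p.cycOf x₀)) (fun s => f (e s.1))]
    have h3 : ∀ s : {d : p.D // p.Active d ∧ p.cycOf d = p.cycOf x₀},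
        f (e (p.boundaryPerm (p.cycOf x₀) s).1) = f (m.face (e s.1)) := fun s => by
      rw [boundaryPerm_coe, apply_emb_nextActive e hf s.2.1]
    rw [Finset.sum_congr rfl fun s _ => h3 s, zmod2_add_self]
  obtain ⟨g, hg, hgb⟩ := hm.exact_dual (fun d => b d + b (m.opp d)) c1 c2 c3
  have hgf : ∀ d, g (m.face d) = g d := fun d => by
    have := hg d
    rwa [around_apply, m.opp_opp] at this
  have hgo : ∀ d, b d + b (m.opp d) = g (m.opp d) + g d := fun d => by
    rw [hgb d, around_apply, hgf]
  -- The curve contains no glued edge of `p`, so the potential has a single value on `p`, which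
  -- serves as the reference `g₀`.
  have hconst : ∀ d, g (e d) = g m.root := apply_emb_eq_root e hp hgf fun d hd => by
    refine zmod2_eq_of_add ?_
    rw [← hgo, hb0 (e d) (fun x hx h => hd (by rw [← e.inj h]; exact hx)), ← e.map_opp d hd, hb0,
      add_zero]
    intro x hx h
    have := e.inj h
    subst this
    exact hd (p.active_opp.1 hx)
  refine ⟨g, g m.root, fun x₁ h₁ d h => ?_⟩
  induction h with
  | base => exact Or.inl ⟨x₁, h₁, Iff.rfl, rfl⟩
  | @next x hx _ ih =>
    left
    rcases ih with ⟨y, hy, hyc, hyx⟩ | ⟨h, -⟩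
    · have := e.inj hyx
      subst this
      exact ⟨_, hy.nextActive, by rw [cycOf_nextActive, hyc], rfl⟩
    · exact absurd ⟨x, rfl⟩ h
  | face hd _ ih =>
    right
    rcases ih with ⟨y, hy, hyc, rfl⟩ | ⟨h, h'⟩
    · exact absurd ⟨y, rfl⟩ hd
    · exact ⟨fun h => hd (e.face_mem_range.1 h), by rw [hgf, h']⟩
  -- Crossing an edge is the only step that could lead to another hole. According to whether each
  -- side lies in `p`, the jump of `g` is compared with `b d + b (opp d)`.
  | @opp d hd ih =>
    by_cases ho : m.opp d ∈ Set.range e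
    · obtain ⟨y, hy⟩ := ho
      left
      have hya : p.Active y := by
        rcases hd.active_or h₁ with ⟨x, hx, rfl⟩ | hd
        · exact e.opp_active hx hy.symm
        · exact e.opp_active_of_notMem hd hy.symm
      refine ⟨y, hya, ?_, hy⟩
      have h1 := hgo d
      rw [← hy, hb y hya, hconst] at h1
      have hite : (if p.cycOf y = p.cycOf x₀ then 1 else 0 : ZMod 2) =
          if p.cycOf x₁ = p.cycOf x₀ then 1 else 0 := by
        rcases ih with ⟨x, hx, hxc, rfl⟩ | ⟨h, h'⟩
        · rw [hb x hx, hconst, zmod2_add_self] at h1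
          rw [← zmod2_eq_of_add h1, if_congr hxc rfl rfl]
        · rw [hb0 d (fun x _ hx => h ⟨x, hx⟩), zero_add, h', ← add_assoc, zmod2_add_self,
            zero_add] at h1
          exact h1
      by_cases c1 : p.cycOf y = p.cycOf x₀ <;> by_cases c2 : p.cycOf x₁ = p.cycOf x₀ <;>
        simp_all
    · right
      refine ⟨ho, ?_⟩
      have h1 := hgo d
      rw [hb0 (m.opp d) (fun x _ h => ho ⟨x, h⟩), add_zero] at h1
      rcases ih with ⟨y, hy, hyc, rfl⟩ | ⟨h, h'⟩
      · rw [hb y hy, hconst, if_congr hyc rfl rfl] at h1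
        rw [h1]
        have : ∀ a b : ZMod 2, a = b + (a + b) := by decide
        exact this _ _
      · rw [hb0 d (fun x _ hx => h ⟨x, hx⟩)] at h1
        rw [← h', zmod2_eq_of_add h1.symm]

/-- This is where planarity enters: on a surface with a handle, the filling of one hole could reach
the boundary of another. -/
lemma Filling.cycOf_eq {e : Emb p m} (hp : p.IsQuad) (hm : m.IsQuad) {x₀ x : p.D}
    (h₀ : p.Active x₀) (h : Filling e x₀ (e x)) : p.cycOf x = p.cycOf x₀ := by
  obtain ⟨g, g₀, hg⟩ := exists_separation e hp hm (x₀ := x₀)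
  rcases hg x₀ h₀ _ h with ⟨y, -, hy, hyx⟩ | ⟨h', -⟩
  · rw [← e.inj hyx]
    exact hy.2 rfl
  · exact absurd ⟨x, rfl⟩ h'

lemma Filling.eq_of_notMem {e : Emb p m} (hp : p.IsQuad) (hm : m.IsQuad) {x₀ x₁ : p.D}
    (h₀ : p.Active x₀) (h₁ : p.Active x₁) {d : m.D} (hd : d ∉ Set.range e) (h : Filling e x₀ d)
    (h' : Filling e x₁ d) : p.cycOf x₁ = p.cycOf x₀ := by
  obtain ⟨g, g₀, hg⟩ := exists_separation e hp hm (x₀ := x₀)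
  rcases hg x₀ h₀ _ h with ⟨y, -, -, rfl⟩ | ⟨-, h2⟩
  · exact absurd ⟨y, rfl⟩ hd
  rcases hg x₁ h₁ _ h' with ⟨y, -, -, rfl⟩ | ⟨-, h3⟩
  · exact absurd ⟨y, rfl⟩ hd
  by_contra hne
  rw [h2, if_neg hne, if_pos rfl] at h3
  simp at h3

/-- By connectedness: a path from the root to a dart outside `p` has to leave `p` across an active
dart. -/
lemma exists_filling (e : Emb p m) (hm : m.IsQuad) {d : m.D} (hd : d ∉ Set.range e) :
    ∃ x, p.Active x ∧ Filling e x d := by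
  have key : ∀ d, d ∈ Set.range e ∨ ∃ x, p.Active x ∧ Filling e x d := by
    refine hm.induction (Or.inl ⟨_, e.map_root⟩) ?_ ?_
    · rintro d h
      by_cases hd : d ∈ Set.range e
      · exact Or.inl (e.face_mem_range.2 hd)
      · obtain ⟨x, hx, hxd⟩ := h.resolve_left hd
        exact Or.inr ⟨x, hx, hxd.face hd⟩
    · rintro d (⟨a, rfl⟩ | ⟨x, hx, hxd⟩)
      · by_cases ha : p.Active a
        · exact Or.inr ⟨a, ha, Filling.base.opp⟩
        · exact Or.inl ⟨_, e.map_opp a ha⟩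
      · exact Or.inr ⟨x, hx, hxd.opp⟩
  exact (key d).resolve_left hd

lemma Filling.of_cycOf_eq {e : Emb p m} {x₀ x₁ : p.D} (h₀ : p.Active x₀) (h₁ : p.Active x₁)
    (h : p.cycOf x₁ = p.cycOf x₀) {d : m.D} (hd : Filling e x₁ d) : Filling e x₀ d := by
  induction hd with
  | base => exact Filling.of_cycOf e h₀ h₁ h
  | next hx _ ih => exact Filling.next hx ih
  | face hd _ ih => exact Filling.face hd ih
  | opp _ ih => exact Filling.opp ih

end HoledMap

/-! ### The fillings of the holes are planar quadrangulations -/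

namespace HoledMap

variable {p m : HoledMap}

open Classical in
/-- The dart that follows `d` in the part of `m` outside `p`: on the boundary of a hole of `p`, it is
the next dart of this boundary. -/
noncomputable def Emb.outerFace (e : Emb p m) (d : m.D) : m.D :=
  if h : ∃ x, p.Active x ∧ e x = d then e (p.nextActive h.choose) else m.face d

lemma Emb.outerFace_active (e : Emb p m) {x : p.D} (hx : p.Active x) :
    e.outerFace (e x) = e (p.nextActive x) := by
  have h : ∃ y, p.Active y ∧ e y = e x := ⟨x, hx, rfl⟩
  rw [outerFace, dif_pos h, e.inj h.choose_spec.2]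

lemma Emb.outerFace_of_notMem (e : Emb p m) {d : m.D} (hd : d ∉ Set.range e) :
    e.outerFace d = m.face d :=
  dif_neg fun ⟨x, _, hx⟩ => hd ⟨x, hx⟩

lemma Filling.outerFace {e : Emb p m} {x₀ : p.D} (h₀ : p.Active x₀) {d : m.D}
    (h : Filling e x₀ d) : Filling e x₀ (e.outerFace d) := by
  rcases h.active_or h₀ with ⟨x, hx, rfl⟩ | hd
  · rw [e.outerFace_active hx]
    exact h.next hx
  · rw [e.outerFace_of_notMem hd]
    exact h.face hd

lemma Filling.outerFace_inj {e : Emb p m} {x₀ : p.D} (h₀ : p.Active x₀) {a b : m.D}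
    (ha : Filling e x₀ a) (hb : Filling e x₀ b) (h : e.outerFace a = e.outerFace b) : a = b := by
  rcases ha.active_or h₀ with ⟨x, hx, rfl⟩ | ha <;> rcases hb.active_or h₀ with ⟨y, hy, rfl⟩ | hb
  · rw [e.outerFace_active hx, e.outerFace_active hy] at h
    rw [nextActive_injOn hx hy (e.inj h)]
  · rw [e.outerFace_active hx, e.outerFace_of_notMem hb] at h
    exact absurd (e.face_mem_range.1 ⟨_, h⟩) hb
  · rw [e.outerFace_active hy, e.outerFace_of_notMem ha] at h
    exact absurd (e.face_mem_range.1 ⟨_, h.symm⟩) ha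
  · rw [e.outerFace_of_notMem ha, e.outerFace_of_notMem hb] at h
    exact m.face.injective h

/-- The map that fills the hole of `p` on the left of `x₀` in `m`. -/
noncomputable def fillMap (e : Emb p m) {x₀ : p.D} (h₀ : p.Active x₀) : HoledMap where
  D := {d : m.D // Filling e x₀ d}
  fin := inferInstance
  face := Equiv.ofBijective (fun d => ⟨e.outerFace d.1, d.2.outerFace h₀⟩)
    (Finite.injective_iff_bijective.1 fun a b h =>
      Subtype.ext (Filling.outerFace_inj h₀ a.2 b.2 (congrArg Subtype.val h)))
  opp := Function.Involutive.toPerm (fun d => ⟨m.opp d.1, d.2.opp⟩)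
    (fun d => Subtype.ext (m.opp_opp d.1))
  opp_opp := fun d => Subtype.ext (m.opp_opp d.1)
  root := ⟨e x₀, Filling.base⟩

section FillMap

variable (e : Emb p m) {x₀ : p.D} (h₀ : p.Active x₀)

/-- The darts of the map that fills a hole, as darts of `m`. -/
def fillVal (d : (fillMap e h₀).D) : m.D := d.1

lemma fillVal_injective : Function.Injective (fillVal e h₀) := Subtype.val_injective

lemma filling_fillVal (d : (fillMap e h₀).D) : Filling e x₀ (fillVal e h₀ d) := d.2

lemma exists_fillVal_eq {d : m.D} (h : Filling e x₀ d) : ∃ d', fillVal e h₀ d' = d := ⟨⟨d, h⟩, rfl⟩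

lemma fillVal_root : fillVal e h₀ (fillMap e h₀).root = e x₀ := rfl

lemma fillVal_face (d : (fillMap e h₀).D) :
    fillVal e h₀ ((fillMap e h₀).face d) = e.outerFace (fillVal e h₀ d) := rfl

lemma fillVal_opp (d : (fillMap e h₀).D) :
    fillVal e h₀ ((fillMap e h₀).opp d) = m.opp (fillVal e h₀ d) := rfl

lemma fillMap_active_iff (d : (fillMap e h₀).D) :
    (fillMap e h₀).Active d ↔ m.Active (fillVal e h₀ d) :=
  Subtype.ext_iff

lemma fillVal_iterate_root (k : ℕ) :
    fillVal e h₀ ((fillMap e h₀).face^[k] (fillMap e h₀).root) = e (p.nextActive^[k] x₀) := by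
  induction k with
  | zero => rfl
  | succ k ih =>
    rw [Function.iterate_succ_apply', Function.iterate_succ_apply', fillVal_face, ih,
      e.outerFace_active (h₀.nextActive_iterate k)]

/-- The root face of a filling is the boundary walk of its hole. The converse direction needs
planarity: a dart of `p` in the filling lies on this same hole. -/
lemma fillMap_onRootFace_iff (hp : p.IsQuad) (hm : m.IsQuad) {d : (fillMap e h₀).D} :
    (fillMap e h₀).OnRootFace d ↔ fillVal e h₀ d ∈ Set.range e := by
  rw [onRootFace_iff]
  constructor
  · rintro ⟨k, rfl⟩
    rw [fillVal_iterate_root]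
    exact ⟨_, rfl⟩
  · rintro ⟨x, hx⟩
    have hd : Filling e x₀ (e x) := hx ▸ filling_fillVal e h₀ d
    obtain ⟨k, hk⟩ := exists_nextActive_iterate h₀ (hd.active h₀) (hd.cycOf_eq hp hm h₀).symm
    exact ⟨k, fillVal_injective e h₀ (by rw [fillVal_iterate_root, hk, hx])⟩

lemma fillMap_perimeter {h : p.Hole} (hh : p.cycOf x₀ = h.1) :
    (fillMap e h₀).perimeter = p.holeDeg h := by
  rw [perimeter_eq, ← minimalPeriod_nextActive h₀ hh]
  refine Function.minimalPeriod_eq_minimalPeriod_iff.2 fun n => ?_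
  unfold Function.IsPeriodicPt Function.IsFixedPt
  rw [← (fillVal_injective e h₀).eq_iff, fillVal_iterate_root, fillVal_root, e.inj.eq_iff]

lemma fillMap_reach (d : (fillMap e h₀).D) :
    Reach (fillMap e h₀).face (fillMap e h₀).opp (fillMap e h₀).root d := by
  have key : ∀ d, Filling e x₀ d → ∀ d', fillVal e h₀ d' = d →
      Reach (fillMap e h₀).face (fillMap e h₀).opp (fillMap e h₀).root d' := by
    intro d hd
    induction hd with
    | base =>
      intro d' hd'
      rw [← fillVal_root e h₀] at hd'
      rw [fillVal_injective e h₀ hd']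
      exact Reach.base
    | @next x hx h ih =>
      intro d' hd'
      obtain ⟨a, ha⟩ := exists_fillVal_eq e h₀ h
      rw [← e.outerFace_active hx, ← ha, ← fillVal_face] at hd'
      rw [fillVal_injective e h₀ hd']
      exact (ih a ha).left
    | @face d hd h ih =>
      intro d' hd'
      obtain ⟨a, ha⟩ := exists_fillVal_eq e h₀ h
      rw [← e.outerFace_of_notMem hd, ← ha, ← fillVal_face] at hd'
      rw [fillVal_injective e h₀ hd']
      exact (ih a ha).left
    | @opp d h ih =>
      intro d' hd'
      obtain ⟨a, ha⟩ := exists_fillVal_eq e h₀ h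
      rw [← ha, ← fillVal_opp] at hd'
      rw [fillVal_injective e h₀ hd']
      exact (ih a ha).right
  exact key _ (filling_fillVal e h₀ d) d rfl

/-- Exactness is checked in the dual form. A cochain of the filling extends by zero to `m`; its
potential is constant on the faces of `m` and on all of `p`, hence also along the root face of the
filling, which is not a face of `m`. -/
lemma fillMap_isQuad (hp : p.IsQuad) (hm : m.IsQuad) : (fillMap e h₀).IsQuad := by
  refine isQuad_of_dual (fillMap_reach e h₀) ?_ ?_
  · intro c h1 h2 h3
    have hval := fillVal_injective e h₀
    have hext : ∀ d, Function.extend (fillVal e h₀) c 0 (fillVal e h₀ d) = c d := fun d =>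
      hval.extend_apply c 0 d
    have hext0 : ∀ d, ¬ Filling e x₀ d → Function.extend (fillVal e h₀) c 0 d = 0 := fun d hd =>
      Function.extend_apply' _ _ _ fun ⟨a, ha⟩ => hd (ha ▸ filling_fillVal e h₀ a)
    have c1 : ∀ d, Function.extend (fillVal e h₀) c 0 (m.opp d)
        = Function.extend (fillVal e h₀) c 0 d := by
      intro d
      by_cases hd : Filling e x₀ d
      · obtain ⟨a, rfl⟩ := exists_fillVal_eq e h₀ hd
        rw [← fillVal_opp, hext, hext, h1]
      · rw [hext0 d hd, hext0]
        intro h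
        have := h.opp
        rw [m.opp_opp] at this
        exact hd this
    have c2 : ∀ d, m.opp d = d → Function.extend (fillVal e h₀) c 0 d = 0 := by
      intro d hd
      by_cases hf : Filling e x₀ d
      · obtain ⟨a, rfl⟩ := exists_fillVal_eq e h₀ hf
        rw [hext]
        exact h2 _ (hval hd)
      · exact hext0 d hf
    have c3 : ∀ f : m.D → ZMod 2, (∀ d, f (m.around d) = f d) →
        ∑ d, f d * Function.extend (fillVal e h₀) c 0 d = 0 := by
      intro f hf
      -- Rotation in the filling skips the darts of `p` between two boundary edges, but it stays at
      -- the same vertex of `m`.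
      have hinv : ∀ d, f (fillVal e h₀ ((fillMap e h₀).around d)) = f (fillVal e h₀ d) := by
        intro d
        rw [around_apply, fillVal_face, fillVal_opp, ← hf (fillVal e h₀ d), around_apply]
        rcases (filling_fillVal e h₀ d).opp.active_or h₀ with ⟨x, hx, hxd⟩ | ho
        · rw [← hxd, e.outerFace_active hx, apply_emb_nextActive e hf hx]
        · rw [e.outerFace_of_notMem ho]
      rw [← h3 (fun d => f (fillVal e h₀ d)) hinv]
      symm
      refine Fintype.sum_of_injective (fillVal e h₀) hval _ _ (fun d hd => ?_) (fun d => ?_)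
      · rw [hext0 d fun h => hd (exists_fillVal_eq e h₀ h), mul_zero]
      · rw [hext]
    obtain ⟨g, hg, hgc⟩ := hm.exact_dual _ c1 c2 c3
    have hgf : ∀ d, g (m.face d) = g d := fun d => by
      have := hg d
      rwa [around_apply, m.opp_opp] at this
    have hgo : ∀ d, Function.extend (fillVal e h₀) c 0 d = g (m.opp d) + g d := fun d => by
      rw [hgc d, around_apply, hgf]
    have hconst : ∀ d, g (e d) = g m.root := apply_emb_eq_root e hp hgf fun d hd => by
      refine zmod2_eq_of_add ?_
      rw [← hgo, hext0]
      exact fun h => hd (h.active h₀)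
    have hout : ∀ d, Filling e x₀ d → g (e.outerFace d) = g d := by
      intro d hd
      rcases hd.active_or h₀ with ⟨x, hx, rfl⟩ | ho
      · rw [e.outerFace_active hx, hconst, hconst]
      · rw [e.outerFace_of_notMem ho, hgf]
    refine ⟨fun d => g (fillVal e h₀ d), fun d => ?_, fun d => ?_⟩
    · beta_reduce
      rw [around_apply, (fillMap e h₀).opp_opp, fillVal_face, hout _ (filling_fillVal e h₀ d)]
    · beta_reduce
      rw [← hext, hgo, around_apply, fillVal_face, hout _ (filling_fillVal e h₀ _), fillVal_opp]
  · intro d hd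
    rw [fillMap_onRootFace_iff e h₀ hp hm] at hd
    have hit : ∀ k, fillVal e h₀ ((fillMap e h₀).face^[k] d) = m.face^[k] (fillVal e h₀ d) ∧
        m.face^[k] (fillVal e h₀ d) ∉ Set.range e := by
      intro k
      induction k with
      | zero => exact ⟨rfl, hd⟩
      | succ k ih =>
        rw [Function.iterate_succ_apply', Function.iterate_succ_apply', fillVal_face, ih.1,
          e.outerFace_of_notMem ih.2]
        exact ⟨rfl, fun h => ih.2 (e.face_mem_range.1 h)⟩
    rw [minimalPeriod_eq_of_semiconj (fillVal_injective e h₀) fun k => (hit k).1]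
    exact hm.minimalPeriod fun h => hd (e.mem_range_of_onRootFace h)

end FillMap

/-- A map in which `p` is embedded is obtained from `p` by gluing maps into the holes. -/
lemma Emb.exists_gluing (e : Emb p m) (hp : p.IsQuad) (hm : m.IsQuad) {mark : p.Hole → p.D}
    (hmark : p.IsMarking mark) :
    ∃ u : p.Hole → HoledMap, (∀ h, (u h).IsQuad) ∧ (m.IsClosed → ∀ h, (u h).IsClosed) ∧
      Nonempty (Gluing p mark u m) := by
  refine ⟨fun h => fillMap e (hmark h).1, fun h => fillMap_isQuad e (hmark h).1 hp hm,
    fun hc h d hd => hc _ ((fillMap_active_iff e (hmark h).1 d).1 hd), ⟨?_⟩⟩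
  refine
    { per := fun h => fillMap_perimeter e (hmark h).1 (hmark h).2
      i := e
      j := fun h d => fillVal e (hmark h).1 d
      bij := ⟨?_, ?_⟩
      i_root := e.map_root
      i_face := e.map_face
      i_opp := e.map_opp
      j_root := fun h k => fillVal_iterate_root e (hmark h).1 k
      j_face := fun h d hd => ?_
      j_opp := fun h d => rfl }
  · rintro (a | ⟨h, d, hd⟩) (b | ⟨h', d', hd'⟩) hab
    · exact congrArg Sum.inl (e.inj hab)
    · rw [fillMap_onRootFace_iff e _ hp hm] at hd'
      exact absurd ⟨a, hab⟩ hd'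
    · rw [fillMap_onRootFace_iff e _ hp hm] at hd
      exact absurd ⟨b, hab.symm⟩ hd
    · simp only [Sum.elim_inr] at hab
      have hd1 := hd
      rw [fillMap_onRootFace_iff e _ hp hm] at hd1
      have hh : h = h' := by
        apply Subtype.ext
        rw [← (hmark h).2, ← (hmark h').2]
        exact Filling.eq_of_notMem hp hm (hmark h').1 (hmark h).1 hd1
          (hab ▸ filling_fillVal e (hmark h').1 d') (filling_fillVal e (hmark h).1 d)
      subst hh
      have : d = d' := fillVal_injective e _ hab
      subst this
      rfl
  · intro d
    by_cases hd : d ∈ Set.range e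
    · obtain ⟨a, rfl⟩ := hd
      exact ⟨Sum.inl a, rfl⟩
    · obtain ⟨x, hx, hxd⟩ := exists_filling e hm hd
      let h := holeOf hx
      have hf : Filling e (mark h) d := hxd.of_cycOf_eq (hmark h).1 hx (hmark h).2.symm
      obtain ⟨a, ha⟩ := exists_fillVal_eq e (hmark h).1 hf
      refine ⟨Sum.inr ⟨h, ⟨a, ?_⟩⟩, ha⟩
      rwa [fillMap_onRootFace_iff e _ hp hm, ha]
  · rw [fillMap_onRootFace_iff e _ hp hm] at hd
    rw [fillVal_face, e.outerFace_of_notMem hd]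

end HoledMap

/-! ### Gluing planar quadrangulations -/

lemma iterate_eq_iterate_iff_mod {D : Type*} {f : D → D} {a : D}
    (h : 0 < Function.minimalPeriod f a) (k l : ℕ) :
    f^[k] a = f^[l] a ↔ k % Function.minimalPeriod f a = l % Function.minimalPeriod f a := by
  rw [← Function.iterate_mod_minimalPeriod_eq (n := k), ← Function.iterate_mod_minimalPeriod_eq (n := l),
    Function.iterate_eq_iterate_iff_of_lt_minimalPeriod (Nat.mod_lt _ h) (Nat.mod_lt _ h)]

namespace HoledMap

variable {p m m' : HoledMap} {mark : p.Hole → p.D} {u u' : p.Hole → HoledMap}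

/-- The boundary of the hole and the root face of a map that fits into it are traversed in the same
way. -/
lemma IsMarking.iterate_eq_iff (hmark : p.IsMarking mark) {h : p.Hole}
    {w : HoledMap} (hw : w.perimeter = p.holeDeg h) (k l : ℕ) :
    p.nextActive^[k] (mark h) = p.nextActive^[l] (mark h) ↔
      w.face^[k] w.root = w.face^[l] w.root := by
  have h1 := minimalPeriod_nextActive (hmark h).1 (hmark h).2
  have h2 : 0 < Function.minimalPeriod w.face w.root := minimalPeriod_perm_pos _ _
  rw [perimeter_eq, ← h1] at hw
  rw [iterate_eq_iterate_iff_mod h2, iterate_eq_iterate_iff_mod (hw ▸ h2), hw]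

namespace Gluing

variable (G : Gluing p mark u m)

lemma eq_of_elim_eq (a b : p.D ⊕ (Σ h, {d : (u h).D // ¬ (u h).OnRootFace d}))
    (h : Sum.elim G.i (fun x : Σ h, {d : (u h).D // ¬ (u h).OnRootFace d} => G.j x.1 x.2.1) a
      = Sum.elim G.i (fun x : Σ h, {d : (u h).D // ¬ (u h).OnRootFace d} => G.j x.1 x.2.1) b) :
    a = b := G.bij.1 h

lemma i_injective : Function.Injective G.i := fun _ _ h => by
  simpa using G.eq_of_elim_eq (Sum.inl _) (Sum.inl _) h

def emb : Emb p m := ⟨G.i, G.i_injective, G.i_root, G.i_face, G.i_opp⟩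

lemma j_ne_i {h : p.Hole} {d : (u h).D} (hd : ¬ (u h).OnRootFace d) (a : p.D) : G.j h d ≠ G.i a :=
  fun hda => by simpa using G.eq_of_elim_eq (Sum.inr ⟨h, d, hd⟩) (Sum.inl a) hda

lemma exists_i_or_j (d : m.D) :
    (∃ a, G.i a = d) ∨ ∃ (h : p.Hole) (a : (u h).D), ¬ (u h).OnRootFace a ∧ G.j h a = d := by
  obtain ⟨a | ⟨h, a, ha⟩, rfl⟩ := G.bij.2 d
  · exact Or.inl ⟨a, rfl⟩
  · exact Or.inr ⟨h, a, ha, rfl⟩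

lemma j_hole_eq {h h' : p.Hole} {d : (u h).D} {d' : (u h').D} (hd : ¬ (u h).OnRootFace d)
    (hd' : ¬ (u h').OnRootFace d') (hdd : G.j h d = G.j h' d') : h = h' := by
  have := G.eq_of_elim_eq (Sum.inr ⟨h, d, hd⟩) (Sum.inr ⟨h', d', hd'⟩) hdd
  simp only [Sum.inr.injEq, Sigma.mk.injEq] at this
  exact this.1

lemma exists_iterate {h : p.Hole} {d : (u h).D} (hd : (u h).OnRootFace d) :
    ∃ k, (u h).face^[k] (u h).root = d ∧ G.j h d = G.i (p.nextActive^[k] (mark h)) := by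
  obtain ⟨k, rfl⟩ := (onRootFace_iff _).1 hd
  exact ⟨k, rfl, G.j_root h k⟩

lemma j_face_of_onRootFace {h : p.Hole} {d : (u h).D} (hd : (u h).OnRootFace d) {x : p.D}
    (hx : G.j h d = G.i x) : G.j h ((u h).face d) = G.i (p.nextActive x) := by
  obtain ⟨k, rfl, hk⟩ := G.exists_iterate hd
  have h1 := G.j_root h (k + 1)
  rw [Function.iterate_succ_apply', Function.iterate_succ_apply'] at h1
  rw [h1, G.i_injective (hx.symm.trans hk)]

lemma exists_active (hmark : p.IsMarking mark) {h : p.Hole} {d : (u h).D}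
    (hd : (u h).OnRootFace d) : ∃ x, p.Active x ∧ p.cycOf x = h.1 ∧ G.j h d = G.i x := by
  obtain ⟨k, rfl, hk⟩ := G.exists_iterate hd
  exact ⟨_, (hmark h).1.nextActive_iterate k, by rw [cycOf_nextActive_iterate, (hmark h).2], hk⟩

lemma exists_onRootFace (hmark : p.IsMarking mark) {h : p.Hole} {x : p.D} (hx : p.Active x)
    (hxh : p.cycOf x = h.1) : ∃ d, (u h).OnRootFace d ∧ G.j h d = G.i x := by
  obtain ⟨k, rfl⟩ := exists_nextActive_iterate (hmark h).1 hx ((hmark h).2.trans hxh.symm)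
  exact ⟨_, (onRootFace_iff _).2 ⟨k, rfl⟩, G.j_root h k⟩

lemma j_mem_range_i {h : p.Hole} {d : (u h).D} (hd : (u h).OnRootFace d) :
    G.j h d ∈ Set.range G.i := by
  obtain ⟨k, -, hk⟩ := G.exists_iterate hd
  exact ⟨_, hk.symm⟩

lemma onRootFace_iff_mem_range {h : p.Hole} {d : (u h).D} :
    (u h).OnRootFace d ↔ G.j h d ∈ Set.range G.i :=
  ⟨G.j_mem_range_i, fun ⟨a, ha⟩ => by_contra fun hd => G.j_ne_i hd a ha.symm⟩

lemma j_injective (hmark : p.IsMarking mark) (h : p.Hole) : Function.Injective (G.j h) := by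
  intro a b hab
  by_cases ha : (u h).OnRootFace a
  · have hb : (u h).OnRootFace b := by
      rw [G.onRootFace_iff_mem_range, ← hab]
      exact G.j_mem_range_i ha
    obtain ⟨k, rfl, hk⟩ := G.exists_iterate ha
    obtain ⟨l, rfl, hl⟩ := G.exists_iterate hb
    rw [hk, hl] at hab
    exact (hmark.iterate_eq_iff (G.per h) k l).1 (G.i_injective hab)
  · have hb : ¬ (u h).OnRootFace b := by
      rw [G.onRootFace_iff_mem_range, ← hab, ← G.onRootFace_iff_mem_range]
      exact ha
    have := G.eq_of_elim_eq (Sum.inr ⟨h, a, ha⟩) (Sum.inr ⟨h, b, hb⟩) hab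
    simpa using this

/-- Every dart is a dart of `p` that is not active or a dart of a map that is glued. -/
lemma exists_not_active_or_j (hmark : p.IsMarking mark) (d : m.D) :
    (∃ a, ¬ p.Active a ∧ G.i a = d) ∨ ∃ (h : p.Hole) (a : (u h).D), G.j h a = d := by
  rcases G.exists_i_or_j d with ⟨a, rfl⟩ | ⟨h, a, -, rfl⟩
  · by_cases ha : p.Active a
    · obtain ⟨b, -, hb⟩ := G.exists_onRootFace hmark ha (h := holeOf ha) rfl
      exact Or.inr ⟨_, b, hb⟩
    · exact Or.inl ⟨a, ha, rfl⟩
  · exact Or.inr ⟨h, a, rfl⟩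

lemma isClosed (G : Gluing p mark u m) (hmark : p.IsMarking mark) (hu : ∀ h, (u h).IsClosed) : m.IsClosed := by
  intro d hd
  rcases G.exists_not_active_or_j hmark d with ⟨a, ha, rfl⟩ | ⟨h, a, rfl⟩
  · exact G.emb.not_active ha hd
  · refine hu h a (G.j_injective hmark h ?_)
    rw [G.j_opp]
    exact hd

/-- Functions on `p` and on the maps that are glued can be put together. -/
lemma exists_extend {E : Type*} (W : p.D → E) (w : ∀ h, (u h).D → E)
    (hw : ∀ h d x, (u h).OnRootFace d → G.j h d = G.i x → w h d = W x) :
    ∃ f : m.D → E, (∀ a, f (G.i a) = W a) ∧ ∀ h d, f (G.j h d) = w h d := by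
  let e := Equiv.ofBijective _ G.bij
  have h1 : ∀ a, e.symm (G.i a) = Sum.inl a := fun a => (Equiv.symm_apply_eq _).2 rfl
  have h2 : ∀ h d hd, e.symm (G.j h d) = Sum.inr ⟨h, d, hd⟩ := fun h d hd =>
    (Equiv.symm_apply_eq _).2 rfl
  refine ⟨fun d => Sum.elim W (fun x => w x.1 x.2.1) (e.symm d), fun a => by simp [h1],
    fun h d => ?_⟩
  beta_reduce
  by_cases hd : (u h).OnRootFace d
  · obtain ⟨k, -, hk⟩ := G.exists_iterate hd
    rw [hw h d _ hd hk, hk, h1]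
    rfl
  · rw [h2 h d hd]
    rfl

lemma reach (G : Gluing p mark u m) (hp : p.IsQuad) (hu : ∀ h, (u h).IsQuad) (d : m.D) :
    Reach m.face m.opp m.root d := by
  have h1 : ∀ a, Reach m.face m.opp m.root (G.i a) := by
    refine hp.induction (by rw [G.i_root]; exact Reach.base)
      (fun d h => by rw [G.i_face]; exact h.left) (fun d h => ?_)
    by_cases hd : p.Active d
    · rwa [hd]
    · rw [G.i_opp d hd]
      exact h.right
  have h2 : ∀ h a, Reach m.face m.opp m.root (G.j h a) := by
    intro h
    refine (hu h).induction ?_ ?_ ?_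
    · rw [show G.j h (u h).root = _ from G.j_root h 0]
      exact h1 _
    · intro d hd
      by_cases hr : (u h).OnRootFace d
      · obtain ⟨x, hx⟩ := G.j_mem_range_i ((onRootFace_face _).2 hr)
        rw [← hx]
        exact h1 _
      · rw [G.j_face h d hr]
        exact hd.left
    · intro d hd
      rw [G.j_opp]
      exact hd.right
  rcases G.exists_i_or_j d with ⟨a, rfl⟩ | ⟨h, a, -, rfl⟩
  · exact h1 a
  · exact h2 h a

end Gluing

/-- A function on the active darts can be extended to a function that is constant on the darts that
start at a given vertex. -/
lemma exists_vertex_extension {E : Type*} [Zero E] (b : p.D → E) :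
    ∃ B : p.D → E, (∀ x, p.Active x → B x = b x) ∧ ∀ d, ¬ p.Active d → B (p.around d) = B d := by
  classical
  refine ⟨fun d => if p.Active d then b d else if p.AroundHole d then b (p.nextActive d) else 0,
    fun x hx => if_pos hx, fun d hd => ?_⟩
  beta_reduce
  rw [if_neg hd, aroundHole_around]
  by_cases h : p.Active (p.around d)
  · rw [if_pos h, if_pos (aroundHole_around.1 h.aroundHole), nextActive_of_active h]
  · rw [if_neg h]
    by_cases h' : p.AroundHole d
    · rw [if_pos h', if_pos h', nextActive_of_not_active h' h]
    · rw [if_neg h', if_neg h']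

namespace Gluing

variable (G : Gluing p mark u m)

/-- To be extended by zero to the faces of `m`, a function on the faces of `u h` must vanish on the
root face, which disappears. Its value there can be subtracted, because the values of `φ` over the
darts of `u h` cancel in pairs under `opp`. -/
lemma exact_part (hmark : p.IsMarking mark) (h : p.Hole) (hu : (u h).IsQuad) {φ : m.D → ZMod 2}
    (h1 : ∀ d, φ (m.opp d) = φ d) (h2 : ∀ d, m.opp d = d → φ d = 0)
    (h3 : ∀ f : m.D → ZMod 2, (∀ d, f (m.face d) = f d) → ∑ d, f d * φ d = 0) :
    ∃ g : (u h).D → ZMod 2, (∀ d, g ((u h).face ((u h).opp d)) = g d) ∧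
      ∀ d, φ (G.j h d) = g ((u h).face d) + g d := by
  have c1 : ∀ d, φ (G.j h ((u h).opp d)) = φ (G.j h d) := fun d => by rw [G.j_opp, h1]
  have c2 : ∀ d, (u h).opp d = d → φ (G.j h d) = 0 := fun d hd => by
    refine h2 _ ?_
    rw [← G.j_opp, hd]
  have hinj := G.j_injective hmark h
  refine hu.exact (fun d => φ (G.j h d)) c1 c2 fun f hf => ?_
  have hroot : ∀ d, (u h).OnRootFace d → f d = f (u h).root := by
    intro d hd
    obtain ⟨k, rfl⟩ := (onRootFace_iff _).1 hd
    clear hd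
    induction k with
    | zero => rfl
    | succ k ih => rw [Function.iterate_succ_apply', hf, ih]
  let F : m.D → ZMod 2 := Function.extend (G.j h) (fun a => f a + f (u h).root) 0
  have hFj : ∀ a, F (G.j h a) = f a + f (u h).root := fun a => hinj.extend_apply _ _ _
  have hFi : ∀ a, F (G.i a) = 0 := by
    intro a
    by_cases ha : ∃ b, G.j h b = G.i a
    · obtain ⟨b, hb⟩ := ha
      rw [← hb, hFj, hroot b (G.onRootFace_iff_mem_range.2 ⟨a, hb.symm⟩), zmod2_add_self]
    · exact Function.extend_apply' _ _ _ ha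
  have hFj' : ∀ h' a, h' ≠ h → ¬ (u h').OnRootFace a → F (G.j h' a) = 0 := by
    intro h' a hne ha
    refine Function.extend_apply' _ _ _ ?_
    rintro ⟨b, hb⟩
    refine hne (G.j_hole_eq ha (fun hr => ?_) hb.symm)
    obtain ⟨x, hx⟩ := G.j_mem_range_i hr
    exact G.j_ne_i ha x (by rw [← hb, hx])
  have hF : ∀ d, F (m.face d) = F d := by
    intro d
    rcases G.exists_i_or_j d with ⟨a, rfl⟩ | ⟨h', a, ha, rfl⟩
    · rw [← G.i_face, hFi, hFi]
    · rw [← G.j_face h' a ha]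
      by_cases hh : h' = h
      · subst hh
        rw [hFj, hFj, hf]
      · rw [hFj' h' a hh ha, hFj' h' _ hh (by rwa [onRootFace_face])]
  have hsum : ∑ d, F d * φ d = ∑ d, (f d + f (u h).root) * φ (G.j h d) := by
    symm
    refine Fintype.sum_of_injective (G.j h) hinj _ _ (fun d hd => ?_) (fun d => by rw [hFj])
    rw [show F d = 0 from Function.extend_apply' _ _ _ hd, zero_mul]
  have hzero : ∑ d, φ (G.j h d) = 0 := by
    refine Finset.sum_involution (fun d _ => (u h).opp d) (fun d _ => ?_) (fun d _ hne hd => ?_)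
      (fun _ _ => Finset.mem_univ _) (fun d _ => (u h).opp_opp d)
    · rw [c1, zmod2_add_self]
    · exact hne (c2 d hd)
  rw [h3 F hF] at hsum
  simp only [add_mul, Finset.sum_add_distrib] at hsum
  rw [← Finset.mul_sum, hzero, mul_zero, add_zero] at hsum
  exact hsum.symm

/-- Gluing planar quadrangulations into the holes of a planar quadrangulation yields a planar
quadrangulation. -/
lemma isQuad (G : Gluing p mark u m) (hmark : p.IsMarking mark) (hp : p.IsQuad) (hu : ∀ h, (u h).IsQuad) : m.IsQuad := by
  refine isQuad_iff.2 ⟨G.reach hp hu, ?_, fun d hd => ?_⟩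
  · intro φ h1 h2 h3
    -- Each part has its own potential `f h`. Read on the boundaries of the holes and extended to
    -- the vertices of `p` as `B`, these potentials correct `φ` to a cochain of `p` that vanishes at
    -- the active darts. A potential `g` of the corrected cochain then fixes the additive constant
    -- of each part.
    choose f hf hfφ using fun h => G.exact_part hmark h (hu h) h1 h2 h3
    choose r hr hrx using fun (x : p.D) (hx : p.Active x) =>
      G.exists_onRootFace hmark hx (h := holeOf hx) rfl
    classical
    obtain ⟨B, hBb, hB⟩ := exists_vertex_extension (p := p) (fun x =>
      if hx : p.Active x then f (holeOf hx) (r x hx) else (0 : ZMod 2))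
    have hBf : ∀ h d x, (u h).OnRootFace d → G.j h d = G.i x → p.Active x ∧ B x = f h d := by
      intro h d x hd hdx
      obtain ⟨y, hy, hyh, hdy⟩ := G.exists_active hmark hd
      obtain rfl := G.i_injective (hdx.symm.trans hdy)
      obtain rfl : h = holeOf hy := Subtype.ext hyh.symm
      refine ⟨hy, ?_⟩
      rw [hBb x hy, dif_pos hy]
      congr 1
      exact G.j_injective hmark _ ((hrx x hy).trans hdx.symm)
    have hBface : ∀ h d x, (u h).OnRootFace d → G.j h d = G.i x →
        B (p.face x) = f h ((u h).face d) := by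
      intro h d x hd hdx
      rw [← apply_nextActive_of_active hB (hBf h d x hd hdx).1]
      exact (hBf h _ _ ((onRootFace_face _).2 hd) (G.j_face_of_onRootFace hd hdx)).2
    have c1 : ∀ d, φ (G.i (p.opp d)) + B (p.face (p.opp d)) + B (p.opp d)
        = φ (G.i d) + B (p.face d) + B d := by
      intro d
      by_cases hd : p.Active d
      · rw [hd]
      · have e1 := hB d hd
        have e2 := hB (p.opp d) (fun h => hd (p.active_opp.1 h))
        rw [around_apply] at e1
        rw [around_apply, p.opp_opp] at e2
        rw [G.i_opp d hd, h1, e1, e2]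
        ring
    have c2 : ∀ d, p.opp d = d → φ (G.i d) + B (p.face d) + B d = 0 := by
      intro d hd
      obtain ⟨a, ha, had⟩ := G.exists_onRootFace hmark (x := d) hd (h := holeOf hd) rfl
      rw [hBface _ a d ha had, (hBf _ a d ha had).2, ← had, hfφ]
      have : ∀ a b : ZMod 2, a + b + a + b = 0 := by decide
      exact this _ _
    have c3 : ∀ F : p.D → ZMod 2, (∀ d, F (p.face d) = F d) →
        ∑ d, F d * (φ (G.i d) + B (p.face d) + B d) = 0 := by
      intro F hF
      obtain ⟨F', hF'i, hF'j⟩ := G.exists_extend (fun d => (F d : ZMod 2))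
        (fun h d => if hd : ∃ x, G.i x = G.j h d then F hd.choose else 0) (by
          intro h d x _ hdx
          have hd : ∃ x, G.i x = G.j h d := ⟨x, hdx.symm⟩
          rw [dif_pos hd, G.i_injective (hd.choose_spec.trans hdx)])
      have hF'0 : ∀ d, d ∉ Set.range G.i → F' d = 0 := by
        intro d hd
        rcases G.exists_i_or_j d with ⟨a, rfl⟩ | ⟨h, a, ha, rfl⟩
        · exact absurd ⟨a, rfl⟩ hd
        · rw [hF'j, dif_neg fun ⟨x, hx⟩ => hd ⟨x, hx⟩]
      have hinv : ∀ d, F' (m.face d) = F' d := by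
        intro d
        by_cases hd : d ∈ Set.range G.i
        · obtain ⟨a, rfl⟩ := hd
          rw [← G.i_face, hF'i, hF'i, hF]
        · rw [hF'0 d hd, hF'0 _ fun h => hd (G.emb.face_mem_range.1 h)]
      have e1 : ∑ d, F d * φ (G.i d) = 0 := by
        rw [← h3 F' hinv]
        refine Fintype.sum_of_injective G.i G.i_injective _ _ (fun d hd => ?_) (fun d => by rw [hF'i])
        rw [hF'0 d hd, zero_mul]
      have e2 : ∑ d, F d * B (p.face d) = ∑ d, F d * B d := by
        rw [← Equiv.sum_comp p.face (fun d => F d * B d)]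
        exact Finset.sum_congr rfl fun d _ => by rw [hF]
      simp only [mul_add, Finset.sum_add_distrib]
      rw [e1, e2, zero_add, zmod2_add_self]
    obtain ⟨g, hg, hgφ⟩ := hp.exact _ c1 c2 c3
    have hgc : ∀ {a b}, p.cycOf a = p.cycOf b → g a = g b := fun hab =>
      SameCycle.apply_eq (σ := p.around) hg ((p.cycOf_eq_iff).1 hab)
    -- All active darts of a hole lie on one cycle of `around`, so `g` takes there the single value
    -- `g (mark h)`; with this shift the potentials agree along the boundary.
    obtain ⟨W, hWi, hWj⟩ := G.exists_extend (fun d => g d + B d) (fun h d => g (mark h) + f h d) (by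
      intro h d x hd hdx
      obtain ⟨y, hy, hyh, hdy⟩ := G.exists_active hmark hd
      obtain rfl := G.i_injective (hdx.symm.trans hdy)
      rw [(hBf h d x hd hdx).2, hgc (hyh.trans (hmark h).2.symm)])
    have hδ : ∀ d, φ d = W (m.face d) + W d := by
      intro d
      rcases G.exists_i_or_j d with ⟨a, rfl⟩ | ⟨h, a, ha, rfl⟩
      · rw [← G.i_face, hWi, hWi]
        have := hgφ a
        have key : ∀ a b c d e : ZMod 2, a + b + c = d + e → a = d + b + (e + c) := by decide
        exact key _ _ _ _ _ this
      · rw [← G.j_face h a ha, hWj, hWj, hfφ]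
        have key : ∀ a b c : ZMod 2, a + b = c + a + (c + b) := by decide
        exact key _ _ _
    refine ⟨W, fun d => ?_, hδ⟩
    rcases G.exists_not_active_or_j hmark d with ⟨a, ha, rfl⟩ | ⟨h, a, rfl⟩
    · rw [← G.i_opp a ha, ← G.i_face, hWi, hWi, hg]
      congr 1
      exact hB a ha
    · have e1 := hδ (m.opp (G.j h a))
      rw [← G.j_opp, hWj, hfφ, hf] at e1
      rw [← G.j_opp, hWj]
      have key : ∀ a b c d : ZMod 2, a + b = c + (d + b) → c = d + a := by decide
      exact key _ _ _ _ e1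
  · rcases G.exists_i_or_j d with ⟨a, rfl⟩ | ⟨h, a, ha, rfl⟩
    · have h1 := G.emb.minimalPeriod a
      have h2 := hp.minimalPeriod (d := a) (by rwa [← G.emb.onRootFace_iff])
      exact h1.symm.trans h2
    · rw [← (hu h).minimalPeriod ha]
      have hit : ∀ k, G.j h ((u h).face^[k] a) = m.face^[k] (G.j h a) ∧
          ¬ (u h).OnRootFace ((u h).face^[k] a) := by
        intro k
        induction k with
        | zero => exact ⟨rfl, ha⟩
        | succ k ih =>
          rw [Function.iterate_succ_apply', Function.iterate_succ_apply', G.j_face h _ ih.2, ih.1,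
            onRootFace_face]
          exact ⟨rfl, ih.2⟩
      exact (minimalPeriod_eq_of_semiconj (G.j_injective hmark h) fun k => (hit k).1).symm

end Gluing

end HoledMap

namespace HoledMap

variable {p m m' : HoledMap} {mark : p.Hole → p.D} {u u' : p.Hole → HoledMap}

namespace Gluing

/-! ## Counting faces -/

lemma j_iterate (G : Gluing p mark u m) {h : p.Hole} {d : (u h).D} (hd : ¬ (u h).OnRootFace d)
    (k : ℕ) : G.j h ((u h).face^[k] d) = m.face^[k] (G.j h d) := by
  induction k with
  | zero => rfl
  | succ k ih =>
    rw [Function.iterate_succ_apply', Function.iterate_succ_apply', ← ih, G.j_face]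
    unfold OnRootFace
    rwa [faceOf_iterate]

lemma exists_faceOf_eq (G : Gluing p mark u m) {h : p.Hole} {d : (u h).D}
    (hd : ¬ (u h).OnRootFace d) {x : m.D} (hx : m.faceOf (G.j h d) = m.faceOf x) :
    ∃ d', ¬ (u h).OnRootFace d' ∧ (u h).faceOf d' = (u h).faceOf d ∧ G.j h d' = x := by
  obtain ⟨k, hk⟩ := (m.faceOf_eq_iff_iterate).1 hx
  refine ⟨(u h).face^[k] d, ?_, faceOf_iterate _ _ _, by rw [G.j_iterate hd, hk]⟩
  unfold OnRootFace
  rwa [faceOf_iterate]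

/-- Faces of `m` are those of `p` and those of the parts other than their root faces. One root face
is lost per hole; the holes are counted on the left to avoid subtraction. -/
lemma numFaces_add (G : Gluing p mark u m) :
    m.numFaces + Nat.card p.Hole = p.numFaces + ∑ᶠ h, (u h).numFaces := by
  classical
  have : Fintype p.Hole := Fintype.ofFinite _
  let V : p.Hole → Type := fun h => {c : (u h).Face // c ≠ (u h).faceOf (u h).root}
  have hV : ∀ h, Nat.card (V h) + 1 = (u h).numFaces := by
    intro h
    have : Fintype (u h).Face := Fintype.ofFinite _
    rw [numFaces, Nat.card_eq_fintype_card, Nat.card_eq_fintype_card, Fintype.card_subtype_compl,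
      Fintype.card_subtype_eq]
    have : 0 < Fintype.card (u h).Face := Fintype.card_pos_iff.2 ⟨(u h).faceOf (u h).root⟩
    omega
  let F : p.Face ⊕ (Σ h, V h) → m.Face :=
    Sum.elim (fun c => m.faceOf (G.i (Quotient.out c)))
      (fun x => m.faceOf (G.j x.1 (Quotient.out x.2.1)))
  have hout : ∀ (w : HoledMap) (c : w.Face), w.faceOf (Quotient.out c) = c := fun w c =>
    Quotient.out_eq c
  have hnr : ∀ h (c : V h), ¬ (u h).OnRootFace (Quotient.out c.1) := by
    intro h c hc
    unfold OnRootFace at hc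
    rw [hout] at hc
    exact c.2 hc
  have hF : Function.Bijective F := by
    constructor
    · rintro (c | ⟨h, c⟩) (c' | ⟨h', c'⟩) hcc
      · have := G.emb.faceOf_eq_iff.1 hcc
        rw [hout, hout] at this
        rw [this]
      · obtain ⟨d, hd, -, hd'⟩ := G.exists_faceOf_eq (hnr h' c') hcc.symm
        exact absurd hd' (G.j_ne_i hd _)
      · obtain ⟨d, hd, -, hd'⟩ := G.exists_faceOf_eq (hnr h c) hcc
        exact absurd hd' (G.j_ne_i hd _)
      · obtain ⟨d, hd, hdf, hd'⟩ := G.exists_faceOf_eq (hnr h c) hcc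
        obtain rfl := G.j_hole_eq hd (hnr h' c') hd'
        have h1 := G.eq_of_elim_eq (Sum.inr ⟨h, d, hd⟩) (Sum.inr ⟨h, _, hnr h c'⟩) hd'
        simp only [Sum.inr.injEq, Sigma.mk.injEq, true_and, heq_eq_eq, Subtype.mk.injEq] at h1
        rw [h1, hout, hout] at hdf
        rw [Subtype.ext hdf]
    · intro c
      obtain ⟨d, rfl⟩ := m.faceOf_surjective c
      rcases G.exists_i_or_j d with ⟨a, rfl⟩ | ⟨h, a, ha, rfl⟩
      · exact ⟨Sum.inl (p.faceOf a), G.emb.faceOf_eq_iff.2 (hout _ _)⟩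
      · refine ⟨Sum.inr ⟨h, (u h).faceOf a, ha⟩, ?_⟩
        have h1 := hnr h ⟨(u h).faceOf a, ha⟩
        obtain ⟨k, hk⟩ := ((u h).faceOf_eq_iff_iterate).1 (hout _ ((u h).faceOf a))
        change m.faceOf (G.j h (Quotient.out ((u h).faceOf a))) = _
        conv_rhs => rw [← hk]
        rw [G.j_iterate h1, faceOf_iterate]
  rw [numFaces, ← Nat.card_congr (Equiv.ofBijective F hF), Nat.card_sum, Nat.card_sigma,
    finsum_eq_sum_of_fintype, add_assoc, Nat.card_eq_fintype_card (α := p.Hole)]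
  simp only [← hV]
  rw [Finset.sum_add_distrib]
  simp [numFaces]

/-! ## Existence and uniqueness of gluings -/

/-- The result of a gluing, transported along an isomorphism. -/
def mapIso (G : Gluing p mark u m) (f : Iso m m') : Gluing p mark u m' where
  per := G.per
  i d := f.toEquiv (G.i d)
  j h d := f.toEquiv (G.j h d)
  bij := by
    convert f.toEquiv.bijective.comp G.bij
    ext (a | a) <;> rfl
  i_root := by rw [G.i_root, f.map_root]
  i_face d := by rw [G.i_face, f.map_face]
  i_opp d hd := by rw [G.i_opp d hd, f.map_opp]
  j_root h k := by rw [G.j_root]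
  j_face h d hd := by rw [G.j_face h d hd, f.map_face]
  j_opp h d := by rw [G.j_opp, f.map_opp]

end Gluing

lemma Iso.map_iterate (f : Iso p m) (k : ℕ) (d : p.D) :
    f.toEquiv (p.face^[k] d) = m.face^[k] (f.toEquiv d) := f.toEmb.map_iterate k d

lemma Iso.onRootFace_iff (f : Iso p m) {d : p.D} :
    m.OnRootFace (f.toEquiv d) ↔ p.OnRootFace d := f.toEmb.onRootFace_iff

namespace Gluing

/-- The maps that are glued can be replaced by isomorphic maps. -/
def congrParts (G : Gluing p mark u m) (f : ∀ h, Iso (u' h) (u h)) : Gluing p mark u' m where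
  per h := by rw [(f h).perimeter, G.per]
  i := G.i
  j h d := G.j h ((f h).toEquiv d)
  bij := by
    have e : (Σ h, {d : (u' h).D // ¬ (u' h).OnRootFace d}) ≃
        (Σ h, {d : (u h).D // ¬ (u h).OnRootFace d}) :=
      Equiv.sigmaCongrRight fun h => (f h).toEquiv.subtypeEquiv fun d => by rw [(f h).onRootFace_iff]
    have := G.bij.comp (Equiv.sumCongr (Equiv.refl p.D) (Equiv.sigmaCongrRight fun h =>
      (f h).toEquiv.subtypeEquiv (p := fun d => ¬ (u' h).OnRootFace d)
        (q := fun d => ¬ (u h).OnRootFace d) fun d => by rw [(f h).onRootFace_iff])).bijective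
    convert this
    ext (a | a) <;> rfl
  i_root := G.i_root
  i_face := G.i_face
  i_opp := G.i_opp
  j_root h k := by rw [(f h).map_iterate, (f h).map_root, G.j_root]
  j_face h d hd := by rw [(f h).map_face, G.j_face _ _ (by rwa [(f h).onRootFace_iff])]
  j_opp h d := by rw [(f h).map_opp, G.j_opp]

/-- The result of a gluing is unique. -/
lemma nonempty_iso (G : Gluing p mark u m) (G' : Gluing p mark u m') (hmark : p.IsMarking mark) :
    Nonempty (Iso m m') := by
  let T : m.D ≃ m'.D := (Equiv.ofBijective _ G.bij).symm.trans (Equiv.ofBijective _ G'.bij)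
  have hi : ∀ a, T (G.i a) = G'.i a := by
    intro a
    have : (Equiv.ofBijective _ G.bij).symm (G.i a) = Sum.inl a := (Equiv.symm_apply_eq _).2 rfl
    simp only [T, Equiv.trans_apply, this]
    rfl
  have hj : ∀ h a, T (G.j h a) = G'.j h a := by
    intro h a
    by_cases ha : (u h).OnRootFace a
    · obtain ⟨k, rfl⟩ := (onRootFace_iff _).1 ha
      rw [G.j_root, hi, G'.j_root]
    · have : (Equiv.ofBijective _ G.bij).symm (G.j h a) = Sum.inr ⟨h, a, ha⟩ :=
        (Equiv.symm_apply_eq _).2 rfl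
      simp only [T, Equiv.trans_apply, this]
      rfl
  refine ⟨⟨T, fun d => ?_, fun d => ?_, by rw [← G.i_root, hi, G'.i_root]⟩⟩
  · rcases G.exists_i_or_j d with ⟨a, rfl⟩ | ⟨h, a, ha, rfl⟩
    · rw [← G.i_face, hi, hi, G'.i_face]
    · rw [← G.j_face h a ha, hj, hj, G'.j_face h a ha]
  · rcases G.exists_not_active_or_j hmark d with ⟨a, ha, rfl⟩ | ⟨h, a, rfl⟩
    · rw [← G.i_opp a ha, hi, hi, G'.i_opp a ha]
    · rw [← G.j_opp, hj, hj, G'.j_opp]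

/-- The embedding of `p` is forced by connectedness, so the two gluings agree on the boundary of the
hole. From there the image of one part is traced step by step inside the image of the other. -/
lemma exists_j_eq (G : Gluing p mark u m) (G' : Gluing p mark u' m) (hp : p.IsQuad) (h : p.Hole)
    (hu : (u h).IsQuad) (d : (u h).D) : ∃ d', G'.j h d' = G.j h d := by
  have hi : ∀ a, G.i a = G'.i a := G.emb.ext_of_reach G'.emb hp.reach
  refine hu.induction (P := fun d => ∃ d', G'.j h d' = G.j h d) ⟨(u' h).root, ?_⟩ ?_ ?_ d
  · exact (G'.j_root h 0).trans ((hi _).symm.trans (G.j_root h 0).symm)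
  · rintro d ⟨d', hd'⟩
    by_cases hd : (u h).OnRootFace d
    · obtain ⟨k, -, hk⟩ := G.exists_iterate hd
      have h1 : (u' h).OnRootFace d' := by
        rw [G'.onRootFace_iff_mem_range, hd', hk, hi]
        exact ⟨_, rfl⟩
      refine ⟨(u' h).face d', ?_⟩
      rw [G.j_face_of_onRootFace hd hk, G'.j_face_of_onRootFace h1 (hd'.trans (hk.trans (hi _))), hi]
    · refine ⟨(u' h).face d', ?_⟩
      rw [G.j_face h d hd, ← hd', G'.j_face]
      intro h1
      obtain ⟨x, hx⟩ := G'.j_mem_range_i h1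
      rw [hd', ← hi] at hx
      exact G.j_ne_i hd x hx.symm
  · rintro d ⟨d', hd'⟩
    exact ⟨(u' h).opp d', by rw [G'.j_opp, hd', G.j_opp]⟩

/-- The maps that are glued are determined by the result. -/
lemma nonempty_iso_part (G : Gluing p mark u m) (G' : Gluing p mark u' m) (hmark : p.IsMarking mark)
    (hp : p.IsQuad) (h : p.Hole) (hu : (u h).IsQuad) (hu' : (u' h).IsQuad) :
    Nonempty (Iso (u h) (u' h)) := by
  have hi : ∀ a, G.i a = G'.i a := G.emb.ext_of_reach G'.emb hp.reach
  choose t ht using G.exists_j_eq G' hp h hu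
  have hinj := G.j_injective hmark h
  have hinj' := G'.j_injective hmark h
  have htb : Function.Bijective t := by
    constructor
    · intro a b hab
      exact hinj (by rw [← ht, hab, ht])
    · intro d
      obtain ⟨d', hd'⟩ := G'.exists_j_eq G hp h hu' d
      exact ⟨d', hinj' (by rw [ht, hd'])⟩
  refine ⟨⟨Equiv.ofBijective t htb, fun d => hinj' ?_, fun d => hinj' ?_, hinj' ?_⟩⟩
  · change G'.j h (t _) = G'.j h ((u' h).face (t d))
    rw [ht]
    by_cases hd : (u h).OnRootFace d
    · obtain ⟨k, -, hk⟩ := G.exists_iterate hd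
      have h1 : (u' h).OnRootFace (t d) := by
        rw [G'.onRootFace_iff_mem_range, ht, hk, hi]
        exact ⟨_, rfl⟩
      rw [G.j_face_of_onRootFace hd hk,
        G'.j_face_of_onRootFace h1 ((ht d).trans (hk.trans (hi _))), hi]
    · rw [G.j_face h d hd, ← ht d, G'.j_face]
      intro h1
      obtain ⟨x, hx⟩ := G'.j_mem_range_i h1
      rw [ht, ← hi] at hx
      exact G.j_ne_i hd x hx.symm
  · change G'.j h (t _) = G'.j h ((u' h).opp (t d))
    rw [ht, G'.j_opp, ht, G.j_opp]
  · change G'.j h (t _) = _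
    rw [ht]
    exact (G.j_root h 0).trans ((hi _).trans (G'.j_root h 0).symm)

end Gluing

/-! ### Construction of a gluing -/

section Construct

variable (p mark u)

/-- The darts of the result of a gluing. -/
abbrev GlueDart : Type := p.D ⊕ (Σ h, {d : (u h).D // ¬ (u h).OnRootFace d})

open Classical in
/-- The dart of the result of a gluing that comes from a dart of one of the maps that are glued. -/
noncomputable def glueJ (h : p.Hole) (d : (u h).D) : GlueDart p u :=
  if hd : (u h).OnRootFace d then
    Sum.inl (p.nextActive^[((onRootFace_iff _).1 hd).choose] (mark h))
  else Sum.inr ⟨h, d, hd⟩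

variable {p mark u}

lemma glueJ_root (hmark : p.IsMarking mark) (hu : ∀ h, (u h).perimeter = p.holeDeg h) (h : p.Hole)
    (k : ℕ) : glueJ p mark u h ((u h).face^[k] (u h).root)
      = Sum.inl (p.nextActive^[k] (mark h)) := by
  have hd : (u h).OnRootFace ((u h).face^[k] (u h).root) := (onRootFace_iff _).2 ⟨k, rfl⟩
  rw [glueJ, dif_pos hd]
  congr 1
  exact (hmark.iterate_eq_iff (hu h) _ _).2 ((onRootFace_iff _).1 hd).choose_spec

lemma glueJ_of_not {h : p.Hole} {d : (u h).D} (hd : ¬ (u h).OnRootFace d) :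
    glueJ p mark u h d = Sum.inr ⟨h, d, hd⟩ := dif_neg hd

lemma glueJ_injective (hmark : p.IsMarking mark) (hu : ∀ h, (u h).perimeter = p.holeDeg h)
    (h : p.Hole) : Function.Injective (glueJ p mark u h) := by
  intro a b hab
  by_cases ha : (u h).OnRootFace a
  · obtain ⟨k, rfl⟩ := (onRootFace_iff _).1 ha
    rw [glueJ_root hmark hu] at hab
    by_cases hb : (u h).OnRootFace b
    · obtain ⟨l, rfl⟩ := (onRootFace_iff _).1 hb
      rw [glueJ_root hmark hu] at hab
      exact (hmark.iterate_eq_iff (hu h) k l).1 (Sum.inl_injective hab)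
    · rw [glueJ_of_not hb] at hab
      exact absurd hab Sum.inl_ne_inr
  · rw [glueJ_of_not ha] at hab
    by_cases hb : (u h).OnRootFace b
    · obtain ⟨l, rfl⟩ := (onRootFace_iff _).1 hb
      rw [glueJ_root hmark hu] at hab
      exact absurd hab Sum.inr_ne_inl
    · rw [glueJ_of_not hb] at hab
      simpa using hab

lemma exists_glueJ_eq (hmark : p.IsMarking mark) (hu : ∀ h, (u h).perimeter = p.holeDeg h) {x : p.D}
    (hx : p.Active x) : ∃ d, glueJ p mark u (holeOf hx) d = Sum.inl x := by
  obtain ⟨k, hk⟩ := exists_nextActive_iterate (hmark (holeOf hx)).1 hx (hmark (holeOf hx)).2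
  exact ⟨(u (holeOf hx)).face^[k] (u (holeOf hx)).root, by rw [glueJ_root hmark hu, hk]⟩

lemma exists_active_of_glueJ (hmark : p.IsMarking mark) (hu : ∀ h, (u h).perimeter = p.holeDeg h)
    {h : p.Hole} {d : (u h).D} (hd : (u h).OnRootFace d) :
    ∃ (x : p.D) (hx : p.Active x), h = holeOf hx ∧ glueJ p mark u h d = Sum.inl x := by
  obtain ⟨k, rfl⟩ := (onRootFace_iff _).1 hd
  exact ⟨_, (hmark h).1.nextActive_iterate k,
    Subtype.ext (by change _ = p.cycOf _; rw [cycOf_nextActive_iterate, (hmark h).2]),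
    glueJ_root hmark hu h k⟩

/-- Maps that fit into the holes can be glued into them. -/
lemma exists_gluing (hmark : p.IsMarking mark) (hu : ∀ h, (u h).perimeter = p.holeDeg h) :
    ∃ m, Nonempty (Gluing p mark u m) := by
  classical
  choose r hr using fun (x : p.D) (hx : p.Active x) => exists_glueJ_eq hmark hu hx
  let J := glueJ p mark u
  -- An active dart of `p` is identified with a dart of the root face of a part, and its opposite is
  -- taken there.
  let o : GlueDart p u → GlueDart p u := Sum.elim
    (fun x => if hx : p.Active x then J _ ((u _).opp (r x hx)) else Sum.inl (p.opp x))
    (fun y => J y.1 ((u y.1).opp y.2.1))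
  have ho1 : ∀ x, ¬ p.Active x → o (Sum.inl x) = Sum.inl (p.opp x) := fun x hx => dif_neg hx
  have ho2 : ∀ h d, o (J h d) = J h ((u h).opp d) := by
    intro h d
    by_cases hd : (u h).OnRootFace d
    · obtain ⟨x, hx, rfl, hxd⟩ := exists_active_of_glueJ hmark hu hd
      have h1 : r x hx = d := glueJ_injective hmark hu _ ((hr x hx).trans hxd.symm)
      have h2 : o (Sum.inl x) = J _ ((u _).opp (r x hx)) := dif_pos hx
      rw [show J (holeOf hx) d = Sum.inl x from hxd, h2, h1]
    · rw [show J h d = _ from glueJ_of_not hd]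
      rfl
  have hcases : ∀ y : GlueDart p u, (∃ x, ¬ p.Active x ∧ y = Sum.inl x) ∨ ∃ h d, y = J h d := by
    rintro (x | ⟨h, d, hd⟩)
    · by_cases hx : p.Active x
      · exact Or.inr ⟨_, _, (hr x hx).symm⟩
      · exact Or.inl ⟨x, hx, rfl⟩
    · exact Or.inr ⟨h, d, (glueJ_of_not hd).symm⟩
  have hinv : Function.Involutive o := by
    intro y
    rcases hcases y with ⟨x, hx, rfl⟩ | ⟨h, d, rfl⟩
    · rw [ho1 x hx, ho1 _ (fun h => hx (p.active_opp.1 h)), p.opp_opp]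
    · rw [ho2, ho2, (u h).opp_opp]
  let m : HoledMap :=
    { D := GlueDart p u
      fin := inferInstance
      face := Equiv.sumCongr p.face (Equiv.sigmaCongrRight fun h =>
        (u h).face.subtypePerm fun d => not_congr (u h).onRootFace_face)
      opp := hinv.toPerm
      opp_opp := hinv
      root := Sum.inl p.root }
  refine ⟨m, ⟨?_⟩⟩
  exact
    { per := hu
      i := Sum.inl
      j := J
      bij := by
        convert Function.bijective_id (α := GlueDart p u)
        ext (x | ⟨h, d, hd⟩)
        · rfl
        · exact glueJ_of_not hd
      i_root := rfl
      i_face := fun d => rfl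
      i_opp := fun d hd => (ho1 d hd).symm
      j_root := glueJ_root hmark hu
      j_face := fun h d hd => by
        have h1 : J h d = _ := glueJ_of_not hd
        have h2 : J h ((u h).face d) = _ := glueJ_of_not (mt (u h).onRootFace_face.1 hd)
        rw [h1, h2]
        rfl
      j_opp := fun h d => (ho2 h d).symm }

end Construct

end HoledMap

open HoledMap

namespace HoledMap

variable {p q m : HoledMap}

/-! ## Submaps -/

lemma exists_isMarking (p : HoledMap) : ∃ mark : p.Hole → p.D, p.IsMarking mark := by
  choose mark hmark using fun h : p.Hole => h.2
  exact ⟨mark, hmark⟩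

lemma Submap.isQuad_left (h : p.Submap m) : p.IsQuad := h.1

lemma Submap.nonempty_emb (h : p.Submap m) : Nonempty (Emb p m) := by
  obtain ⟨-, mark, u, -, -, ⟨G⟩⟩ := h
  exact ⟨G.emb⟩

lemma Submap.isQuad_right (h : p.Submap m) : m.IsQuad := by
  obtain ⟨hp, mark, u, hmark, hu, ⟨G⟩⟩ := h
  exact G.isQuad hmark hp hu

lemma Emb.submap (e : Emb p m) (hp : p.IsQuad) (hm : m.IsQuad) : p.Submap m := by
  obtain ⟨mark, hmark⟩ := p.exists_isMarking
  obtain ⟨u, hu, -, G⟩ := e.exists_gluing hp hm hmark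
  exact ⟨hp, mark, u, hmark, hu, G⟩

end HoledMap

namespace MapClass

variable {p q m : HoledMap}

lemma of_eq_iff : of p = of m ↔ Nonempty (Iso p m) := Quotient.eq

lemma exists_of (x : MapClass) : ∃ m, of m = x := ⟨Quotient.out x, Quotient.out_eq x⟩

lemma of_out (x : MapClass) : of (Quotient.out x) = x := Quotient.out_eq x

/-- An embedding can be cut open and glued back, so the fillings may be forgotten. Transitivity of
`⊂`, and with it the monotonicity of the filtration, becomes composition of embeddings. -/
lemma sub_of_iff : Sub (of p) (of m) ↔ p.IsQuad ∧ m.IsQuad ∧ Nonempty (Emb p m) := by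
  constructor
  · rintro ⟨p', m', hp, hm, h⟩
    obtain ⟨f⟩ := of_eq_iff.1 hp
    obtain ⟨g⟩ := of_eq_iff.1 hm
    obtain ⟨e⟩ := h.nonempty_emb
    exact ⟨f.symm.isQuad h.isQuad_left, g.symm.isQuad h.isQuad_right,
      ⟨(f.symm.toEmb.trans e).trans g.toEmb⟩⟩
  · rintro ⟨hp, hm, ⟨e⟩⟩
    exact ⟨p, m, rfl, rfl, e.submap hp hm⟩

lemma Sub.trans {x y z : MapClass} (h : Sub x y) (h' : Sub y z) : Sub x z := by
  obtain ⟨p, rfl⟩ := x.exists_of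
  obtain ⟨q, rfl⟩ := y.exists_of
  obtain ⟨m, rfl⟩ := z.exists_of
  obtain ⟨hp, -, ⟨e⟩⟩ := sub_of_iff.1 h
  obtain ⟨-, hm, ⟨e'⟩⟩ := sub_of_iff.1 h'
  exact sub_of_iff.2 ⟨hp, hm, ⟨e.trans e'⟩⟩

lemma sub_refl_of (hp : p.IsQuad) : Sub (of p) (of p) :=
  sub_of_iff.2 ⟨hp, hp, ⟨(Iso.refl p).toEmb⟩⟩

lemma numFaces_of (m : HoledMap) : (of m).numFaces = m.numFaces := by
  obtain ⟨f⟩ := of_eq_iff.1 (of_out (of m))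
  exact f.numFaces

lemma isGluing_of_iff {mark : p.Hole → p.D} {u : p.Hole → HoledMap} :
    IsGluing p mark u (of m) ↔ Nonempty (Gluing p mark u m) := by
  constructor
  · rintro ⟨m', hm, ⟨G⟩⟩
    obtain ⟨f⟩ := of_eq_iff.1 hm
    exact ⟨G.mapIso f⟩
  · rintro h
    exact ⟨m, rfl, h⟩

/-- Every map has a copy with darts `Fin n`. Countability is what makes unions and sums over
isomorphism classes harmless, although the classes live in a higher universe. -/
instance : Countable MapClass := by
  let T := Σ n : ℕ, {x : Equiv.Perm (Fin n) × Equiv.Perm (Fin n) × Fin n //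
    ∀ d, x.2.1 (x.2.1 d) = d}
  let F : T → MapClass := fun t => of
    { D := Fin t.1
      fin := inferInstance
      face := t.2.1.1
      opp := t.2.1.2.1
      opp_opp := t.2.2
      root := t.2.1.2.2 }
  have hF : Function.Surjective F := by
    intro x
    obtain ⟨m, rfl⟩ := x.exists_of
    obtain ⟨n, ⟨e⟩⟩ := Finite.exists_equiv_fin m.D
    refine ⟨⟨n, ⟨(e.permCongr m.face, e.permCongr m.opp, e m.root), fun d => ?_⟩⟩, ?_⟩
    · simp [Equiv.permCongr_apply, m.opp_opp]
    · exact of_eq_iff.2 ⟨⟨e.symm, fun d => by simp, fun d => by simp, by simp⟩⟩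
  exact hF.countable

lemma mem_quads_of_iff {n : ℕ} : of m ∈ Quads n ↔ m.IsQuad ∧ m.IsClosed ∧ m.perimeter = n := by
  constructor
  · rintro ⟨m', hm, h1, h2, h3⟩
    obtain ⟨f⟩ := of_eq_iff.1 hm
    exact ⟨f.symm.isQuad h1, f.symm.isClosed h2, f.symm.perimeter.trans h3⟩
  · rintro ⟨h1, h2, h3⟩
    exact ⟨m, rfl, h1, h2, h3⟩

lemma IsGluing.sub {mark : p.Hole → p.D} {u : p.Hole → HoledMap} {x : MapClass}
    (hx : IsGluing p mark u x) (hmark : p.IsMarking mark) (hp : p.IsQuad)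
    (hu : ∀ h, (u h).IsQuad) : Sub (of p) x := by
  obtain ⟨m, rfl⟩ := x.exists_of
  obtain ⟨G⟩ := isGluing_of_iff.1 hx
  exact sub_of_iff.2 ⟨hp, G.isQuad hmark hp hu, ⟨G.emb⟩⟩

end MapClass

lemma QuadHoles.isQuad {p : HoledMap} (x : QuadHoles) (h : x.1 = MapClass.of p) : p.IsQuad := by
  obtain ⟨m, hm, hq⟩ := x.2
  obtain ⟨f⟩ := MapClass.of_eq_iff.1 (hm.trans h)
  exact f.symm.isQuad hq

lemma QuadHoles.sub_refl (x : QuadHoles) : MapClass.Sub x.1 x.1 := by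
  obtain ⟨p, hp⟩ := x.1.exists_of
  rw [← hp]
  exact MapClass.sub_refl_of (x.isQuad hp.symm)

/-! ## The natural filtration -/

universe v in
/-- The sum of a product over a product space is the product of the sums. -/
lemma ENNReal.tsum_pi_prod {ι : Type} [Fintype ι] {X : ι → Type v} (a : ∀ i, X i → ℝ≥0∞) :
    ∑' x : ∀ i, X i, ∏ i, a i (x i) = ∏ i, ∑' x, a i x := by
  classical
  refine Fintype.induction_empty_option (P := fun ι _ => ∀ (X : ι → Type v) (a : ∀ i, X i → ℝ≥0∞),
    ∑' x : ∀ i, X i, ∏ i, a i (x i) = ∏ i, ∑' x, a i x) ?_ ?_ ?_ ι X a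
  · intro α β _ e ih X a
    have h1 := ih (fun i => X (e i)) (fun i => a (e i))
    let : Fintype α := Fintype.ofEquiv β e.symm
    rw [← Fintype.prod_equiv e (fun i => ∑' x, a (e i) x) _ (fun i => rfl), ← h1,
      ← (Equiv.piCongrLeft X e).tsum_eq]
    refine tsum_congr fun x => ?_
    rw [← Fintype.prod_equiv e (fun i => a (e i) (x i)) _ (fun i => by simp)]
  · intro X a
    simp
  · intro α _ ih X a
    rw [Fintype.prod_option, ← ih _ (fun i => a (some i)), ← (Equiv.piOptionEquivProd).symm.tsum_eq]
    simp only [Fintype.prod_option]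
    rw [← ENNReal.tsum_mul_right, ENNReal.tsum_prod']
    simp only [← ENNReal.tsum_mul_left]
    rfl

section Filtration

variable {Ω : Type*} [MeasurableSpace Ω] {μ : Measure Ω} {q : ℝ≥0} {Q : Ω → MapClass}

lemma measurableSet_naturalFiltration_sub {p r : QuadHoles} (h : MapClass.Sub p.1 r.1) :
    MeasurableSet[naturalFiltration μ Q r] {ω | MapClass.Sub p.1 (Q ω)} :=
  MeasurableSpace.measurableSet_generateFrom (Or.inl ⟨p, h, rfl⟩)

lemma measurableSet_naturalFiltration_null (r : QuadHoles) {N : Set Ω} (h : μ N = 0) :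
    MeasurableSet[naturalFiltration μ Q r] N :=
  MeasurableSpace.measurableSet_generateFrom (Or.inr h)

/-- Measurability only depends on a set up to negligible sets. -/
lemma measurableSet_naturalFiltration_congr (r : QuadHoles) {A B : Set Ω}
    (hA : MeasurableSet[naturalFiltration μ Q r] A) (h : A =ᵐ[μ] B) :
    MeasurableSet[naturalFiltration μ Q r] B := by
  have h1 : μ (A \ B) = 0 := (ae_le_set.1 h.le)
  have h2 : μ (B \ A) = 0 := (ae_le_set.1 h.symm.le)
  have : B = (A \ (A \ B)) ∪ (B \ A) := by
    ext x
    simp only [Set.mem_union, Set.mem_sdiff]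
    tauto
  rw [this]
  exact (hA.diff (measurableSet_naturalFiltration_null r h1)).union
    (measurableSet_naturalFiltration_null r h2)

lemma isQuadFiltration_naturalFiltration : IsQuadFiltration μ (naturalFiltration μ Q) where
  mono p r h := by
    refine MeasurableSpace.generateFrom_mono (Set.union_subset_union_left _ ?_)
    rintro A ⟨x, hx, rfl⟩
    exact ⟨x, hx.trans h, rfl⟩
  complete r N hN := measurableSet_naturalFiltration_null r hN

/-- The events of the natural filtration at `p` are trivial on the event `{p ⊂ Q}`. -/
lemma naturalFiltration_trivial {p : QuadHoles} {A : Set Ω}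
    (hA : MeasurableSet[naturalFiltration μ Q p] A) :
    μ (A ∩ {ω | MapClass.Sub p.1 (Q ω)}) = 0 ∨ μ ({ω | MapClass.Sub p.1 (Q ω)} \ A) = 0 := by
  induction A, hA using MeasurableSpace.generateFrom_induction with
  | hC t ht _ =>
    rcases ht with ⟨x, hx, rfl⟩ | hN
    · right
      convert measure_empty (μ := μ)
      rw [Set.sdiff_eq_empty]
      exact fun ω hω => hx.trans hω
    · exact Or.inl (measure_mono_null Set.inter_subset_left hN)
  | empty => simp
  | compl t _ ih =>
    rcases ih with h | h
    · right
      rwa [Set.sdiff_compl, Set.inter_comm]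
    · left
      rwa [Set.inter_comm, ← Set.sdiff_eq]
  | iUnion s _ ih =>
    by_cases h : ∃ n, μ ({ω | MapClass.Sub p.1 (Q ω)} \ s n) = 0
    · obtain ⟨n, hn⟩ := h
      right
      exact measure_mono_null (Set.sdiff_subset_sdiff_right (Set.subset_iUnion s n)) hn
    · left
      push Not at h
      rw [Set.iUnion_inter]
      exact measure_iUnion_null fun n => (ih n).resolve_right (h n)

variable [IsProbabilityMeasure μ]

/-- The law of the maps that fill the holes of `p`. -/
lemma measure_isGluing (hq : 0 < q) (hQ : IsBoltzmann μ q 1 Q) {p : HoledMap} (hp : p.IsQuad)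
    {mark : p.Hole → p.D} {u : p.Hole → HoledMap} (hmark : p.IsMarking mark) (hu : IsFilling p u) :
    μ {ω | MapClass.IsGluing p mark u (Q ω)} =
      μ {ω | MapClass.Sub (MapClass.of p) (Q ω)} * ∏ᶠ h, boltzmannProb q (u h) := by
  classical
  have : Fintype p.Hole := Fintype.ofFinite _
  have hmeas : ∀ s : Set MapClass, MeasurableSet (Q ⁻¹' s) := fun s => hQ.measurable trivial
  by_cases hper : p.perimeter = 2
  swap
  -- Embeddings preserve the perimeter, so a `p` of another perimeter is almost surely not contained
  -- in `Q` and both sides vanish.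
  · have h0 : μ {ω | MapClass.Sub (MapClass.of p) (Q ω)} = 0 := by
      refine measure_mono_null (t := {ω | ¬ Q ω ∈ Quads (2 * 1)}) (fun ω hω hω' => ?_)
        (ae_iff.1 hQ.support)
      obtain ⟨m, hm⟩ := (Q ω).exists_of
      rw [Set.mem_ofPred_eq, ← hm] at hω
      rw [← hm] at hω'
      obtain ⟨-, -, ⟨e⟩⟩ := MapClass.sub_of_iff.1 hω
      exact hper (e.perimeter.trans (MapClass.mem_quads_of_iff.1 hω').2.2)
    rw [h0, zero_mul]
    exact measure_mono_null (fun ω hω => hω.sub hmark hp fun h => (hu h).1) h0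
  let X : p.Hole → Type 1 := fun h => Quads (p.holeDeg h)
  let w : (∀ h, X h) → p.Hole → HoledMap := fun x h => Quotient.out (x h).1
  have hw : ∀ x h, (w x h).IsQuad ∧ (w x h).IsClosed ∧ (w x h).perimeter = p.holeDeg h := by
    intro x h
    rw [← MapClass.mem_quads_of_iff, MapClass.of_out]
    exact (x h).2
  choose M hM using fun x => exists_gluing hmark fun h => (hw x h).2.2
  have hMq : ∀ x, MapClass.of (M x) ∈ Quads (2 * 1) := by
    intro x
    obtain ⟨G⟩ := hM x
    exact MapClass.mem_quads_of_iff.2 ⟨G.isQuad hmark hp fun h => (hw x h).1,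
      G.isClosed hmark fun h => (hw x h).2.1, by rw [← G.emb.perimeter, hper]⟩
  let s : Set MapClass := {y | y ∈ Quads (2 * 1) ∧ MapClass.Sub (MapClass.of p) y}
  have hMs : ∀ x, MapClass.of (M x) ∈ s := fun x => ⟨hMq x, by
    obtain ⟨G⟩ := hM x
    exact MapClass.sub_of_iff.2 ⟨hp, G.isQuad hmark hp fun h => (hw x h).1, ⟨G.emb⟩⟩⟩
  -- Families of fillings correspond to the maps that contain `p`: the parts are determined by the
  -- result, and every such map can be cut along its embedding of `p`.
  have hbij : Function.Bijective (fun x => (⟨MapClass.of (M x), hMs x⟩ : s)) := by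
    constructor
    · intro x y hxy
      obtain ⟨f⟩ := MapClass.of_eq_iff.1 (congrArg Subtype.val hxy)
      obtain ⟨G⟩ := hM x
      obtain ⟨G'⟩ := hM y
      funext h
      obtain ⟨g⟩ := (G.mapIso f).nonempty_iso_part G' hmark hp h (hw x h).1 (hw y h).1
      apply Subtype.ext
      rw [← MapClass.of_out (x h).1, ← MapClass.of_out (y h).1]
      exact MapClass.of_eq_iff.2 ⟨g⟩
    · rintro ⟨y, hy, hpy⟩
      obtain ⟨m, rfl⟩ := y.exists_of
      obtain ⟨-, hm, ⟨e⟩⟩ := MapClass.sub_of_iff.1 hpy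
      obtain ⟨v, hv, hvc, ⟨G⟩⟩ := e.exists_gluing hp hm hmark
      have hc := hvc (MapClass.mem_quads_of_iff.1 hy).2.1
      let x : ∀ h, X h := fun h =>
        ⟨MapClass.of (v h), MapClass.mem_quads_of_iff.2 ⟨hv h, hc h, G.per h⟩⟩
      have f : ∀ h, Nonempty (Iso (w x h) (v h)) := fun h =>
        MapClass.of_eq_iff.1 (MapClass.of_out _)
      obtain ⟨G'⟩ := hM x
      obtain ⟨g⟩ := G'.nonempty_iso (G.congrParts fun h => (f h).some) hmark
      exact ⟨x, Subtype.ext (MapClass.of_eq_iff.2 ⟨g⟩)⟩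
  -- the event that is a gluing
  let xu : ∀ h, X h := fun h => ⟨MapClass.of (u h), MapClass.mem_quads_of_iff.2 (hu h)⟩
  have hgl : {ω | MapClass.IsGluing p mark u (Q ω)} = {ω | Q ω = MapClass.of (M xu)} := by
    have f : ∀ h, Nonempty (Iso (u h) (w xu h)) := fun h =>
      MapClass.of_eq_iff.1 (MapClass.of_out _).symm
    obtain ⟨G⟩ := hM xu
    have G' := G.congrParts fun h => (f h).some
    ext ω
    obtain ⟨m, hm⟩ := (Q ω).exists_of
    rw [Set.mem_ofPred_eq, Set.mem_ofPred_eq, ← hm, MapClass.isGluing_of_iff, MapClass.of_eq_iff]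
    exact ⟨fun ⟨G''⟩ => G''.nonempty_iso G' hmark, fun ⟨g⟩ => ⟨G'.mapIso g.symm⟩⟩
  have hsub : μ {ω | MapClass.Sub (MapClass.of p) (Q ω)} = μ (Q ⁻¹' s) := by
    refine measure_congr ?_
    filter_upwards [hQ.support] with ω hω
    exact propext ⟨fun h => ⟨hω, h⟩, fun h => h.2⟩
  have hsum : μ (Q ⁻¹' s) = ∑' x, μ {ω | Q ω = MapClass.of (M x)} := by
    rw [← tsum_measure_preimage_singleton (Set.to_countable s) fun y _ => hmeas _,
      ← (Equiv.ofBijective _ hbij).tsum_eq]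
    rfl
  -- the weights
  have hq0 : (q : ℝ≥0∞) ≠ 0 := by simpa using hq.ne'
  have hqt : (q : ℝ≥0∞) ≠ ⊤ := ENNReal.coe_ne_top
  let H := Nat.card p.Hole
  -- The root face of each part disappears in the gluing, hence the division by `q ^ H`.
  let c : ℝ≥0∞ := (q : ℝ≥0∞) ^ p.numFaces / (q : ℝ≥0∞) ^ H / partitionFunction q (2 * 1)
  have hlaw : ∀ x, μ {ω | Q ω = MapClass.of (M x)} =
      c * ∏ h, (q : ℝ≥0∞) ^ (x h).1.numFaces := by
    intro x
    rw [hQ.law _ (hMq x), MapClass.numFaces_of]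
    obtain ⟨G⟩ := hM x
    have h1 := G.numFaces_add
    rw [finsum_eq_sum_of_fintype] at h1
    have h2 : (q : ℝ≥0∞) ^ (M x).numFaces * (q : ℝ≥0∞) ^ H =
        (q : ℝ≥0∞) ^ p.numFaces * ∏ h, (q : ℝ≥0∞) ^ (x h).1.numFaces := by
      rw [← pow_add, h1, pow_add, ← Finset.prod_pow_eq_pow_sum]
      rfl
    have h3 : (q : ℝ≥0∞) ^ (M x).numFaces =
        (q : ℝ≥0∞) ^ p.numFaces / (q : ℝ≥0∞) ^ H * ∏ h, (q : ℝ≥0∞) ^ (x h).1.numFaces := by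
      rw [ENNReal.div_eq_inv_mul, mul_assoc, ← h2, ← ENNReal.div_eq_inv_mul,
        ENNReal.mul_div_cancel_right (pow_ne_zero _ hq0) (ENNReal.pow_ne_top hqt)]
    rw [h3]
    simp only [c, div_eq_mul_inv]
    ring
  have htot : μ (Q ⁻¹' s) = c * ∏ h, partitionFunction q (p.holeDeg h) := by
    rw [hsum]
    simp only [hlaw]
    rw [ENNReal.tsum_mul_left, ENNReal.tsum_pi_prod (X := X)
      (fun h x => (q : ℝ≥0∞) ^ x.1.numFaces)]
    rfl
  rw [hgl, hlaw, hsub, htot, finprod_eq_prod_of_fintype]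
  -- `c` vanishes only if the partition function of perimeter two is infinite, and then both sides
  -- are zero. Otherwise the total mass `htot` is finite, which forces the partition functions of
  -- the holes to be finite, so that they can be cancelled.
  by_cases hc : c = 0
  · rw [hc]
    simp
  have hW0 : ∀ h, partitionFunction q (p.holeDeg h) ≠ 0 := by
    intro h h0
    rw [partitionFunction, ENNReal.tsum_eq_zero] at h0
    exact pow_ne_zero _ hq0 (h0 (xu h))
  have hWt : ∀ h, partitionFunction q (p.holeDeg h) ≠ ⊤ := by
    intro h ht
    have h1 : ∏ h, partitionFunction q (p.holeDeg h) = ⊤ := by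
      rw [← Finset.mul_prod_erase _ _ (Finset.mem_univ h), ht, ENNReal.top_mul]
      exact Finset.prod_ne_zero_iff.2 fun h _ => hW0 h
    rw [h1, ENNReal.mul_top hc] at htot
    exact measure_ne_top μ _ htot
  rw [mul_assoc, ← Finset.prod_mul_distrib]
  congr 1
  refine Finset.prod_congr rfl fun h _ => ?_
  rw [boltzmannProb, (hu h).2.2, ENNReal.mul_div_cancel (hW0 h) (hWt h), MapClass.numFaces_of]

/-- A Boltzmann map is a Boltzmann map for its natural filtration. -/
lemma isFBoltzmann_naturalFiltration (hq : 0 < q) (hQ : IsBoltzmann μ q 1 Q) :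
    IsFBoltzmann μ q (naturalFiltration μ Q) Q where
  adapted p := measurableSet_naturalFiltration_sub p.sub_refl
  indep p hp mark u A hmark hu hA := by
    have hGS : {ω | MapClass.IsGluing p mark u (Q ω)} ⊆
        {ω | MapClass.Sub (MapClass.of p) (Q ω)} :=
      fun ω hω => MapClass.IsGluing.sub hω hmark hp fun h => (hu h).1
    -- Either `A` has no mass on `{p ⊂ Q}` and both sides vanish, or it has full mass there and can
    -- be dropped.
    rcases naturalFiltration_trivial hA with h | h
    · rw [h, zero_mul]
      exact measure_mono_null (Set.inter_subset_inter_right A hGS) h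
    · have key : ∀ B ⊆ {ω | MapClass.Sub (MapClass.of p) (Q ω)}, μ (A ∩ B) = μ B := by
        intro B hB
        refine measure_congr (ae_eq_set.2 ⟨?_, ?_⟩)
        · convert measure_empty (μ := μ)
          exact Set.sdiff_eq_empty.2 Set.inter_subset_right
        · refine measure_mono_null (t := {ω | MapClass.Sub (MapClass.of p) (Q ω)} \ A)
            (fun ω hω => ⟨hB hω.1, fun h => hω.2 ⟨h, hω.1⟩⟩) h
      rw [key _ hGS, key _ subset_rfl, measure_isGluing hq hQ hp hmark hu]

end Filtration

namespace HoledMap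

/-! ## The right process on a quadrangulation of perimeter two -/

/-- The rotation around the end point of a dart. -/
def rot (m : HoledMap) : Equiv.Perm m.D := m.opp.trans m.face.symm

/-- The darts obtained from the root by rotation around its end point. -/
def spoke (m : HoledMap) (n : ℕ) : m.D := m.rot^[n] m.root

/-- The number of darts that end at the end point of the root. -/
noncomputable def valency (m : HoledMap) : ℕ := Function.minimalPeriod m.rot m.root

/-- Quadrangulations of perimeter two without holes. -/
structure IsQuadTwo (m : HoledMap) : Prop where
  quad : m.IsQuad
  closed : m.IsClosed
  perimeter : m.perimeter = 2

variable {m : HoledMap}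

lemma rot_apply (d : m.D) : m.rot d = m.face.symm (m.opp d) := rfl

lemma spoke_zero : m.spoke 0 = m.root := rfl

lemma spoke_succ (n : ℕ) : m.spoke (n + 1) = m.face.symm (m.opp (m.spoke n)) :=
  Function.iterate_succ_apply' _ _ _

lemma spoke_succ_eq_rot (n : ℕ) : m.spoke (n + 1) = m.rot (m.spoke n) :=
  Function.iterate_succ_apply' _ _ _

lemma face_spoke_succ (n : ℕ) : m.face (m.spoke (n + 1)) = m.opp (m.spoke n) := by
  rw [spoke_succ, Equiv.apply_symm_apply]

lemma valency_pos : 0 < m.valency := minimalPeriod_perm_pos _ _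

lemma spoke_valency : m.spoke m.valency = m.root := Function.iterate_minimalPeriod

lemma spoke_inj {a b : ℕ} (ha : a < m.valency) (hb : b < m.valency) (h : m.spoke a = m.spoke b) :
    a = b :=
  (Function.iterate_eq_iterate_iff_of_lt_minimalPeriod ha hb).1 h

lemma spoke_ne_root {a : ℕ} (h0 : 0 < a) (ha : a < m.valency) : m.spoke a ≠ m.root := fun h =>
  h0.ne' (spoke_inj ha valency_pos h)

lemma faceOf_spoke_succ (n : ℕ) :
    m.faceOf (m.spoke (n + 1)) = m.faceOf (m.opp (m.spoke n)) := by
  rw [spoke_succ, faceOf_symm]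

lemma IsQuadTwo.face_face_root (h : m.IsQuadTwo) : m.face (m.face m.root) = m.root := by
  have h1 := h.perimeter
  rw [perimeter_eq] at h1
  have h2 : m.face^[2] m.root = m.root := h1 ▸ Function.iterate_minimalPeriod
  exact h2

lemma IsQuadTwo.onRootFace_iff (h : m.IsQuadTwo) {d : m.D} :
    m.OnRootFace d ↔ d = m.root ∨ d = m.face m.root := by
  rw [HoledMap.onRootFace_iff]
  constructor
  · rintro ⟨k, rfl⟩
    induction k with
    | zero => exact Or.inl rfl
    | succ k ih =>
      rw [Function.iterate_succ_apply']
      rcases ih with ih | ih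
      · exact Or.inr (by rw [ih])
      · exact Or.inl (by rw [ih, h.face_face_root])
  · rintro (rfl | rfl)
    · exact ⟨0, rfl⟩
    · exact ⟨1, rfl⟩

lemma IsQuad.face_four (h : m.IsQuad) {d : m.D} (hd : ¬ m.OnRootFace d) : m.face^[4] d = d :=
  h.minimalPeriod hd ▸ Function.iterate_minimalPeriod

/-- A quadrangulation of perimeter two is bipartite. -/
lemma IsQuadTwo.exists_colouring (h : m.IsQuadTwo) :
    ∃ col : m.D → ZMod 2, (∀ d, col (m.face d) = col d + 1) ∧ ∀ d, col (m.opp d) = col d + 1 := by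
  classical
  -- `I` exchanges the two darts of the root digon, and opposite sides of each square. So all faces
  -- have even degree, the constant cochain `1` is a cocycle, and its potential is a two-colouring
  -- of the vertices.
  let I : m.D → m.D := fun d => if m.OnRootFace d then m.face d else m.face (m.face d)
  have c3 : ∀ f : m.D → ZMod 2, (∀ d, f (m.face d) = f d) → ∑ d, f d * (1 : ZMod 2) = 0 := by
    intro f hf
    refine Finset.sum_involution (fun d _ => I d) (fun d _ => ?_) (fun d _ _ hd => ?_)
      (fun _ _ => Finset.mem_univ _) (fun d _ => ?_)
    · have : f (I d) = f d := by
        by_cases hd : m.OnRootFace d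
        · simp only [I, if_pos hd, hf]
        · simp only [I, if_neg hd, hf]
      rw [this, zmod2_add_self]
    · by_cases hr : m.OnRootFace d
      · simp only [I, if_pos hr] at hd
        have h1 : m.face m.root = m.root := by
          rcases h.onRootFace_iff.1 hr with rfl | rfl
          · exact hd
          · rw [← hd, h.face_face_root]
        have h2 := h.perimeter
        rw [perimeter_eq] at h2
        have := Function.IsPeriodicPt.minimalPeriod_le (f := m.face) one_pos h1
        omega
      · simp only [I, if_neg hr] at hd
        have h1 := h.quad.minimalPeriod hr
        have := Function.IsPeriodicPt.minimalPeriod_le (f := m.face) (n := 2) two_pos hd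
        omega
    · by_cases hr : m.OnRootFace d
      · have hr' := (onRootFace_face _).2 hr
        simp only [I, if_pos hr, if_pos hr']
        rcases h.onRootFace_iff.1 hr with rfl | rfl
        · exact h.face_face_root
        · rw [h.face_face_root]
      · have hr' : ¬ m.OnRootFace (m.face (m.face d)) := by
          rwa [onRootFace_face, onRootFace_face]
        simp only [I, if_neg hr, if_neg hr']
        exact h.quad.face_four hr
  obtain ⟨g, hg, hg1⟩ := h.quad.exact (fun _ => 1) (fun _ => rfl)
    (fun d hd => absurd hd (h.closed d)) c3
  have key : ∀ a b : ZMod 2, 1 = a + b → a = b + 1 := by decide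
  have hf : ∀ d, g (m.face d) = g d + 1 := fun d => key _ _ (hg1 d)
  refine ⟨g, hf, fun d => ?_⟩
  have h1 := hg d
  rw [hf] at h1
  have key' : ∀ a b : ZMod 2, a + 1 = b → a = b + 1 := by decide
  exact key' _ _ h1

lemma col_rot {col : m.D → ZMod 2} (h1 : ∀ d, col (m.face d) = col d + 1)
    (h2 : ∀ d, col (m.opp d) = col d + 1) (n : ℕ) : col (m.spoke n) = col m.root := by
  induction n with
  | zero => rfl
  | succ n ih =>
    have h3 := h1 (m.spoke (n + 1))
    rw [face_spoke_succ, h2, ih] at h3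
    exact (add_right_cancel h3).symm

/-- All spokes have the colour of the root, while reversal changes the colour: there is no loop at
the end point of the root. -/
lemma IsQuadTwo.opp_spoke_ne (h : m.IsQuadTwo) (a b : ℕ) : m.opp (m.spoke a) ≠ m.spoke b := by
  obtain ⟨col, h1, h2⟩ := h.exists_colouring
  intro hab
  have := congrArg col hab
  rw [h2, col_rot h1 h2, col_rot h1 h2] at this
  simp at this

lemma IsQuadTwo.face_spoke_ne (h : m.IsQuadTwo) (a b : ℕ) : m.face (m.spoke a) ≠ m.spoke b := by
  obtain ⟨col, h1, h2⟩ := h.exists_colouring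
  intro hab
  have := congrArg col hab
  rw [h1, col_rot h1 h2, col_rot h1 h2] at this
  simp at this

/-- Two different darts with the same end point on a face of degree four are opposite sides. -/
lemma IsQuadTwo.face_face_spoke (h : m.IsQuadTwo) {a b : ℕ} (ha : ¬ m.OnRootFace (m.spoke a))
    (hab : m.faceOf (m.spoke a) = m.faceOf (m.spoke b)) (hne : m.spoke a ≠ m.spoke b) :
    m.face (m.face (m.spoke a)) = m.spoke b := by
  obtain ⟨k, hk⟩ := (m.faceOf_eq_iff_iterate).1 hab
  rw [← Function.iterate_mod_minimalPeriod_eq, h.quad.minimalPeriod ha] at hk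
  have hk4 : k % 4 < 4 := Nat.mod_lt _ (by norm_num)
  interval_cases hkk : k % 4
  · exact absurd hk hne
  · exact absurd hk (h.face_spoke_ne a b)
  · exact hk
  · have h4 := h.quad.face_four ha
    rw [show m.face^[4] (m.spoke a) = m.face (m.face^[3] (m.spoke a)) from
      Function.iterate_succ_apply' _ _ _, hk] at h4
    exact absurd h4 (h.face_spoke_ne b a)

lemma IsQuadTwo.onRootFace_spoke (h : m.IsQuadTwo) {a : ℕ} (ha : m.OnRootFace (m.spoke a)) :
    m.spoke a = m.root :=
  (h.onRootFace_iff.1 ha).resolve_right fun h' => h.face_spoke_ne 0 a h'.symm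

/-- The right-most edge after crossing a spoke is the next spoke. It has not been crossed: within
one period the spokes are distinct, and in the absence of loops none is the reverse of another. So
the process never has to look past the first edge. -/
lemma IsQuadTwo.rightStep (h : m.IsQuadTwo) {n : ℕ} (hn : n < m.valency) :
    (m.rightStep n).1 = m.spoke n ∧
      ∀ d, d ∈ (m.rightStep n).2 ↔ ∃ j ≤ n, d = m.spoke j ∨ d = m.opp (m.spoke j) := by
  induction n with
  | zero =>
    refine ⟨rfl, fun d => ?_⟩
    change d ∈ ({m.root, m.opp m.root} : Set m.D) ↔ _
    simp [spoke_zero]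
  | succ n ih =>
    obtain ⟨ih1, ih2⟩ := ih (by omega)
    have hstep : (m.rightStep (n + 1)).1 = m.spoke (n + 1) := by
      change firstIter m.face.symm (fun d => d ∉ (m.rightStep n).2) (m.opp (m.rightStep n).1) = _
      rw [ih1, spoke_succ]
      refine firstIter_eq (k := 1) one_pos ?_ (fun j h1 h2 => by omega)
      change m.face.symm (m.opp (m.spoke n)) ∉ _
      rw [← spoke_succ, ih2]
      rintro ⟨j, hj, hj' | hj'⟩
      · have := spoke_inj hn (by omega) hj'
        omega
      · exact h.opp_spoke_ne j (n + 1) hj'.symm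
    refine ⟨hstep, fun d => ?_⟩
    change d ∈ (m.rightStep n).2 ∪ {(m.rightStep (n + 1)).1, m.opp (m.rightStep (n + 1)).1} ↔ _
    rw [hstep, Set.mem_union, ih2]
    constructor
    · rintro (⟨j, hj, hd⟩ | hd)
      · exact ⟨j, by omega, hd⟩
      · exact ⟨n + 1, le_rfl, hd⟩
    · rintro ⟨j, hj, hd⟩
      rcases Nat.lt_or_ge n j with h' | h'
      · obtain rfl : j = n + 1 := by omega
        exact Or.inr hd
      · exact Or.inl ⟨j, h', hd⟩

lemma IsQuadTwo.rightFace (h : m.IsQuadTwo) {n : ℕ} (hn : n ≤ m.valency) :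
    m.rightFace n = m.faceOf (m.spoke n) := by
  cases n with
  | zero => rfl
  | succ n =>
    change m.faceOf (m.opp (m.rightStep n).1) = _
    rw [(h.rightStep (by omega)).1, faceOf_spoke_succ]

/-- A spoke on the root face can only be the root, because the other dart of the digon has the other
colour; the return takes exactly one full rotation. -/
lemma IsQuadTwo.returnTime (h : m.IsQuadTwo) : m.returnTime = m.valency := by
  refine IsLeast.csInf_eq ⟨⟨valency_pos, ?_⟩, ?_⟩
  · rw [h.rightFace le_rfl, spoke_valency]
    rfl
  · rintro n ⟨hn, hn'⟩
    by_contra hlt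
    rw [h.rightFace (by omega)] at hn'
    exact spoke_ne_root (by omega) (by omega) (h.onRootFace_spoke hn')

/-- The faces that are visited by the right process are different. -/
def NoPinch (m : HoledMap) : Prop :=
  ∀ n l, 1 ≤ n → n ≤ m.valency → 1 ≤ l → l ≤ m.valency → l ≠ n →
    m.faceOf (m.spoke n) ≠ m.faceOf (m.spoke l)

/-- The first self-intersection of the right process is visited at time `s` first and at time `t`
last. -/
structure IsPinch (m : HoledMap) (s t : ℕ) : Prop where
  one_le : 1 ≤ s
  lt : s < t
  lt_valency : t < m.valency
  faceOf_eq : m.faceOf (m.spoke s) = m.faceOf (m.spoke t)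
  first : ∀ n l, 1 ≤ n → n < s → 1 ≤ l → l ≤ m.valency → l ≠ n →
    m.faceOf (m.spoke n) ≠ m.faceOf (m.spoke l)
  last : ∀ n, t < n → n ≤ m.valency → m.faceOf (m.spoke n) ≠ m.faceOf (m.spoke s)

lemma IsQuadTwo.mem_multipleTimes (h : m.IsQuadTwo) {n : ℕ} : n ∈ m.multipleTimes ↔
    1 ≤ n ∧ n ≤ m.valency ∧ ∃ k, 1 ≤ k ∧ k ≤ m.valency ∧ k ≠ n ∧
      m.faceOf (m.spoke n) = m.faceOf (m.spoke k) := by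
  unfold multipleTimes
  rw [Set.mem_ofPred_eq, h.returnTime]
  refine and_congr_right fun _ => and_congr_right fun h2 => exists_congr fun k =>
    and_congr_right fun _ => and_congr_right fun h4 => and_congr_right fun _ => ?_
  rw [h.rightFace h2, h.rightFace h4]

lemma IsQuadTwo.mem_cutTrail_of_noPinch (h : m.IsQuadTwo) (h' : m.NoPinch) {d : m.D} :
    d ∈ m.cutTrail ↔ ∃ n < m.valency, d = m.spoke n := by
  have he : ¬ m.multipleTimes.Nonempty := by
    rintro ⟨n, hn⟩
    obtain ⟨h1, h2, k, h3, h4, h5, h6⟩ := h.mem_multipleTimes.1 hn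
    exact h' n k h1 h2 h3 h4 h5 h6
  unfold cutTrail
  rw [Set.mem_ofPred_eq, h.returnTime]
  refine exists_congr fun n => and_congr_right fun hn => ?_
  rw [(h.rightStep hn).1]
  simp [he]

lemma IsQuadTwo.mem_cutTrail_of_isPinch (h : m.IsQuadTwo) {s t : ℕ} (h' : m.IsPinch s t) {d : m.D} :
    d ∈ m.cutTrail ↔ ∃ n < m.valency, (n < s ∨ t ≤ n) ∧ d = m.spoke n := by
  have hs1 := h'.one_le
  have hst := h'.lt
  have htv := h'.lt_valency
  have hs : s ∈ m.multipleTimes := h.mem_multipleTimes.2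
    ⟨h'.one_le, by omega, t, by omega, by omega, by omega, h'.faceOf_eq⟩
  have hf : m.firstVisit = s := by
    refine IsLeast.csInf_eq ⟨hs, fun n hn => ?_⟩
    by_contra hlt
    obtain ⟨h1, h2, k, h3, h4, h5, h6⟩ := h.mem_multipleTimes.1 hn
    exact h'.first n k h1 (by omega) h3 h4 h5 h6
  have hl : m.lastVisit = t := by
    unfold lastVisit
    rw [hf, h.returnTime]
    refine IsGreatest.csSup_eq ⟨⟨by omega, ?_⟩, ?_⟩
    · rw [h.rightFace (by omega), h.rightFace (by omega), h'.faceOf_eq]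
    · rintro n ⟨hn, hn'⟩
      by_contra hlt
      rw [h.rightFace hn, h.rightFace (by omega)] at hn'
      exact h'.last n (by omega) hn hn'
  unfold cutTrail
  rw [Set.mem_ofPred_eq, h.returnTime]
  refine exists_congr fun n => and_congr_right fun hn => ?_
  rw [(h.rightStep hn).1, hf, hl]
  have : ¬ (m.multipleTimes.Nonempty ∧ s ≤ n ∧ n < t) ↔ (n < s ∨ t ≤ n) := by
    have : m.multipleTimes.Nonempty := ⟨s, hs⟩
    simp only [this, true_and]
    omega
  rw [this, and_comm]

lemma IsQuadTwo.noPinch_or_isPinch (h : m.IsQuadTwo) : m.NoPinch ∨ ∃ s t, m.IsPinch s t := by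
  classical
  by_cases hn : m.NoPinch
  · exact Or.inl hn
  right
  have hex : ∃ n, n ∈ m.multipleTimes := by
    unfold NoPinch at hn
    push Not at hn
    obtain ⟨n, l, h1, h2, h3, h4, h5, h6⟩ := hn
    exact ⟨n, h.mem_multipleTimes.2 ⟨h1, h2, l, h3, h4, h5, h6⟩⟩
  let s := Nat.find hex
  have hs : s ∈ m.multipleTimes := Nat.find_spec hex
  have hmin : ∀ n, n < s → n ∉ m.multipleTimes := fun n hn => Nat.find_min hex hn
  obtain ⟨h1, h2, l, h3, h4, h5, h6⟩ := h.mem_multipleTimes.1 hs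
  have hsl : s < l := by
    by_contra hlt
    exact hmin l (by omega) (h.mem_multipleTimes.2 ⟨h3, h4, s, h1, h2, h5.symm, h6.symm⟩)
  let P : ℕ → Prop := fun n => m.faceOf (m.spoke n) = m.faceOf (m.spoke s)
  let t := Nat.findGreatest P m.valency
  have hPt : P t := Nat.findGreatest_spec (P := P) h4 h6.symm
  have hlt : l ≤ t := Nat.le_findGreatest (P := P) h4 h6.symm
  have htv : t ≤ m.valency := Nat.findGreatest_le _
  -- The pinched face is not the root face, since the latter is not visited between time `0` and the
  -- return.
  have htne : t ≠ m.valency := by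
    intro ht
    have h7 : P m.valency := ht ▸ hPt
    have h8 : m.faceOf (m.spoke s) = m.faceOf m.root := by
      rw [← spoke_valency (m := m)]
      exact h7.symm
    exact spoke_ne_root (by omega) (by omega) (h.onRootFace_spoke h8)
  refine ⟨s, t, h1, by omega, by omega, hPt.symm, fun n k hn1 hn2 hk1 hk2 hne he => ?_,
    fun n hn hnv he => ?_⟩
  · exact hmin n hn2 (h.mem_multipleTimes.2 ⟨hn1, by omega, k, hk1, hk2, hne, he⟩)
  · exact Nat.findGreatest_is_greatest (P := P) hn hnv he

/-! ## Explored maps -/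

lemma crossedOpp_of_crossed {X : Set m.D} {d : {d : m.D // m.Discovered X d}}
    (h : m.Crossed X d.1) : (m.crossedOpp X d).1 = m.opp d.1 := by
  unfold crossedOpp
  rw [dif_pos h]

lemma crossedOpp_of_not_crossed {X : Set m.D} {d : {d : m.D // m.Discovered X d}}
    (h : ¬ m.Crossed X d.1) : m.crossedOpp X d = d := by
  unfold crossedOpp
  rw [dif_neg h]

/-- An explored part of `m` is embedded in `m`. -/
def exploreEmb (m : HoledMap) (X : Set m.D) : Emb (m.explore X) m where
  toFun := Subtype.val
  inj := Subtype.val_injective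
  map_root := rfl
  map_face _ := rfl
  map_opp d hd := by
    have h : (m.explore X).opp d = m.crossedOpp X d := rfl
    by_cases hc : m.Crossed X d.1
    · rw [h]
      exact crossedOpp_of_crossed hc
    · exact absurd (crossedOpp_of_not_crossed hc) hd

variable {X : Set m.D}

lemma explore_active_of_not_crossed {d : (m.explore X).D} (hd : ¬ m.Crossed X (m.exploreEmb X d)) :
    (m.explore X).Active d := crossedOpp_of_not_crossed hd

lemma explore_active_iff (hc : m.IsClosed) {d : (m.explore X).D} :
    (m.explore X).Active d ↔ ¬ m.Crossed X (m.exploreEmb X d) := by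
  refine ⟨fun hd h => hc d.1 ?_, explore_active_of_not_crossed⟩
  have h1 : m.crossedOpp X d = d := hd
  exact (crossedOpp_of_crossed h).symm.trans (congrArg Subtype.val h1)

lemma exists_exploreEmb_eq {d : m.D} (hd : m.Discovered X d) : ∃ a, m.exploreEmb X a = d :=
  ⟨⟨d, hd⟩, rfl⟩

lemma discovered_exploreEmb (a : (m.explore X).D) : m.Discovered X (m.exploreEmb X a) := a.2

lemma Crossed.discovered {d : m.D} (h : m.Crossed X d) : m.Discovered X d := Or.inr ⟨d, h, rfl⟩

/-- A connected map that is embedded in `m` is the part of `m` that is discovered by crossing its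
glued edges. -/
lemma Emb.nonempty_iso_explore {p : HoledMap} (e : Emb p m)
    (hp : ∀ d, Reach p.face p.opp p.root d)
    (hX : ∀ d, m.Crossed X d ↔ ∃ a, ¬ p.Active a ∧ e a = d) : Nonempty (Iso p (m.explore X)) := by
  have h1 : ∀ a, m.Discovered X (e a) := by
    intro a
    induction hp a with
    | base => exact Or.inl (by rw [e.map_root]; rfl)
    | left _ ih => rw [e.map_face, discovered_face]; exact ih
    | @right a _ ih =>
      by_cases ha : p.Active a
      · rwa [ha]
      · exact ((hX _).2 ⟨p.opp a, fun h => ha (p.active_opp.1 h), rfl⟩).discovered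
  have h2 : ∀ d, m.Discovered X d → ∃ a, e a = d := by
    rintro d (h | ⟨x, hx, hxd⟩)
    · exact e.mem_range_of_onRootFace h
    · obtain ⟨a, -, rfl⟩ := (hX x).1 hx
      exact e.mem_range_of_faceOf hxd.symm
  let T : p.D → (m.explore X).D := fun a => ⟨e a, h1 a⟩
  have hT : ∀ a, m.exploreEmb X (T a) = e a := fun a => rfl
  have hinj := (m.exploreEmb X).inj
  have hb : Function.Bijective T := by
    constructor
    · intro a b hab
      exact e.inj (by rw [← hT, hab, hT])
    · intro d
      obtain ⟨a, ha⟩ := h2 _ (discovered_exploreEmb d)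
      exact ⟨a, hinj ha⟩
  refine ⟨⟨Equiv.ofBijective T hb, fun d => hinj ?_, fun d => ?_, hinj e.map_root⟩⟩
  · rw [(m.exploreEmb X).map_face]
    exact e.map_face d
  · change T (p.opp d) = (m.explore X).opp (T d)
    by_cases hd : p.Active d
    · rw [hd, explore_active_of_not_crossed]
      rw [hX, hT]
      rintro ⟨a, ha, hae⟩
      rw [e.inj hae] at ha
      exact ha hd
    · have hc : m.Crossed X (T d).1 := (hX _).2 ⟨d, hd, rfl⟩
      have h3 : (m.explore X).opp (T d) = m.crossedOpp X (T d) := rfl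
      rw [h3]
      exact Subtype.ext ((e.map_opp d hd).trans (crossedOpp_of_crossed hc).symm)

/-- Explored parts with corresponding faces and corresponding gluings of the crossed edges are
isomorphic. -/
lemma exists_iso_explore {m' : HoledMap} (f : m.D ≃ m'.D) (hface : ∀ d, f (m.face d) = m'.face (f d))
    (hroot : f m.root = m'.root) {X : Set m.D} {Y : Set m'.D}
    (h : ∀ d, m'.Crossed Y (f d) ↔ m.Crossed X d)
    (hopp : ∀ d, m.Crossed X d → f (m.opp d) = m'.opp (f d)) :
    ∃ g : Iso (m.explore X) (m'.explore Y), ∀ d, (g.toEquiv d).1 = f d.1 := by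
  have hf : ∀ a b, m'.faceOf (f a) = m'.faceOf (f b) ↔ m.faceOf a = m.faceOf b := by
    intro a b
    rw [faceOf_eq_iff_iterate, faceOf_eq_iff_iterate]
    refine exists_congr fun k => ?_
    rw [← f.injective.eq_iff, (Function.Semiconj.iterate_right hface k).eq]
  have hdisc : ∀ d, m.Discovered X d ↔ m'.Discovered Y (f d) := by
    intro d
    refine or_congr ?_ ?_
    · unfold OnRootFace
      rw [← hroot, hf]
    constructor
    · rintro ⟨x, hx, hxd⟩
      exact ⟨f x, (h x).2 hx, (hf _ _).2 hxd⟩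
    · rintro ⟨y, hy, hyd⟩
      obtain ⟨x, rfl⟩ := f.surjective y
      exact ⟨x, (h x).1 hy, (hf _ _).1 hyd⟩
  refine ⟨⟨f.subtypeEquiv hdisc, fun d => Subtype.ext (hface d.1), fun d => ?_,
    Subtype.ext hroot⟩, fun d => rfl⟩
  apply Subtype.ext
  change f (m.crossedOpp X d).1 = (m'.crossedOpp Y _).1
  by_cases hd : m.Crossed X d.1
  · have hd' : m'.Crossed Y (f d.1) := (h _).2 hd
    exact (congrArg f (crossedOpp_of_crossed hd)).trans ((hopp d.1 hd).trans
      (crossedOpp_of_crossed (d := ⟨f d.1, (hdisc d.1).1 d.2⟩) hd').symm)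
  · have hd' : ¬ m'.Crossed Y (f d.1) := fun h' => hd ((h _).1 h')
    exact (congrArg (fun a => f a.1) (crossedOpp_of_not_crossed hd)).trans
      (congrArg Subtype.val (crossedOpp_of_not_crossed
        (d := ⟨f d.1, (hdisc d.1).1 d.2⟩) hd').symm)

lemma explore_reach_of_faceOf_eq {a b : (m.explore X).D}
    (h : m.faceOf (m.exploreEmb X a) = m.faceOf (m.exploreEmb X b))
    (ha : Reach (m.explore X).face (m.explore X).opp (m.explore X).root a) :
    Reach (m.explore X).face (m.explore X).opp (m.explore X).root b := by
  obtain ⟨k, hk⟩ := (faceOf_eq_iff_iterate _).1 ((m.exploreEmb X).faceOf_eq_iff.1 h)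
  rw [← hk]
  clear hk
  induction k with
  | zero => exact ha
  | succ k ih => rw [Function.iterate_succ_apply']; exact ih.left

lemma explore_reach_opp {a b : (m.explore X).D} (hc : m.Crossed X (m.exploreEmb X a))
    (h : m.exploreEmb X b = m.opp (m.exploreEmb X a))
    (ha : Reach (m.explore X).face (m.explore X).opp (m.explore X).root a) :
    Reach (m.explore X).face (m.explore X).opp (m.explore X).root b := by
  have : b = (m.explore X).opp a := by
    apply (m.exploreEmb X).inj
    rw [h]
    have h1 : (m.explore X).opp a = m.crossedOpp X a := rfl
    rw [h1]
    exact (crossedOpp_of_crossed (show m.Crossed X a.1 from hc)).symm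
  rw [this]
  exact ha.right

/-- The explored part is connected if the darts that are crossed are reached. -/
lemma explore_reach (h : ∀ a : (m.explore X).D, m.exploreEmb X a ∈ X →
    Reach (m.explore X).face (m.explore X).opp (m.explore X).root a) (b : (m.explore X).D) :
    Reach (m.explore X).face (m.explore X).opp (m.explore X).root b := by
  rcases discovered_exploreEmb b with hb | ⟨x, hx, hxb⟩
  · exact explore_reach_of_faceOf_eq (a := (m.explore X).root) hb.symm Reach.base
  · obtain ⟨a, rfl⟩ := exists_exploreEmb_eq hx.discovered
    refine explore_reach_of_faceOf_eq hxb ?_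
    rcases hx with hx | hx
    · exact h a hx
    · have hx' : m.Crossed X (m.opp (m.exploreEmb X a)) := Or.inl hx
      obtain ⟨c, hc⟩ := exists_exploreEmb_eq hx'.discovered
      refine explore_reach_opp (a := c) (hc ▸ hx') (by rw [hc, m.opp_opp]) (h c (hc ▸ hx))

/-- The part discovered by the right process and cut at the first self-intersection is connected. -/
lemma IsQuadTwo.explore_cutTrail_reach (h : m.IsQuadTwo) (b : (m.explore m.cutTrail).D) :
    Reach (m.explore m.cutTrail).face (m.explore m.cutTrail).opp (m.explore m.cutTrail).root b := by
  -- `K` selects the kept times. A kept spoke lies either on the face entered across the preceding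
  -- kept spoke or, at the jump to time `t`, on the face already entered at time `s`.
  obtain ⟨K, hX, hK⟩ : ∃ K : ℕ → Prop,
      (∀ d, d ∈ m.cutTrail ↔ ∃ n, n < m.valency ∧ K n ∧ d = m.spoke n) ∧
      ∀ n, n + 1 < m.valency → K (n + 1) →
        K n ∨ ∃ l ≤ n, 1 ≤ l ∧ K (l - 1) ∧ m.faceOf (m.spoke l) = m.faceOf (m.spoke (n + 1)) := by
    rcases h.noPinch_or_isPinch with h' | ⟨s, t, h'⟩
    · exact ⟨fun _ => True, fun d => by
        rw [h.mem_cutTrail_of_noPinch h']; simp, fun n _ _ => Or.inl trivial⟩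
    · refine ⟨fun n => n < s ∨ t ≤ n, fun d => h.mem_cutTrail_of_isPinch h',
        fun n hn hK => ?_⟩
      have := h'.one_le
      have := h'.lt
      by_cases hnt : n + 1 = t
      · exact Or.inr ⟨s, by omega, h'.one_le, Or.inl (by omega), hnt ▸ h'.faceOf_eq⟩
      · left
        beta_reduce at hK ⊢
        omega
  have key : ∀ n, n < m.valency → K n → ∀ a : (m.explore m.cutTrail).D,
      m.exploreEmb _ a = m.spoke n →
      Reach (m.explore m.cutTrail).face (m.explore m.cutTrail).opp (m.explore m.cutTrail).root a := by
    intro n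
    induction n using Nat.strong_induction_on with
    | _ n ih =>
      intro hn hKn a ha
      have hstep : ∀ l, l + 1 ≤ n → K l → ∀ b : (m.explore m.cutTrail).D,
          m.faceOf (m.exploreEmb _ b) = m.faceOf (m.spoke (l + 1)) →
          Reach (m.explore m.cutTrail).face (m.explore m.cutTrail).opp
            (m.explore m.cutTrail).root b := by
        intro l hl hKl b hb
        have hx : m.Crossed m.cutTrail (m.spoke l) :=
          Or.inl ((hX _).2 ⟨l, by omega, hKl, rfl⟩)
        have hx' := (m.crossed_opp _ _).2 hx
        obtain ⟨c, hc⟩ := exists_exploreEmb_eq hx.discovered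
        obtain ⟨c', hc'⟩ := exists_exploreEmb_eq hx'.discovered
        refine explore_reach_of_faceOf_eq (a := c') ?_ (explore_reach_opp (a := c) (hc ▸ hx)
          (by rw [hc, hc']) (ih l (by omega) (by omega) hKl c hc))
        rw [hc', hb, faceOf_spoke_succ]
      cases n with
      | zero =>
        have : a = (m.explore m.cutTrail).root := (m.exploreEmb _).inj ha
        rw [this]
        exact Reach.base
      | succ n =>
        rcases hK n hn hKn with h1 | ⟨l, hl, hl1, hKl, hf⟩
        · exact hstep n le_rfl h1 a (by rw [ha])
        · obtain ⟨l, rfl⟩ : ∃ j, l = j + 1 := ⟨l - 1, by omega⟩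
          exact hstep l (by omega) hKl a (by rw [ha, hf])
  refine explore_reach (fun a ha => ?_) b
  obtain ⟨n, hn, hKn, hna⟩ := (hX _).1 ha
  exact key n hn hKn a hna

lemma IsQuadTwo.explore_cutTrail_isQuad (h : m.IsQuadTwo) : (m.explore m.cutTrail).IsQuad :=
  (m.exploreEmb _).isQuad h.quad h.explore_cutTrail_reach

end HoledMap

namespace HoledMap

/-! ## The cut submap of a map that contains a cut submap -/

variable {p m m' : HoledMap}

/-- The darts `x` and `y` are the images of the same dart under two embeddings. -/
def Emb.Corr (i : Emb p m') (e : Emb p m) (x : m'.D) (y : m.D) : Prop := ∃ a, i a = x ∧ e a = y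

lemma Emb.Corr.eq_iff {i : Emb p m'} {e : Emb p m} {x x' : m'.D} {y y' : m.D} (h : i.Corr e x y)
    (h' : i.Corr e x' y') : y = y' ↔ x = x' := by
  obtain ⟨a, rfl, rfl⟩ := h
  obtain ⟨b, rfl, rfl⟩ := h'
  rw [e.inj.eq_iff, i.inj.eq_iff]

lemma Emb.Corr.faceOf_eq_iff {i : Emb p m'} {e : Emb p m} {x x' : m'.D} {y y' : m.D}
    (h : i.Corr e x y) (h' : i.Corr e x' y') :
    m.faceOf y = m.faceOf y' ↔ m'.faceOf x = m'.faceOf x' := by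
  obtain ⟨a, rfl, rfl⟩ := h
  obtain ⟨b, rfl, rfl⟩ := h'
  rw [e.faceOf_eq_iff, i.faceOf_eq_iff]

lemma Emb.Corr.face {i : Emb p m'} {e : Emb p m} {x : m'.D} {y : m.D} (h : i.Corr e x y) :
    i.Corr e (m'.face x) (m.face y) := by
  obtain ⟨a, rfl, rfl⟩ := h
  exact ⟨p.face a, i.map_face a, e.map_face a⟩

lemma Emb.corr_root (i : Emb p m') (e : Emb p m) : i.Corr e m'.root m.root :=
  ⟨p.root, i.map_root, e.map_root⟩

lemma Emb.map_rot (e : Emb p m) {a : p.D} (ha : ¬ p.Active a) : e (p.rot a) = m.rot (e a) := by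
  rw [rot_apply, rot_apply, e.map_symm, e.map_opp a ha]

/-- The edge of a dart in `X` is glued in the explored part, and the embedding respects this gluing.
Hence both rotations proceed in parallel as long as the current spoke is kept. -/
lemma Emb.Corr.rot {X : Set m'.D} {e : Emb (m'.explore X) m} (hc : m'.IsClosed) {x : m'.D} {y : m.D}
    (h : (m'.exploreEmb X).Corr e x y) (hx : x ∈ X) :
    (m'.exploreEmb X).Corr e (m'.rot x) (m.rot y) := by
  obtain ⟨a, rfl, rfl⟩ := h
  have ha : ¬ (m'.explore X).Active a := fun h => (explore_active_iff hc).1 h (Or.inl hx)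
  exact ⟨(m'.explore X).rot a, Emb.map_rot _ ha, e.map_rot ha⟩

lemma exists_corr {X : Set m'.D} (e : Emb (m'.explore X) m) {x : m'.D} (hx : x ∈ X) :
    ∃ y, (m'.exploreEmb X).Corr e x y := by
  have hc : m'.Crossed X x := Or.inl hx
  obtain ⟨a, ha⟩ := exists_exploreEmb_eq hc.discovered
  exact ⟨e a, a, ha, rfl⟩

lemma Filling.face_symm {e : Emb p m} {x₀ : p.D} {d : m.D} (hd : d ∉ Set.range e)
    (h : Filling e x₀ d) : Filling e x₀ (m.face.symm d) := by
  have h1 : m.faceOf d = m.faceOf (m.face.symm d) := (m.faceOf_symm d).symm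
  obtain ⟨k, hk⟩ := (faceOf_eq_iff_iterate _).1 h1
  rw [← hk]
  have key : ∀ k, m.face^[k] d ∉ Set.range e ∧ Filling e x₀ (m.face^[k] d) := by
    intro k
    induction k with
    | zero => exact ⟨hd, h⟩
    | succ k ih =>
      rw [Function.iterate_succ_apply']
      exact ⟨fun h' => ih.1 (e.face_mem_range.1 h'), Filling.face ih.1 ih.2⟩
  exact (key k).2

/-- If the part of `m'` that is discovered by crossing `X` is embedded in `m` and its glued edges
are the edges crossed by `Y`, then it is the part of `m` that is discovered by crossing `Y`. -/
lemma nonempty_iso_explore_of_corr {X : Set m'.D} {Y : Set m.D} (hc : m'.IsClosed)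
    (e : Emb (m'.explore X) m)
    (hr : ∀ d, Reach (m'.explore X).face (m'.explore X).opp (m'.explore X).root d)
    (h : ∀ y, y ∈ Y ↔ ∃ x ∈ X, (m'.exploreEmb X).Corr e x y) :
    Nonempty (Iso (m'.explore X) (m.explore Y)) := by
  have hX : ∀ a, ¬ (m'.explore X).Active a ↔
      m'.exploreEmb X a ∈ X ∨ m'.exploreEmb X ((m'.explore X).opp a) ∈ X := by
    intro a
    rw [explore_active_iff hc, not_not]
    refine ⟨fun ha => ?_, fun ha => ?_⟩
    · have : ¬ (m'.explore X).Active a := fun h' => (explore_active_iff hc).1 h' ha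
      rw [Emb.map_opp _ _ this]
      exact ha
    · rcases ha with ha | ha
      · exact Or.inl ha
      · by_contra h'
        have : (m'.explore X).Active a := explore_active_of_not_crossed h'
        rw [this] at ha
        exact h' (Or.inl ha)
  refine e.nonempty_iso_explore hr fun d => ⟨?_, ?_⟩
  · rintro (hd | hd)
    · obtain ⟨x, hx, a, rfl, rfl⟩ := (h d).1 hd
      exact ⟨a, (hX a).2 (Or.inl hx), rfl⟩
    · obtain ⟨x, hx, a, rfl, ha⟩ := (h _).1 hd
      have h1 : ¬ (m'.explore X).Active a := (hX a).2 (Or.inl hx)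
      refine ⟨(m'.explore X).opp a, fun h2 => h1 ((active_opp _).1 h2), ?_⟩
      rw [e.map_opp a h1, ha, m.opp_opp]
  · rintro ⟨a, ha, rfl⟩
    rcases (hX a).1 ha with h1 | h1
    · exact Or.inl ((h _).2 ⟨_, h1, a, rfl, rfl⟩)
    · exact Or.inr ((h _).2 ⟨_, h1, _, rfl, e.map_opp a ha⟩)

/-- Without self-intersection every spoke is kept, so the whole rotation is copied: the valencies
and the coincidences of faces are the same. -/
lemma IsQuadTwo.corr_of_noPinch (h' : m'.IsQuadTwo) (h : m.IsQuadTwo) (hn : m'.NoPinch)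
    (e : Emb (m'.explore m'.cutTrail) m) (y : m.D) :
    y ∈ m.cutTrail ↔ ∃ x ∈ m'.cutTrail, (m'.exploreEmb m'.cutTrail).Corr e x y := by
  have hmem : ∀ n, n < m'.valency → m'.spoke n ∈ m'.cutTrail := fun n hnv =>
    (h'.mem_cutTrail_of_noPinch hn).2 ⟨n, hnv, rfl⟩
  have hcorr : ∀ n, n ≤ m'.valency →
      (m'.exploreEmb m'.cutTrail).Corr e (m'.spoke n) (m.spoke n) := by
    intro n
    induction n with
    | zero => exact fun _ => Emb.corr_root _ _
    | succ n ih =>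
      intro hnv
      rw [spoke_succ_eq_rot, spoke_succ_eq_rot]
      exact (ih (by omega)).rot h'.closed (hmem n (by omega))
  have hroot : ∀ n, n ≤ m'.valency → (m.spoke n = m.root ↔ m'.spoke n = m'.root) := fun n hnv =>
    (hcorr n hnv).eq_iff (Emb.corr_root _ _)
  have hv : m.valency = m'.valency := by
    refine le_antisymm ?_ ?_
    · exact Function.IsPeriodicPt.minimalPeriod_le valency_pos
        ((hroot _ le_rfl).2 spoke_valency)
    · by_contra hlt
      exact spoke_ne_root valency_pos (not_le.1 hlt)
        ((hroot _ (not_le.1 hlt).le).1 spoke_valency)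
  have hm : m.NoPinch := by
    intro n l h1 h2 h3 h4 h5 h6
    rw [hv] at h2 h4
    exact hn n l h1 h2 h3 h4 h5 (((hcorr n h2).faceOf_eq_iff (hcorr l h4)).1 h6)
  rw [h.mem_cutTrail_of_noPinch hm, hv]
  constructor
  · rintro ⟨n, hnv, rfl⟩
    exact ⟨_, hmem n hnv, hcorr n hnv.le⟩
  · rintro ⟨x, hx, hxy⟩
    obtain ⟨n, hnv, rfl⟩ := (h'.mem_cutTrail_of_noPinch hn).1 hx
    exact ⟨n, hnv, (hxy.eq_iff (hcorr n hnv.le)).2 rfl⟩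

/-- If there is a first self-intersection, then the cut submap has a hole whose boundary consists of
one edge of the first pinched face and of the opposite edge. -/
lemma IsQuadTwo.hole_of_isPinch (h : m.IsQuadTwo) {s t : ℕ} (hst : m.IsPinch s t)
    {x₀ y : (m.explore m.cutTrail).D} (hx₀ : m.exploreEmb _ x₀ = m.spoke s)
    (hy : (m.explore m.cutTrail).Active y)
    (hxy : (m.explore m.cutTrail).cycOf x₀ = (m.explore m.cutTrail).cycOf y) :
    m.exploreEmb _ y = m.spoke s ∨ m.exploreEmb _ y = m.face (m.spoke t) := by
  have h1 := hst.one_le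
  have h2 := hst.lt
  have h3 := hst.lt_valency
  have hcut : ∀ n, n < m.valency → (m.spoke n ∈ m.cutTrail ↔ n < s ∨ t ≤ n) := by
    intro n hn
    rw [h.mem_cutTrail_of_isPinch hst]
    constructor
    · rintro ⟨l, hl, hl', he⟩
      rwa [spoke_inj hn hl he]
    · exact fun h' => ⟨n, hn, h', rfl⟩
  have hopp : ∀ n, m.opp (m.spoke n) ∉ m.cutTrail := by
    intro n hn
    obtain ⟨l, -, -, he⟩ := (h.mem_cutTrail_of_isPinch hst).1 hn
    exact h.opp_spoke_ne n l he
  -- The candidates for the cycle around the hole are the two boundary darts and the reversed kept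
  -- spokes. `C` is stable under `around`, and its only active members are the two boundary darts.
  let C : (m.explore m.cutTrail).D → Prop := fun a =>
    m.exploreEmb _ a = m.spoke s ∨ m.exploreEmb _ a = m.face (m.spoke t) ∨
      ∃ n, n < m.valency ∧ (n < s ∨ t ≤ n) ∧ m.exploreEmb _ a = m.opp (m.spoke n)
  have hface : ∀ n, 1 ≤ n → n ≤ m.valency → (n ≤ s ∨ t ≤ n) → ∀ a,
      m.exploreEmb _ a = m.face (m.spoke n) → C a := by
    intro n hn1 hnv hn a ha
    obtain ⟨l, rfl⟩ : ∃ l, n = l + 1 := ⟨n - 1, by omega⟩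
    by_cases hl : l + 1 = t
    · exact Or.inr (Or.inl (by rw [ha, hl]))
    · exact Or.inr (Or.inr ⟨l, by omega, by omega, by rw [ha, face_spoke_succ]⟩)
  have hact : ∀ a, (m.explore m.cutTrail).Active a → C a →
      m.exploreEmb _ a = m.spoke s ∨ m.exploreEmb _ a = m.face (m.spoke t) := by
    rintro a ha (h' | h' | ⟨n, hn, hn', h'⟩)
    · exact Or.inl h'
    · exact Or.inr h'
    · refine absurd (Or.inr ?_) ((explore_active_iff h.closed).1 ha)
      rw [h', m.opp_opp, hcut n hn]
      exact hn'
  have hstep : ∀ a, C a → C ((m.explore m.cutTrail).around a) := by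
    intro a ha
    by_cases hact' : (m.explore m.cutTrail).Active a
    · have h4 : m.exploreEmb _ ((m.explore m.cutTrail).around a) = m.face (m.exploreEmb _ a) := by
        rw [around_apply, hact', Emb.map_face]
      rcases hact a hact' ha with h' | h'
      · exact hface s h1 (by omega) (Or.inl le_rfl) _ (by rw [h4, h'])
      -- The spokes `s` and `t` are opposite sides of the square, so `s` comes two steps after `t`
      -- and the boundary closes up.
      · left
        rw [h4, h']
        refine h.face_face_spoke (fun h5 => ?_) hst.faceOf_eq.symm fun h5 => ?_
        · exact spoke_ne_root (by omega) h3 (h.onRootFace_spoke h5)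
        · have := spoke_inj (by omega) (by omega) h5
          omega
    · have h4 := Emb.map_around (m.exploreEmb _) hact'
      have hcr : m.Crossed m.cutTrail (m.exploreEmb _ a) := by
        by_contra h5
        exact hact' (explore_active_of_not_crossed h5)
      rcases ha with h' | h' | ⟨n, hn, hn', h'⟩
      · rw [h'] at hcr
        rcases hcr with hcr | hcr
        · have := (hcut s (by omega)).1 hcr
          omega
        · exact absurd hcr (hopp s)
      · obtain ⟨l, rfl⟩ : ∃ l, t = l + 1 := ⟨t - 1, by omega⟩
        rw [h', face_spoke_succ] at hcr
        rcases hcr with hcr | hcr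
        · exact absurd hcr (hopp l)
        · rw [m.opp_opp, hcut l (by omega)] at hcr
          omega
      · rw [h', m.around_apply, m.opp_opp] at h4
        rcases Nat.eq_zero_or_pos n with rfl | hn0
        · refine hface m.valency valency_pos le_rfl (Or.inr h3.le) _ ?_
          rw [h4, spoke_valency, spoke_zero]
        · exact hface n hn0 hn.le (by omega) _ h4
  refine hact y hy ?_
  obtain ⟨k, rfl⟩ := (cycOf_eq_iff_iterate _).1 hxy
  clear hxy hy
  induction k with
  | zero => exact Or.inl hx₀
  | succ k ih =>
    rw [Function.iterate_succ_apply']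
    exact hstep _ ih

/-- The rotations agree forwards from the root up to time `s`, and backwards from the root down to
the last visit, which may have another time `t'` in `m` because the hole is filled differently.
Between `s` and `t'` the rotation of `m` stays in the filling of the hole, where it meets no face of
the cut submap; so the first self-intersection is the same. -/
lemma IsQuadTwo.corr_of_isPinch (h' : m'.IsQuadTwo) (h : m.IsQuadTwo) {s t : ℕ}
    (hst : m'.IsPinch s t) (e : Emb (m'.explore m'.cutTrail) m) (y : m.D) :
    y ∈ m.cutTrail ↔ ∃ x ∈ m'.cutTrail, (m'.exploreEmb m'.cutTrail).Corr e x y := by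
  have h1 := hst.one_le
  have h2 := hst.lt
  have h3 := hst.lt_valency
  have hcut : ∀ n, n < m'.valency → (m'.spoke n ∈ m'.cutTrail ↔ n < s ∨ t ≤ n) := by
    intro n hn
    rw [h'.mem_cutTrail_of_isPinch hst]
    constructor
    · rintro ⟨l, hl, hl', he⟩
      rwa [spoke_inj hn hl he]
    · exact fun h' => ⟨n, hn, h', rfl⟩
  have hfwd : ∀ n, n ≤ s → (m'.exploreEmb m'.cutTrail).Corr e (m'.spoke n) (m.spoke n) := by
    intro n
    induction n with
    | zero => exact fun _ => Emb.corr_root _ _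
    | succ n ih =>
      intro hns
      rw [spoke_succ_eq_rot, spoke_succ_eq_rot]
      exact (ih (by omega)).rot h'.closed ((hcut n (by omega)).2 (Or.inl (by omega)))
  -- Times are counted backwards from the return, and injectivity of `rot` inverts each step. The
  -- bound `j < m.valency` ensures that the subtraction is not truncated.
  have hbwd : ∀ j, j ≤ m'.valency - t → j < m.valency ∧
      (m'.exploreEmb m'.cutTrail).Corr e (m'.spoke (m'.valency - j)) (m.spoke (m.valency - j)) := by
    intro j
    induction j with
    | zero =>
      intro _
      rw [Nat.sub_zero, Nat.sub_zero, spoke_valency, spoke_valency]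
      exact ⟨valency_pos, Emb.corr_root _ _⟩
    | succ j ih =>
      intro hj
      obtain ⟨ih1, ih2⟩ := ih (by omega)
      have hmem := (hcut (m'.valency - (j + 1)) (by omega)).2 (Or.inr (by omega))
      obtain ⟨y, hy⟩ := exists_corr e hmem
      have hy' := hy.rot h'.closed hmem
      rw [← spoke_succ_eq_rot, show m'.valency - (j + 1) + 1 = m'.valency - j by omega] at hy'
      have hyr := (hy'.eq_iff ih2).2 rfl
      rw [show m.valency - j = m.valency - (j + 1) + 1 by omega, spoke_succ_eq_rot,
        m.rot.injective.eq_iff] at hyr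
      rw [hyr] at hy
      refine ⟨?_, hy⟩
      by_contra hlt
      rw [show m.valency - (j + 1) = 0 by omega, spoke_zero] at hy
      exact spoke_ne_root (by omega) (by omega) ((hy.eq_iff (Emb.corr_root _ _)).1 rfl)
  have hsv : s < m.valency := by
    by_contra hlt
    exact spoke_ne_root valency_pos (by omega)
      (((hfwd m.valency (by omega)).eq_iff (Emb.corr_root _ _)).1 spoke_valency)
  -- The kept end of the trail has the same length in both maps: time `n ≥ t'` of `m` corresponds to
  -- time `t + (n - t')` of `m'`.
  obtain ⟨t', ht', hlast⟩ : ∃ t', t' = m.valency - (m'.valency - t) ∧ ∀ n, t' ≤ n → n ≤ m.valency →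
      (m'.exploreEmb m'.cutTrail).Corr e (m'.spoke (t + (n - t'))) (m.spoke n) := by
    refine ⟨_, rfl, fun n hn hnv => ?_⟩
    have h4 := hbwd (m.valency - n) (by omega)
    have h5 := hbwd (m'.valency - t) le_rfl
    rw [show m.valency - (m.valency - n) = n by omega,
      show m'.valency - (m.valency - n) = t + (n - (m.valency - (m'.valency - t))) by omega] at h4
    exact h4.2
  have htpos := (hbwd (m'.valency - t) le_rfl).1
  have ht := hlast t' le_rfl (by omega)
  rw [Nat.sub_self, Nat.add_zero] at ht
  have hst' : s < t' := by
    by_contra hlt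
    have := spoke_inj (by omega) (by omega) (((hfwd t' (by omega)).eq_iff ht).1 rfl)
    omega
  have htv : t' < m.valency := by omega
  obtain ⟨x₀, hx₀, hx₀'⟩ := hfwd s le_rfl
  have hact : ((m'.explore m'.cutTrail)).Active x₀ := by
    rw [explore_active_iff h'.closed, hx₀]
    rintro (hc | hc)
    · have := (hcut s (by omega)).1 hc
      omega
    · obtain ⟨l, -, -, he⟩ := (h'.mem_cutTrail_of_isPinch hst).1 hc
      exact h'.opp_spoke_ne s l he
  -- To re-enter the cut submap, the reversed spoke would have to be one of the two boundary darts
  -- of the hole. One of them is a spoke, which is impossible without loops; the other is the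
  -- reverse of the spoke just before `t'`, which is too late for this step.
  have hmid : ∀ r, s + r < t' → Filling e x₀ (m.spoke (s + r)) ∧
      (0 < r → m.spoke (s + r) ∉ Set.range e) := by
    intro r
    induction r with
    | zero =>
      intro _
      rw [Nat.add_zero, ← hx₀']
      exact ⟨Filling.base, fun h0 => absurd h0 (lt_irrefl 0)⟩
    | succ r ih =>
      intro hr
      have ih1 := (ih (by omega)).1.opp
      have hno : m.opp (m.spoke (s + r)) ∉ Set.range e := by
        rintro ⟨y, hy⟩
        rw [← hy] at ih1
        have hya := ih1.active hact
        rcases h'.hole_of_isPinch hst hx₀ hya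
          (ih1.cycOf_eq h'.explore_cutTrail_isQuad h.quad hact).symm with h4 | h4
        · have h5 : (m'.exploreEmb m'.cutTrail).Corr e (m'.spoke s) (e y) := ⟨y, h4, rfl⟩
          rw [hy] at h5
          exact h.opp_spoke_ne _ _ ((h5.eq_iff (hfwd s le_rfl)).2 rfl)
        · have h5 : (m'.exploreEmb m'.cutTrail).Corr e (m'.face (m'.spoke t)) (e y) := ⟨y, h4, rfl⟩
          have h6 := (h5.eq_iff ht.face).2 rfl
          rw [hy, ← face_spoke_succ, m.face.injective.eq_iff] at h6
          have := spoke_inj (by omega) htv h6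
          omega
      rw [← Nat.add_assoc, spoke_succ]
      refine ⟨ih1.face_symm hno, fun _ hr' => hno ?_⟩
      have := e.face_mem_range.2 hr'
      rwa [Equiv.apply_symm_apply] at this
  have hm : m.IsPinch s t' := by
    refine ⟨h1, hst', htv, ((hfwd s le_rfl).faceOf_eq_iff ht).2 hst.faceOf_eq, ?_, ?_⟩
    · intro n l hn1 hn2 hl1 hl2 hne he
      rcases le_or_gt l s with hls | hls
      · exact hst.first n l hn1 hn2 hl1 (by omega) hne
          (((hfwd n hn2.le).faceOf_eq_iff (hfwd l hls)).1 he)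
      rcases Nat.lt_or_ge l t' with hlt | hlt
      · refine (hmid (l - s) (by omega)).2 (by omega) ?_
        rw [show s + (l - s) = l by omega]
        obtain ⟨a, -, ha⟩ := hfwd n hn2.le
        rw [← ha] at he
        exact e.mem_range_of_faceOf he.symm
      · exact hst.first n (t + (l - t')) hn1 hn2 (by omega) (by omega) (by omega)
          (((hfwd n hn2.le).faceOf_eq_iff (hlast l hlt hl2)).1 he)
    · intro n hn1 hn2 he
      exact hst.last (t + (n - t')) (by omega) (by omega)
        (((hlast n hn1.le hn2).faceOf_eq_iff (hfwd s le_rfl)).1 he)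
  rw [h.mem_cutTrail_of_isPinch hm]
  constructor
  · rintro ⟨n, hnv, hn, rfl⟩
    rcases Nat.lt_or_ge n s with hns | hns
    · exact ⟨_, (hcut n (by omega)).2 (Or.inl hns), hfwd n hns.le⟩
    · exact ⟨_, (hcut (t + (n - t')) (by omega)).2 (Or.inr (by omega)),
        hlast n (by omega) hnv.le⟩
  · rintro ⟨x, hx, hxy⟩
    obtain ⟨n, hnv, hn, rfl⟩ := (h'.mem_cutTrail_of_isPinch hst).1 hx
    rcases Nat.lt_or_ge n s with hns | hns
    · exact ⟨n, by omega, Or.inl hns, (hxy.eq_iff (hfwd n hns.le)).2 rfl⟩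
    · refine ⟨t' + (n - t), by omega, Or.inr (by omega),
        (hxy.eq_iff (hlast _ (by omega) (by omega))).2 ?_⟩
      rw [show t + (t' + (n - t) - t') = n by omega]

/-- A quadrangulation that contains the cut submap of another one has the same cut submap. -/
theorem IsQuadTwo.nonempty_iso_explore_cutTrail (h' : m'.IsQuadTwo) (h : m.IsQuadTwo)
    (e : Emb (m'.explore m'.cutTrail) m) :
    Nonempty (Iso (m'.explore m'.cutTrail) (m.explore m.cutTrail)) := by
  refine nonempty_iso_explore_of_corr h'.closed e h'.explore_cutTrail_reach fun y => ?_
  rcases h'.noPinch_or_isPinch with hn | ⟨s, t, hst⟩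
  · exact h'.corr_of_noPinch h hn e y
  · exact h'.corr_of_isPinch h hst e y

end HoledMap

/-! ### The cut submap as a stopping map -/

namespace MapClass

variable {m : HoledMap} {x y : MapClass}

lemma isQuadTwo_of_mem (h : of m ∈ Quads 2) : m.IsQuadTwo := by
  obtain ⟨h1, h2, h3⟩ := mem_quads_of_iff.1 h
  exact ⟨h1, h2, h3⟩

lemma isQuadTwo_out (h : x ∈ Quads 2) : (Quotient.out x).IsQuadTwo :=
  isQuadTwo_of_mem (by rwa [of_out])

/-- On quadrangulations of perimeter two, having the cut submap `y` is therefore the same as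
containing `y`, for every value `y`. The stopping and Markov properties follow from this alone. -/
lemma cutSubmap_eq_of_sub (hx : x ∈ Quads 2) (hy : y ∈ Quads 2) (h : Sub (cutSubmap x) y) :
    cutSubmap y = cutSubmap x := by
  have hx' := isQuadTwo_out hx
  have hy' := isQuadTwo_out hy
  rw [← of_out y] at h
  obtain ⟨-, -, ⟨e⟩⟩ := sub_of_iff.1 h
  exact (of_eq_iff.2 (hx'.nonempty_iso_explore_cutTrail hy' e)).symm

/-- The cut submap does not depend on the representative. -/
lemma cutSubmap_of (h : of m ∈ Quads 2) : cutSubmap (of m) = of (m.explore m.cutTrail) := by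
  obtain ⟨f⟩ : Nonempty (Iso (Quotient.out (of m)) m) := of_eq_iff.1 (of_out _)
  exact of_eq_iff.2 ((isQuadTwo_out h).nonempty_iso_explore_cutTrail (isQuadTwo_of_mem h)
    ((exploreEmb _ _).trans f.toEmb))

lemma cutSubmap_sub (h : x ∈ Quads 2) : Sub (cutSubmap x) x := by
  have h' := isQuadTwo_out h
  conv_rhs => rw [← of_out x]
  exact sub_of_iff.2 ⟨h'.explore_cutTrail_isQuad, h'.quad, ⟨exploreEmb _ _⟩⟩

end MapClass

section Filtration

variable {Ω : Type*} [MeasurableSpace Ω] {μ : Measure Ω} {q : ℝ≥0} {Q : Ω → MapClass}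

/-- Up to a null set, the event that the cut submap lies in `r` is the countable union of the events
that `Q` contains `y`, over the values `y ⊂ r`. Each of these generates the filtration at `r`. -/
lemma isStoppingMap_cutSubmap (hQ : ∀ᵐ ω ∂μ, Q ω ∈ Quads 2) :
    IsStoppingMap μ (naturalFiltration μ Q) Q (fun ω => (Q ω).cutSubmap) where
  sub := by
    filter_upwards [hQ] with ω hω
    exact MapClass.cutSubmap_sub hω
  stopping r := by
    refine measurableSet_naturalFiltration_congr r
      (A := ⋃ x ∈ {x : MapClass | x ∈ Quads 2 ∧ MapClass.Sub x.cutSubmap r.1},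
        {ω | MapClass.Sub x.cutSubmap (Q ω)}) ?_ ?_
    · refine MeasurableSet.biUnion (Set.to_countable _) fun x hx => ?_
      exact measurableSet_naturalFiltration_sub
        (p := ⟨x.cutSubmap, _, rfl, (MapClass.isQuadTwo_out hx.1).explore_cutTrail_isQuad⟩) hx.2
    · filter_upwards [hQ] with ω hω
      refine propext ⟨fun h => ?_, fun h => ?_⟩
      · obtain ⟨x, hx, h'⟩ := Set.mem_iUnion₂.1 h
        have h2 := MapClass.cutSubmap_eq_of_sub hx.1 hω h'
        change MapClass.Sub (Q ω).cutSubmap r.1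
        rw [h2]
        exact hx.2
      · exact Set.mem_iUnion₂.2 ⟨Q ω, ⟨hω, h⟩, MapClass.cutSubmap_sub hω⟩

/-- If `p` is a possible value, the cut submap is almost surely `p` exactly when `p ⊂ Q`.
Intersecting `A` with the event that the cut submap lies in `p` gives an event of the filtration at
`p`, to which the Boltzmann property applies. -/
lemma hasMarkovProperty_cutSubmap (hQ : ∀ᵐ ω ∂μ, Q ω ∈ Quads 2)
    (hF : IsFBoltzmann μ q (naturalFiltration μ Q) Q) :
    HasMarkovProperty μ q (naturalFiltration μ Q) Q (fun ω => (Q ω).cutSubmap) := by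
  refine ⟨(isStoppingMap_cutSubmap hQ).sub, fun p mark u A hp hmark hu hA => ?_⟩
  by_cases hex : ∃ x ∈ Quads 2, MapClass.cutSubmap x = MapClass.of p
  · obtain ⟨x, hx, hxp⟩ := hex
    have key : ∀ y ∈ Quads 2, MapClass.Sub (MapClass.of p) y → y.cutSubmap = MapClass.of p :=
      fun y hy hpy => (MapClass.cutSubmap_eq_of_sub hx hy (hxp ▸ hpy)).trans hxp
    have hind := hF.indep p hp mark u _ hmark hu (hA.2 ⟨MapClass.of p, p, rfl, hp⟩)
    refine Eq.trans (measure_congr ?_) (hind.trans (congrArg (· * _) (measure_congr ?_)))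
    · filter_upwards [hQ] with ω hω
      refine propext ⟨fun h => ⟨⟨h.1.1, ?_⟩, h.2⟩, fun h => ⟨⟨h.1.1, ?_⟩, h.2⟩⟩
      · exact (congrArg (fun z => MapClass.Sub z _) h.1.2).mpr (MapClass.sub_refl_of hp)
      · exact key _ hω (MapClass.IsGluing.sub h.2 hmark hp fun h => (hu h).1)
    · filter_upwards [hQ] with ω hω
      refine propext ⟨fun h => ⟨h.1.1, key _ hω h.2⟩, fun h => ⟨⟨h.1, ?_⟩, ?_⟩⟩
      · exact (congrArg (fun z => MapClass.Sub z _) h.2).mpr (MapClass.sub_refl_of hp)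
      · have h1 := MapClass.cutSubmap_sub hω
        exact (congrArg (fun z => MapClass.Sub z _) h.2).mp h1
  · have h0 : μ (A ∩ {ω | (Q ω).cutSubmap = MapClass.of p}) = 0 := by
      refine measure_mono_null (t := {ω | ¬ Q ω ∈ Quads 2}) (fun ω hω hω' => ?_) (ae_iff.1 hQ)
      exact hex ⟨_, hω', hω.2⟩
    rw [h0, zero_mul]
    exact measure_mono_null Set.inter_subset_left h0

end Filtration

namespace HoledMap

/-! ## Peeling -/

variable {m m' : HoledMap} {S : Type*} [MeasurableSpace S]

/-- The edge that is picked only depends on the explored part of the map. -/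
lemma mem_pick_iff (A : PeelingAlgorithm S) (s : S) (f : m.D ≃ m'.D)
    (hface : ∀ d, f (m.face d) = m'.face (f d)) (hroot : f m.root = m'.root)
    {X : Set m.D} {Y : Set m'.D} (h : ∀ d, m'.Crossed Y (f d) ↔ m.Crossed X d)
    (hopp : ∀ d, m.Crossed X d → f (m.opp d) = m'.opp (f d)) (d : m.D) :
    (∃ h : m'.Discovered Y (f d),
      A.pick s (m'.explore Y) = some (⟨f d, h⟩ : {d : m'.D // m'.Discovered Y d})) ↔
    ∃ h : m.Discovered X d,
      A.pick s (m.explore X) = some (⟨d, h⟩ : {d : m.D // m.Discovered X d}) := by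
  obtain ⟨g, hg⟩ := exists_iso_explore f hface hroot h hopp
  rw [A.equivariant s _ _ g]
  constructor
  · rintro ⟨h1, h2⟩
    obtain ⟨a, ha, hga⟩ := Option.map_eq_some_iff.1 h2
    have h3 : f a.1 = f d := by
      rw [← hg, hga]
    obtain rfl := f.injective h3
    exact ⟨a.2, ha⟩
  · rintro ⟨h1, h2⟩
    have h3 : m'.Discovered Y (f d) := by
      rw [← hg ⟨d, h1⟩]
      exact (g.toEquiv ⟨d, h1⟩).2
    exact ⟨h3, Option.map_eq_some_iff.2 ⟨_, h2, Subtype.ext (hg _)⟩⟩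

lemma mem_peeled_succ (pick : (e : HoledMap) → Option e.D) (n : ℕ) (d : m.D) :
    d ∈ m.peeled pick (n + 1) ↔ d ∈ m.peeled pick n ∨
      ∃ h : m.Discovered (m.peeled pick n) d,
        pick (m.explore (m.peeled pick n)) =
          some (⟨d, h⟩ : {d : m.D // m.Discovered (m.peeled pick n) d}) := Iff.rfl

lemma peeled_mono (pick : (e : HoledMap) → Option e.D) : Monotone (m.peeled pick) :=
  monotone_nat_of_le_succ fun _ _ hd => Or.inl hd

lemma Crossed.mono {X Y : Set m.D} (h : X ⊆ Y) {d : m.D} (hd : m.Crossed X d) : m.Crossed Y d :=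
  hd.imp (fun h' => h h') fun h' => h h'

/-- As long as the crossed edges correspond, the explored parts are isomorphic, and equivariance
transports the next pick. -/
lemma Iso.mem_peeled_iff (A : PeelingAlgorithm S) (s : S) (f : Iso m m') (n : ℕ) (d : m.D) :
    f.toEquiv d ∈ m'.peeled (A.pick s) n ↔ d ∈ m.peeled (A.pick s) n := by
  induction n generalizing d with
  | zero => exact Iff.rfl
  | succ n ih =>
    rw [mem_peeled_succ, mem_peeled_succ, ih]
    refine or_congr_right (mem_pick_iff A s f.toEquiv f.map_face f.map_root (fun d => ?_)
      (fun d _ => f.map_opp d) d)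
    unfold Crossed
    rw [ih, ← f.map_opp, ih]

/-- The exploration does not depend on the representative. -/
lemma run_of (A : PeelingAlgorithm S) (s : S) (n : ℕ) :
    A.run s (MapClass.of m) n = MapClass.of (m.explore (m.peeled (A.pick s) n)) := by
  obtain ⟨f⟩ : Nonempty (Iso (Quotient.out (MapClass.of m)) m) :=
    MapClass.of_eq_iff.1 (MapClass.of_out _)
  obtain ⟨g, -⟩ := exists_iso_explore f.toEquiv f.map_face f.map_root
    (X := (Quotient.out (MapClass.of m)).peeled (A.pick s) n) (Y := m.peeled (A.pick s) n)
    (fun d => by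
      unfold Crossed
      rw [f.mem_peeled_iff, ← f.map_opp, f.mem_peeled_iff]) fun d _ => f.map_opp d
  exact MapClass.of_eq_iff.2 ⟨g⟩

/-- Two isomorphic explored parts of a map have the same crossed edges. -/
lemma Iso.crossed_iff (hc : m.IsClosed) {X Y : Set m.D} (g : Iso (m.explore X) (m.explore Y))
    (hr : ∀ d, Reach (m.explore X).face (m.explore X).opp (m.explore X).root d) (d : m.D) :
    m.Crossed Y d ↔ m.Crossed X d := by
  have key : ∀ a, m.exploreEmb Y (g.toEquiv a) = m.exploreEmb X a := fun a =>
    Emb.ext_of_reach (g.toEmb.trans (m.exploreEmb Y)) (m.exploreEmb X) hr a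
  have key' : ∀ a, m.Crossed Y (m.exploreEmb X a) ↔ m.Crossed X (m.exploreEmb X a) := by
    intro a
    rw [← not_iff_not, ← explore_active_iff hc, ← g.active_iff, explore_active_iff hc, key]
  constructor
  · intro hd
    obtain ⟨b, rfl⟩ := exists_exploreEmb_eq hd.discovered
    obtain ⟨a, rfl⟩ := g.toEquiv.surjective b
    rw [key] at hd ⊢
    exact (key' a).1 hd
  · intro hd
    obtain ⟨a, rfl⟩ := exists_exploreEmb_eq hd.discovered
    exact (key' a).2 hd

/-- On a fixed map there are finitely many sets of darts and finitely many possible picks, so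
measurability of each single pick suffices. -/
lemma measurableSet_peeled (A : PeelingAlgorithm S) (n : ℕ) (X : Set m.D) :
    MeasurableSet {s | m.peeled (A.pick s) n = X} := by
  induction n generalizing X with
  | zero => exact MeasurableSet.const (∅ = X)
  | succ n ih =>
    let N : Set m.D → (Y : Set m.D) → Option (m.explore Y).D → Prop := fun X Y o =>
      Y ∪ {d | ∃ h : m.Discovered Y d, o = some (⟨d, h⟩ : {d : m.D // m.Discovered Y d})} = X
    have h1 : {s | m.peeled (A.pick s) (n + 1) = X} =
        ⋃ Y : Set m.D, {s | m.peeled (A.pick s) n = Y} ∩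
          ⋃ o ∈ {o | N X Y o}, {s | A.pick s (m.explore Y) = o} := by
      ext s
      simp only [Set.mem_iUnion, Set.mem_inter_iff, Set.mem_ofPred_eq]
      constructor
      · exact fun h => ⟨_, rfl, _, h, rfl⟩
      · rintro ⟨Y, rfl, o, h, rfl⟩
        exact h
    have := m.fin
    have h2 : ∀ Y : Set m.D, Finite (Option (m.explore Y).D) := fun Y => by
      have := (m.explore Y).fin
      infer_instance
    rw [h1]
    refine MeasurableSet.iUnion fun Y => (ih Y).inter ?_
    exact MeasurableSet.biUnion (Set.to_countable _) fun o _ => A.measurable _ o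

lemma measurableSet_run (A : PeelingAlgorithm S) (n : ℕ) (x y : MapClass) :
    MeasurableSet {s | A.run s x n = y} := by
  have h1 : {s | A.run s x n = y} =
      ⋃ X ∈ {X : Set (Quotient.out x).D | MapClass.of ((Quotient.out x).explore X) = y},
        {s | (Quotient.out x).peeled (A.pick s) n = X} := by
    ext s
    simp only [Set.mem_iUnion, Set.mem_ofPred_eq]
    constructor
    · exact fun h => ⟨_, h, rfl⟩
    · rintro ⟨X, h, rfl⟩
      exact h
  have := (Quotient.out x).fin
  rw [h1]
  exact MeasurableSet.biUnion (Set.to_countable _) fun X _ => measurableSet_peeled A n X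

/-! ## Three quadrangulations that no algorithm distinguishes in time -/

/-- The number of cycles of a permutation whose cycles are labelled by `w`. -/
lemma card_quotient_sameCycle {D : Type} [Finite D] {σ : Equiv.Perm D} {k : ℕ} {w : D → Fin k}
    (hw : Function.Surjective w) (h : ∀ a b, w a = w b ↔ σ.SameCycle a b) :
    Nat.card (Quotient (Equiv.Perm.SameCycle.setoid σ)) = k := by
  rw [← Nat.card_fin k]
  refine Nat.card_congr (Equiv.ofBijective (Quotient.lift w fun a b hab => (h a b).2 hab) ⟨?_, ?_⟩)
  · rintro ⟨a⟩ ⟨b⟩ hab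
    exact Quotient.sound (s := Equiv.Perm.SameCycle.setoid σ) ((h a b).1 hab)
  · intro i
    obtain ⟨a, ha⟩ := hw i
    exact ⟨Quotient.mk _ a, ha⟩

/-- The gluings of a digon and two squares. -/
def gluingVec : Fin 3 → Fin 10 → Fin 10 :=
  ![![2, 6, 0, 7, 5, 4, 1, 3, 9, 8], ![2, 6, 0, 4, 3, 7, 1, 5, 9, 8],
    ![2, 6, 0, 9, 5, 4, 1, 8, 7, 3]]

/-- Labels of the start vertices. With 4 vertices, 5 edges and 3 faces, each map satisfies Euler's
formula. -/
def vertexVec : Fin 3 → Fin 10 → Fin 4 :=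
  ![![0, 1, 1, 0, 2, 0, 0, 1, 0, 3], ![0, 1, 1, 2, 1, 0, 0, 1, 0, 3],
    ![0, 1, 1, 0, 2, 0, 0, 1, 3, 1]]

/-- The root digon has the darts `0, 1`; the squares have the darts `2` to `5` and `6` to `9`. In
all three maps `0` is glued to `2` and `1` to `6`. -/
def faceVec : Fin 10 → Fin 3 := ![0, 0, 1, 1, 1, 1, 2, 2, 2, 2]

lemma gluingVec_involutive (i : Fin 3) : Function.Involutive (gluingVec i) := by
  revert i
  unfold Function.Involutive
  decide

/-- Three quadrangulations with perimeter two and two inner faces. -/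
@[reducible]
def threeMaps (i : Fin 3) : HoledMap where
  D := Fin 10
  fin := inferInstance
  face := ⟨![1, 0, 5, 2, 3, 4, 7, 8, 9, 6], ![1, 0, 3, 4, 5, 2, 9, 6, 7, 8], by decide, by decide⟩
  opp := (gluingVec_involutive i).toPerm
  opp_opp := gluingVec_involutive i
  root := 0

lemma threeMaps_sameCycle_face (i : Fin 3) (a b : Fin 10) :
    faceVec a = faceVec b ↔ (threeMaps i).face.SameCycle a b := by
  rw [sameCycle_iff_iterate]
  constructor
  · intro h
    -- Faces have degree at most four, so exponents below four suffice; `face` does not depend on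
    -- `i`.
    have key : ∀ a b, faceVec a = faceVec b →
        ∃ k : Fin 4, (threeMaps 0).face^[k] a = b := by decide
    obtain ⟨k, hk⟩ := key a b h
    exact ⟨k, hk⟩
  · rintro ⟨k, rfl⟩
    have key : ∀ a, faceVec ((threeMaps 0).face a) = faceVec a := by decide
    induction k with
    | zero => rfl
    | succ k ih =>
      rw [Function.iterate_succ_apply', ih]
      exact (key _).symm

lemma threeMaps_sameCycle_around (i : Fin 3) (a b : Fin 10) :
    vertexVec i a = vertexVec i b ↔ (threeMaps i).around.SameCycle a b := by
  rw [sameCycle_iff_iterate]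
  constructor
  · intro h
    have key : ∀ i a b, vertexVec i a = vertexVec i b →
        ∃ k : Fin 6, (threeMaps i).around^[k] a = b := by decide
    obtain ⟨k, hk⟩ := key i a b h
    exact ⟨k, hk⟩
  · rintro ⟨k, rfl⟩
    have key : ∀ i a, vertexVec i ((threeMaps i).around a) = vertexVec i a := by decide
    induction k with
    | zero => rfl
    | succ k ih =>
      rw [Function.iterate_succ_apply', ih]
      exact (key _ _).symm

lemma threeMaps_faceOf_eq_iff (i : Fin 3) (a b : Fin 10) :
    (threeMaps i).faceOf a = (threeMaps i).faceOf b ↔ faceVec a = faceVec b := by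
  rw [faceOf_eq_iff]
  exact (threeMaps_sameCycle_face i a b).symm

lemma threeMaps_isClosed (i : Fin 3) : (threeMaps i).IsClosed := by
  have key : ∀ i d, gluingVec i d ≠ d := by decide
  exact key i

lemma threeMaps_isQuadTwo (i : Fin 3) : (threeMaps i).IsQuadTwo := by
  have hcyc : Nat.card (threeMaps i).Cyc = 4 := by
    refine card_quotient_sameCycle (w := vertexVec i) ?_ (threeMaps_sameCycle_around i)
    revert i
    unfold Function.Surjective
    decide
  have hfaces : (threeMaps i).numFaces = 3 := by
    refine card_quotient_sameCycle (w := faceVec) ?_ (threeMaps_sameCycle_face i)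
    have key : ∀ b, ∃ a, faceVec a = b := by decide
    exact key
  have hcard : ∀ d : Fin 10, Nat.card {d' : Fin 10 // (threeMaps i).faceOf d' = (threeMaps i).faceOf d}
      = if d = 0 ∨ d = 1 then 2 else 4 := by
    intro d
    rw [Nat.card_congr (Equiv.subtypeEquivRight fun d' => threeMaps_faceOf_eq_iff i d' d),
      Nat.card_eq_fintype_card]
    revert d
    decide
  refine ⟨⟨fun d => closure_of_reach ?_, ?_, fun d hd => ?_⟩, threeMaps_isClosed i, ?_⟩
  · have hface : ∀ a b : Fin 10, faceVec a = faceVec b →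
        Reach (threeMaps i).face (threeMaps i).opp (threeMaps i).root a →
        Reach (threeMaps i).face (threeMaps i).opp (threeMaps i).root b := by
      intro a b hab ha
      obtain ⟨k, rfl⟩ := sameCycle_iff_iterate.1 ((threeMaps_sameCycle_face i a b).1 hab)
      clear hab
      induction k with
      | zero => exact ha
      | succ k ih =>
        rw [Function.iterate_succ_apply']
        exact ih.left
    have hopp : ∀ i, (threeMaps i).opp 0 = 2 ∧ (threeMaps i).opp 1 = 6 := by decide
    have h0 : Reach (threeMaps i).face (threeMaps i).opp (threeMaps i).root (0 : Fin 10) :=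
      Reach.base
    have h2 := h0.right
    have h6 := (hface 0 1 rfl h0).right
    rw [(hopp i).1] at h2
    rw [(hopp i).2] at h6
    have key : ∀ d, faceVec 0 = faceVec d ∨ faceVec 2 = faceVec d ∨ faceVec 6 = faceVec d := by
      decide
    rcases key d with h | h | h
    · exact hface _ _ h h0
    · exact hface _ _ h h2
    · exact hface _ _ h h6
  · rw [hcyc, hfaces, Nat.card_congr (Equiv.subtypeUnivEquiv (threeMaps_isClosed i))]
    simp
  · rw [hcard d, if_neg]
    intro h
    refine hd ((threeMaps_faceOf_eq_iff i _ _).2 ?_)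
    rcases h with rfl | rfl <;> rfl
  · exact (hcard 0).trans (if_pos (Or.inl rfl))

lemma valency_eq {n : ℕ} (hn : 0 < n) (h : m.spoke n = m.root)
    (h' : ∀ j, 0 < j → j < n → m.spoke j ≠ m.root) : m.valency = n := by
  refine le_antisymm (Function.IsPeriodicPt.minimalPeriod_le hn h) ?_
  by_contra hlt
  exact h' _ valency_pos (not_le.1 hlt) spoke_valency

lemma threeMaps_valency (i : Fin 3) : (threeMaps i).valency = if i = 0 then 3 else 4 := by
  have h1 : ∀ i, (threeMaps i).spoke (if i = 0 then 3 else 4) = 0 := by decide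
  have h2 : ∀ i, ∀ j : Fin 4, 0 < j.1 → j.1 < (if i = 0 then 3 else 4) →
      (threeMaps i).spoke j ≠ 0 := by decide
  refine valency_eq (by split <;> norm_num) (h1 i) fun j hj hj' => h2 i ⟨j, ?_⟩ hj hj'
  split at hj' <;> omega

lemma threeMaps_faceOf_spoke_iff (i : Fin 3) (n l : ℕ) :
    (threeMaps i).faceOf ((threeMaps i).spoke n) = (threeMaps i).faceOf ((threeMaps i).spoke l) ↔
      faceVec ((threeMaps i).spoke n) = faceVec ((threeMaps i).spoke l) :=
  threeMaps_faceOf_eq_iff i _ _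

lemma threeMaps_noPinch : (threeMaps 0).NoPinch := by
  have key : ∀ n l : Fin 4, 1 ≤ n.1 → 1 ≤ l.1 → l.1 ≠ n.1 →
      faceVec ((threeMaps 0).spoke n) ≠ faceVec ((threeMaps 0).spoke l) := by decide
  intro n l h1 h2 h3 h4 h5
  rw [threeMaps_valency, if_pos rfl] at h2 h4
  rw [Ne, threeMaps_faceOf_spoke_iff]
  exact key ⟨n, by omega⟩ ⟨l, by omega⟩ h1 h3 h5

/-- Call the squares A (darts `2` to `5`) and B (darts `6` to `9`). Before its return, the rotation
visits A, A, B in map `1` and A, B, B in map `2`. -/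
lemma threeMaps_isPinch {i : Fin 3} (hi : i ≠ 0) : (threeMaps i).IsPinch i (i + 1) := by
  have hv : (threeMaps i).valency = 4 := by rw [threeMaps_valency, if_neg hi]
  have hi1 : i.1 ≠ 0 := fun h => hi (Fin.ext h)
  refine ⟨by omega, by omega, by omega, ?_, ?_, ?_⟩
  · rw [threeMaps_faceOf_spoke_iff]
    have key : ∀ i : Fin 3, i ≠ 0 →
        faceVec ((threeMaps i).spoke i) = faceVec ((threeMaps i).spoke (i + 1)) := by decide
    exact key i hi
  · intro n l h1 h2 h3 h4 h5
    have key : ∀ i : Fin 3, i ≠ 0 → ∀ n l : Fin 5, 1 ≤ n.1 → n.1 < i.1 → 1 ≤ l.1 → l.1 ≠ n.1 →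
        faceVec ((threeMaps i).spoke n) ≠ faceVec ((threeMaps i).spoke l) := by decide
    rw [Ne, threeMaps_faceOf_spoke_iff]
    exact key i hi ⟨n, by omega⟩ ⟨l, by omega⟩ h1 h2 h3 h5
  · intro n h1 h2
    have key : ∀ i : Fin 3, i ≠ 0 → ∀ n : Fin 5, i.1 + 1 < n.1 →
        faceVec ((threeMaps i).spoke n) ≠ faceVec ((threeMaps i).spoke i) := by decide
    rw [Ne, threeMaps_faceOf_spoke_iff]
    exact key i hi ⟨n, by omega⟩ h1

lemma threeMaps_mem_cutTrail (i : Fin 3) (d : Fin 10) :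
    d ∈ (threeMaps i).cutTrail ↔ d = 0 ∨ d = (if i = 1 then 5 else 3) ∨ d = 6 := by
  by_cases hi : i = 0
  · subst hi
    rw [(threeMaps_isQuadTwo 0).mem_cutTrail_of_noPinch threeMaps_noPinch, threeMaps_valency]
    revert d
    decide
  · rw [(threeMaps_isQuadTwo i).mem_cutTrail_of_isPinch (threeMaps_isPinch hi), threeMaps_valency]
    revert d
    revert i
    decide

/-- Besides the two edges of the root digon, the crossed edge is `{3, 7}`, `{5, 7}` and `{3, 9}` in
the three maps: each of these darts is missing in at least one of them. -/
lemma threeMaps_crossed_cutTrail (i : Fin 3) (d : Fin 10) :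
    (threeMaps i).Crossed (threeMaps i).cutTrail d ↔
      d = 0 ∨ d = 2 ∨ d = 1 ∨ d = 6 ∨ d = (if i = 1 then 5 else 3) ∨
        d = gluingVec i (if i = 1 then 5 else 3) := by
  unfold Crossed
  rw [threeMaps_mem_cutTrail, threeMaps_mem_cutTrail]
  revert i d
  decide

/-- No peeling algorithm discovers the cut submaps of all the three maps: as long as it has only
crossed edges of the root face, it does not distinguish the maps, and there is no other edge that is
crossed in all the cut submaps. -/
lemma threeMaps_not_run (A : PeelingAlgorithm S) (s : S) :
    ¬ ∀ i, ∃ n, A.run s (MapClass.of (threeMaps i)) n =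
      (MapClass.of (threeMaps i)).cutSubmap := by
  intro h
  -- Isomorphic explored parts of one map have the same crossed edges, so reaching the cut submap
  -- means having crossed exactly its edges.
  have h' : ∀ i, ∃ n, ∀ d, (threeMaps i).Crossed ((threeMaps i).peeled (A.pick s) n) d ↔
      (threeMaps i).Crossed (threeMaps i).cutTrail d := by
    intro i
    obtain ⟨n, hn⟩ := h i
    have hq := threeMaps_isQuadTwo i
    rw [run_of, MapClass.cutSubmap_of (MapClass.mem_quads_of_iff.2 ⟨hq.quad, hq.closed,
      hq.perimeter⟩)] at hn
    obtain ⟨g⟩ := MapClass.of_eq_iff.1 hn.symm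
    exact ⟨n, g.crossed_iff hq.closed hq.explore_cutTrail_reach⟩
  -- Invariant: the crossed darts are the same in the three maps and belong to edges of the root
  -- digon, where the three gluings agree. So the explored parts are isomorphic and the next pick is
  -- the same.
  have key : ∀ n, ∃ T : Set (Fin 10), (∀ d ∈ T, d = 0 ∨ d = 2 ∨ d = 1 ∨ d = 6) ∧
      ∀ i d, (threeMaps i).Crossed ((threeMaps i).peeled (A.pick s) n) d ↔ d ∈ T := by
    intro n
    induction n with
    | zero => exact ⟨∅, fun d hd => hd.elim, fun i d => or_self_iff⟩
    | succ n ih =>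
      obtain ⟨T, hT, hcr⟩ := ih
      let P : Fin 3 → Fin 10 → Prop := fun i d =>
        ∃ h : (threeMaps i).Discovered ((threeMaps i).peeled (A.pick s) n) d,
          A.pick s ((threeMaps i).explore ((threeMaps i).peeled (A.pick s) n)) = some
            (⟨d, h⟩ : {d : Fin 10 // (threeMaps i).Discovered ((threeMaps i).peeled (A.pick s) n) d})
      have hP : ∀ i d, P i d ↔ P 0 d := by
        intro i d
        refine mem_pick_iff (m := threeMaps 0) (m' := threeMaps i) A s (Equiv.refl (Fin 10))
          (fun _ => rfl) rfl (fun d => (hcr i d).trans (hcr 0 d).symm) (fun d hd => ?_) d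
        have hg : ∀ i d, (d = 0 ∨ d = 2 ∨ d = 1 ∨ d = 6) → gluingVec 0 d = gluingVec i d := by
          decide
        exact hg i d (hT d ((hcr 0 d).1 hd))
      have hsucc : ∀ i d, d ∈ (threeMaps i).peeled (A.pick s) (n + 1) ↔
          d ∈ (threeMaps i).peeled (A.pick s) n ∨ P 0 d := fun i d =>
        (mem_peeled_succ _ _ _).trans (or_congr_right (hP i d))
      have hP0 : ∀ d, P 0 d → d = 0 ∨ d = 2 ∨ d = 1 ∨ d = 6 := by
        intro d hd
        have hmem : ∀ i, (threeMaps i).Crossed (threeMaps i).cutTrail d := by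
          intro i
          obtain ⟨l, hl⟩ := h' i
          rw [← hl]
          rcases Nat.lt_or_ge n l with hnl | hnl
          · exact Or.inl (peeled_mono _ hnl ((hsucc i d).2 (Or.inr hd)))
          -- If the cut submap had been reached by step `n`, its edge between the two squares would
          -- already be crossed, contrary to the invariant. So the new pick must still belong to the
          -- cut submap.
          · exfalso
            have h1 := (hl _).2 ((threeMaps_crossed_cutTrail i (if i = 1 then 5 else 3)).2
              (by simp))
            have h2 := hT _ ((hcr i _).1 (h1.mono (peeled_mono _ hnl)))
            have hb : ∀ i : Fin 3, ¬ ((if i = 1 then (5 : Fin 10) else 3) = 0 ∨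
                (if i = 1 then (5 : Fin 10) else 3) = 2 ∨ (if i = 1 then (5 : Fin 10) else 3) = 1 ∨
                (if i = 1 then (5 : Fin 10) else 3) = 6) := by decide
            exact hb i h2
        have h0 := (threeMaps_crossed_cutTrail 0 d).1 (hmem 0)
        have h1 := (threeMaps_crossed_cutTrail 1 d).1 (hmem 1)
        have h2 := (threeMaps_crossed_cutTrail 2 d).1 (hmem 2)
        clear hmem hd
        revert d
        decide
      refine ⟨T ∪ {d | P 0 d ∨ P 0 (gluingVec 0 d)}, ?_, fun i d => ?_⟩
      · rintro d (hd | hd | hd)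
        · exact hT d hd
        · exact hP0 d hd
        · have hg : ∀ d, (gluingVec 0 d = 0 ∨ gluingVec 0 d = 2 ∨ gluingVec 0 d = 1 ∨
              gluingVec 0 d = 6) → d = 0 ∨ d = 2 ∨ d = 1 ∨ d = 6 := by decide
          exact hg d (hP0 _ hd)
      · have hg : ∀ d, P 0 (gluingVec i d) ↔ P 0 (gluingVec 0 d) := by
          intro d
          have h1 : ∀ i j d, (gluingVec i d = 0 ∨ gluingVec i d = 2 ∨ gluingVec i d = 1 ∨
              gluingVec i d = 6) → gluingVec i d = gluingVec j d := by decide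
          constructor
          · intro h2
            rwa [← h1 i 0 d (hP0 _ h2)]
          · intro h2
            rwa [← h1 0 i d (hP0 _ h2)]
        rw [Set.mem_union, ← hcr i d]
        unfold Crossed
        rw [hsucc, hsucc, Set.mem_ofPred_eq, ← hg]
        exact or_or_or_comm
  obtain ⟨n, hn⟩ := h' 0
  obtain ⟨T, hT, hcr⟩ := key n
  have h3 := (hn 3).2 ((threeMaps_crossed_cutTrail 0 3).2 (by decide))
  exact absurd (hT 3 ((hcr 0 3).1 h3)) (by decide)

end HoledMap

/-! ### From random seeds to a fixed seed -/

section Peeling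

variable {Ω : Type*} [MeasurableSpace Ω] {μ : Measure Ω} {q : ℝ≥0} {Q : Ω → MapClass} {ℓ : ℕ}

/-- A Boltzmann map takes every value with positive probability. -/
lemma IsBoltzmann.measure_ne_zero [IsProbabilityMeasure μ] (hQ : IsBoltzmann μ q ℓ Q) (hq : 0 < q)
    {x : MapClass} (hx : x ∈ Quads (2 * ℓ)) : μ {ω | Q ω = x} ≠ 0 := by
  rw [hQ.law x hx]
  -- If the partition function were infinite, the law would give probability zero to every map of a
  -- countable set that supports `Q`.
  refine (ENNReal.div_pos (pow_ne_zero _ (by simpa using hq.ne')) fun ht => ?_).ne'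
  have h1 : ∀ᵐ ω ∂μ, ∀ y ∈ Quads (2 * ℓ), Q ω ≠ y := by
    rw [ae_ball_iff (Set.to_countable _)]
    intro y hy
    rw [ae_iff]
    simpa [ht] using hQ.law y hy
  obtain ⟨ω, h2, h3⟩ := (h1.and hQ.support).exists
  exact h2 _ h3 rfl

/-- If an algorithm with an independent seed discovers the cut submap almost surely, then there is a
seed with which it discovers the cut submap of every quadrangulation. -/
lemma exists_seed [IsProbabilityMeasure μ] (hQ : IsBoltzmann μ q 1 Q) (hq : 0 < q) {S : Type*}
    [MeasurableSpace S] (A : PeelingAlgorithm S) {U : Ω → S}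
    (hind : IndepFun Q U μ) (h : ∀ᵐ ω ∂μ, ∃ n : ℕ, A.run (U ω) (Q ω) n = (Q ω).cutSubmap) :
    ∃ s, ∀ x ∈ Quads 2, ∃ n, A.run s x n = x.cutSubmap := by
  have h1 : ∀ᵐ ω ∂μ, ∀ x ∈ Quads 2, ∃ n, A.run (U ω) x n = x.cutSubmap := by
    rw [ae_ball_iff (Set.to_countable _)]
    intro x hx
    let N : Set S := {s | ∃ n, A.run s x n = x.cutSubmap}
    have hN : MeasurableSet N := by
      have : N = ⋃ n, {s | A.run s x n = x.cutSubmap} := by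
        ext s
        simp [N]
      rw [this]
      exact MeasurableSet.iUnion fun n => measurableSet_run A n x _
    -- By independence, the null event that `Q = x` and the seed fails for `x` has a product
    -- probability. As `Q = x` has positive probability, almost every seed works for `x`, hence for
    -- all the countably many `x` at once.
    have h2 := hind.measure_inter_preimage_eq_mul {x} Nᶜ trivial hN.compl
    have h3 : μ (Q ⁻¹' {x} ∩ U ⁻¹' Nᶜ) = 0 := by
      refine measure_mono_null (fun ω hω => ?_) (ae_iff.1 h)
      have hQx : Q ω = x := hω.1
      rw [Set.mem_ofPred_eq, hQx]
      exact hω.2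
    rw [h3] at h2
    exact (mul_eq_zero.1 h2.symm).resolve_left (hQ.measure_ne_zero hq hx)
  obtain ⟨ω, hω⟩ := h1.exists
  exact ⟨_, hω⟩

end Peeling

theorem mainTheorem9 {Ω : Type*} [MeasurableSpace Ω] (μ : Measure Ω) [IsProbabilityMeasure μ]
    (q : ℝ≥0) (hq : 0 < q) (Q : Ω → MapClass) (hQ : IsBoltzmann μ q 1 Q) :
    (IsQuadFiltration μ (naturalFiltration μ Q) ∧
      IsFBoltzmann μ q (naturalFiltration μ Q) Q ∧
      IsStoppingMap μ (naturalFiltration μ Q) Q (fun ω => (Q ω).cutSubmap) ∧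
      HasMarkovProperty μ q (naturalFiltration μ Q) Q (fun ω => (Q ω).cutSubmap)) ∧
    ∀ (S : Type*) [MeasurableSpace S] (A : PeelingAlgorithm S) (U : Ω → S),
      Measurable U → IndepFun Q U μ →
      ¬ ∀ᵐ ω ∂μ, ∃ n : ℕ, A.run (U ω) (Q ω) n = (Q ω).cutSubmap := by
  have hF := isFBoltzmann_naturalFiltration hq hQ
  refine ⟨⟨isQuadFiltration_naturalFiltration, hF, isStoppingMap_cutSubmap hQ.support,
    hasMarkovProperty_cutSubmap hQ.support hF⟩, fun S _ A U _ hind h => ?_⟩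
  obtain ⟨s, hs⟩ := exists_seed hQ hq A hind h
  refine threeMaps_not_run A s fun i => hs _ ?_
  have hm := threeMaps_isQuadTwo i
  exact MapClass.mem_quads_of_iff.2 ⟨hm.quad, hm.closed, hm.perimeter⟩
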